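/- **Setting.** Let $\mathcal X\subseteq\mathbb R^d$ be compact and convex, contained in an open set $\mathcal O$. Let $\varphi:\mathcal O\times\mathbb R^\ell\to\mathbb R$ be convex (in particular $\mathcal O$ is convex) and $L_\varphi$-Lipschitz for the Euclidean norm. Let $\xi(x)=c(x)+Q(x)\varepsilon$, where $\mathbb E[\varepsilon]=0$, $\mathrm{Cov}(\varepsilon)=\mathbb I_\ell$, $c:\mathcal O\to\mathbb R^\ell$ is $C^1$ with $L_c$-Lipschitz Jacobian, and $Q(x)$ is symmetric positive definite with rows $q_j(x)^\top$, each $q_j:\mathcal O\to\mathbb R^\ell$ being $C^1$ with $L_q$-Lipschitz Jacobian. Put $f(x)=\mathbb E[\varphi(x,c(x)+Q(x)\varepsilon)]$, $\tau=L_\varphi(L_c+\ell L_q)$, $\Delta_0=\max_{x,y\in\mathcal X}(f(x)-f(y))$ and $$L=L_\varphi\Bigl(1+\max_{x\in\mathcal X}\bigl(\|\nabla c(x)\|+\sqrt\ell\sqrt{\textstyle\sum_j\|\nabla q_j(x)\|^2}\bigr)\Bigr).$$ A random point $x\in\mathcal X$ is a $(\nu,\delta)$-NSE point if there is a random $y\in\mathcal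 X$ with $\mathbb E\|x-y\|\le\delta$ and $\mathbb E\,\mathrm{dist}(0,\partial f(y)+\mathcal N_{\mathcal X}(y))\le\nu$, where $\partial f$ is the Clarke subdifferential and $\mathcal N_{\mathcal X}$ the normal cone. **Sampling.** For a reference point $z\in\mathcal X$, a data set $S_n$ of $n$ i.i.d. pairs $(X_i,\xi_i)$ and a data set $W_m$ of $m$ i.i.d. pairs $(Y_i,\eta_i)$ are drawn independently, the second entry of each pair being distributed as $\xi$ at the first entry. *Static oracle*: all $X_i,Y_i$ have one fixed distribution on $\mathcal X$. *Adaptive oracle*: the $X_i$ have a distribution $M(\cdot;z,n)$ on $\mathcal O$, and $Y_i=z$. Let $\widehat c_n(z),\widehat\nabla c_n(z),\widehat q_{j,n}(z),\widehat\nabla q_{j,n}(z)$ be estimators computed from $S_n$, and let $\widehat Q_n(z)$, with rows $\widehat q_{j,n}(z)^\top$, be a.s. invertible. Assume that $\|\varepsilon\|$ is a.s. bounded, that $\|\widehat c_n(z)\|$ is a.s. bounded uniformly in $n>0$, $z\in\mathcal X$, and that for some $r\in(0,1]$, $C>0$ the mean squared errors of $\widehat c_n(z)$, $\widehat\nabla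 c_n(z)$, $\widehat Q_n(z)$, $\widehat\nabla q_{j,n}(z)$, $[\widehat Q_n(z)]^{-1}$ as estimates of $c(z)$, $\nabla c(z)$, $Q(z)$, $\nabla q_j(z)$, $[Q(z)]^{-1}$ are at most $Cn^{-r}$ for all $n>0$, $z\in\mathcal X$. **Surrogates.** With $G(z,e)v=(e^\top\nabla q_j(z)v)_{j}$, put $$\widetilde F_\alpha(x,e;z)=\varphi\bigl(x,\,c(z)+\nabla c(z)(x-z)+Q(z)e+G(z,e)(x-z)\bigr)+\tfrac\alpha2\|x-z\|^2,$$ and let $\widetilde F^m_\alpha(x;z)$ be its average over the residuals $e=[Q(Y_i)]^{-1}(\eta_i-c(Y_i))$, $i\le m$. Let $\widehat F^{n,m}_\alpha(x;z)$ be obtained in the same way, with estimates in place of all true values, Jacobians and residuals. **Algorithm (ALS).** Start at $z^0\in\mathcal X$. For $t=0,\dots,T$ draw fresh samples $S^t_n,W^t_m$ at the reference point $z^t$ and set $z^{t+1}=\arg\min_{z\in\mathcal X}\widehat F^{n,m}_{\alpha_t}(z;z^t)$. Take constant sample sizes $m,n\ge1$, $\rho_t\equiv\rho_0>\tau$ and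 $\alpha_t=\alpha_0(t+1)^b$ with $b\in[0,1]$ and $\alpha_0\ge\rho_0+\tau$. Let $$P_t=\frac{\rho_{t+1}(\rho_t-\tau)}{\alpha_t}-(\rho_{t+1}-\rho_t),\qquad p_t=\frac{P_t}{\sum_{s=0}^TP_s}.$$ The output is $z^{t^*}$, where $t^*\in\{0,\dots,T\}$ is independent of the samples with $\Pr(t^*=t)=p_t$. Let $\widehat z^{\,t}=\arg\min_{y\in\mathcal X}\{f(y)+\frac{\rho_0}2\|y-z^t\|^2\}$ (a unique point). **Claim.** There is $\widetilde C>0$, depending on neither $n,m,\alpha$ nor $z$, such that $$\mathbb E\Bigl[\sup_{x\in\mathcal X}\bigl|\widehat F^{n,m}_\alpha(x;z)-\widetilde F^m_\alpha(x;z)\bigr|\Bigr]\le\widetilde C\,n^{-r/2}\qquad\text{for all } n,m\ge1,\ \alpha>0,\ z\in\mathcal X,$$ and for every such $\widetilde C$ the following hold. Put $$\Delta(T)=2\Delta_0+\sum_{t=0}^T\frac{4\rho_{t+1}L^2}{m\alpha_t^2}+\sum_{t=0}^T\frac{4\rho_{t+1}\widetilde C}{n^{r/2}\alpha_t}.$$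 1. For every $b\in[0,1]$: $\mathbb E\|z^{t^*}-\widehat z^{\,t^*}\|^2\le\Delta(T)/\sum_{t=0}^TP_t$. If moreover $\Delta(T)/\sum_tP_t\le\delta^2$ and $\bigl(\sum_t\rho_t^2P_t\bigr)\Delta(T)/\bigl(\sum_tP_t\bigr)^2\le\nu^2$, then $z^{t^*}$ is a $(\nu,\delta)$-NSE point. Call the least number of iterations $T+1$ for which these two inequalities hold the iteration complexity $N_b(\nu,\delta,n)\in\mathbb N\cup\{\infty\}$ for obtaining a $(\nu,\delta)$-NSE point. 2. The best order of the iteration complexity is attained at $b=1/2$: for every $b\in[0,1]$ there is $K$ with $N_{1/2}(\nu,\delta,n)\le K\,N_b(\nu,\delta,n)$ for all $\nu,\delta>0$, $n\ge1$. If $L_\varphi>0$ and $b\ne1/2$, the order is strictly better: for every $K$ there is $\epsilon>0$ such that $K\,N_{1/2}(\nu,\delta,n)\le N_b(\nu,\delta,n)$ for all $n\ge1$ and all $\nu,\delta>0$ with $\min\{\rho_0\delta,\nu\}\le\epsilon$. 3. For $b=1/2$ and every $T\ge0$: $p_t=(t+1)^{-1/2}/\sum_{s=0}^T(s+1)^{-1/2}$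 for $0\le t\le T$, and $$\mathbb E\|z^{t^*}-\widehat z^{\,t^*}\|^2\le\frac{4\Delta_0\alpha_0}{\rho_0(\rho_0-\tau)}\frac1{\sqrt{T+1}}+\frac{16L^2}{m\alpha_0(\rho_0-\tau)}\frac{\log(T+1)}{\sqrt{T+1}}+\frac{4\widetilde C}{n^{r/2}(\rho_0-\tau)}.$$ -/

import Mathlib

open MeasureTheory ProbabilityTheory Set Filter Topology
open scoped NNReal ENNReal Pointwise

noncomputable section

namespace SPDDU

/-- `ℝᵏ` with its Euclidean norm. -/
abbrev Vec (k : ℕ) : Type := EuclideanSpace ℝ (Fin k)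

/-! ### General notions of optimization -/

/-- The set of minimizers of `g` over `X`. -/
def argminOn {d : ℕ} (g : Vec d → ℝ) (X : Set (Vec d)) : Set (Vec d) :=
  {y | y ∈ X ∧ IsMinOn g X y}

/-- `prox_{lam f}(x)`, the minimizer over `X` of `y ↦ f y + ‖y - x‖² / (2 lam)`. -/
def prox {d : ℕ} (f : Vec d → ℝ) (X : Set (Vec d)) (lam : ℝ) (x : Vec d) : Vec d :=
  Classical.epsilon fun y => y ∈ argminOn (fun y => f y + 1 / (2 * lam) * ‖y - x‖ ^ 2) X

/-- The Clarke subdifferential of a locally Lipschitz function: the convex hull of all limits of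
gradients at points of differentiability that converge to `x`. -/
def clarkeSubdiff {d : ℕ} (f : Vec d → ℝ) (x : Vec d) : Set (Vec d) :=
  convexHull ℝ {g | ∃ y : ℕ → Vec d, (∀ k, DifferentiableAt ℝ f (y k)) ∧
    Tendsto y atTop (𝓝 x) ∧ Tendsto (fun k => gradient f (y k)) atTop (𝓝 g)}

/-- The normal cone to a convex set `A` at a point `a` of `A`. -/
def normalCone {d : ℕ} (A : Set (Vec d)) (a : Vec d) : Set (Vec d) :=
  {v | ∀ a' ∈ A, inner ℝ v (a' - a) ≤ 0}

/-- `(ν, δ)`-near stationarity in expectation of a random point `x` for the minimization of `f`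
over `X`. The expectations are integrals of nonnegative functions. -/
def IsNSE {d : ℕ} {Ω : Type*} [MeasurableSpace Ω] (μ : Measure Ω) (f : Vec d → ℝ)
    (X : Set (Vec d)) (ν δ : ℝ) (x : Ω → Vec d) : Prop :=
  (∀ᵐ ω ∂μ, x ω ∈ X) ∧
  ∃ y : Ω → Vec d, AEMeasurable y μ ∧ (∀ᵐ ω ∂μ, y ω ∈ X) ∧
    ∫⁻ ω, ‖x ω - y ω‖ₑ ∂μ ≤ ENNReal.ofReal δ ∧
    ∫⁻ ω, Metric.infEDist 0 (clarkeSubdiff f (y ω) + normalCone X (y ω)) ∂μ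
      ≤ ENNReal.ofReal ν

/-! ### The stochastic program with decision-dependent uncertainty -/

/-- The matrix with rows `q j`. -/
def rowMatrix {l : ℕ} (q : Fin l → Vec l) : Matrix (Fin l) (Fin l) ℝ :=
  Matrix.of fun j k => q j k

/-- A matrix as an operator on Euclidean space; the norm of this operator is the matrix norm
induced by the `ℓ₂`-norm. -/
def matOp {l : ℕ} (A : Matrix (Fin l) (Fin l) ℝ) : Vec l →L[ℝ] Vec l :=
  Matrix.toEuclideanCLM (𝕜 := ℝ) A

/-- `G(·, e) v`: the vector with entries `eᵀ (dq j) v`, where `dq j` is the Jacobian of `q j`. -/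
def gradRows {d l : ℕ} (dq : Fin l → Vec d →L[ℝ] Vec l) (e : Vec l) (v : Vec d) : Vec l :=
  WithLp.toLp 2 fun j => inner ℝ e (dq j v)

/-- The data of a problem `min_{x ∈ X} 𝔼 φ(x, c(x) + Q(x) ε)`, where `Q(x)` has the rows `q j x`
and `ε` has the distribution `noise`. -/
structure Problem (d l : ℕ) where
  X : Set (Vec d)
  O : Set (Vec d)
  φ : Vec d → Vec l → ℝ
  c : Vec d → Vec l
  q : Fin l → Vec d → Vec l
  noise : Measure (Vec l)
  Lφ : ℝ≥0
  Lc : ℝ≥0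
  Lq : ℝ≥0

namespace Problem

variable {d l : ℕ}

/-- The matrix `Q(x)`. -/
def Q (P : Problem d l) (x : Vec d) : Matrix (Fin l) (Fin l) ℝ :=
  rowMatrix fun j => P.q j x

/-- The standing assumptions on the problem. -/
structure Regular (P : Problem d l) : Prop where
  compact_X : IsCompact P.X
  convex_X : Convex ℝ P.X
  X_subset : P.X ⊆ P.O
  open_O : IsOpen P.O
  convex_cost : ConvexOn ℝ (P.O ×ˢ univ) fun p : Vec d × Vec l => P.φ p.1 p.2
  lipschitz_cost : ∀ x ∈ P.O, ∀ y ∈ P.O, ∀ u v : Vec l,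
    |P.φ x u - P.φ y v| ≤ P.Lφ * Real.sqrt (‖x - y‖ ^ 2 + ‖u - v‖ ^ 2)
  noise_prob : IsProbabilityMeasure P.noise
  noise_memLp : MemLp (fun e : Vec l => e) 2 P.noise
  noise_mean : ∫ e, e ∂P.noise = 0
  noise_cov : ∀ i j : Fin l, ∫ e, e i * e j ∂P.noise = if i = j then 1 else 0
  smooth_c : ContDiffOn ℝ 1 P.c P.O
  lipschitz_dc : LipschitzOnWith P.Lc (fderiv ℝ P.c) P.O
  smooth_q : ∀ j, ContDiffOn ℝ 1 (P.q j) P.O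
  lipschitz_dq : ∀ j, LipschitzOnWith P.Lq (fderiv ℝ (P.q j)) P.O
  posDef_Q : ∀ x ∈ P.O, (P.Q x).PosDef

/-- The objective `f(x) = 𝔼 φ(x, c(x) + Q(x) ε)`. -/
def f (P : Problem d l) (x : Vec d) : ℝ :=
  ∫ e, P.φ x (P.c x + matOp (P.Q x) e) ∂P.noise

/-- The weak convexity modulus `τ = L_φ (L_c + ℓ L_q)`. -/
def τ (P : Problem d l) : ℝ := P.Lφ * (P.Lc + l * P.Lq)

/-- `L = L_φ (1 + max_{x ∈ X} (‖∇c(x)‖ + √ℓ √(∑ⱼ ‖∇qⱼ(x)‖²)))`. -/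
def L (P : Problem d l) : ℝ :=
  P.Lφ * (1 + sSup ((fun x => ‖fderiv ℝ P.c x‖ +
    Real.sqrt l * Real.sqrt (∑ j, ‖fderiv ℝ (P.q j) x‖ ^ 2)) '' P.X))

/-- `Δ₀ = max_{x, y ∈ X} (f x - f y)`. -/
def Δ₀ (P : Problem d l) : ℝ :=
  sSup ((fun p : Vec d × Vec d => P.f p.1 - P.f p.2) '' (P.X ×ˢ P.X))

/-- The law of `(X, ξ)` with `X ∼ κ` and `ξ = c(X) + Q(X) ε`, where `ε` is independent of `X`. -/
def obsLaw (P : Problem d l) (κ : Measure (Vec d)) : Measure (Vec d × Vec l) :=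
  (κ.prod P.noise).map fun p => (p.1, P.c p.1 + matOp (P.Q p.1) p.2)

end Problem

/-! ### Simulation oracles and statistical estimators -/

/-- A data set of `n` pairs. -/
abbrev Dataset (d l n : ℕ) : Type := Fin n → Vec d × Vec l

/-- The static oracle samples from a fixed joint distribution, given by its marginal in `x`. The
adaptive oracle samples the predictors from a distribution `M n z` that depends on the sample
size `n` and on the reference point `z`, and it samples the responses for the residuals at `z`. -/
inductive Oracle (d : ℕ) : Type where
  | static (marginal : Measure (Vec d)) : Oracle d
  | adaptive (M : ℕ → Kernel (Vec d) (Vec d)) : Oracle d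

namespace Oracle

variable {d l : ℕ}

/-- The marginals are probability distributions on the region where sampling makes sense. -/
def Valid (S : Oracle d) (P : Problem d l) : Prop :=
  match S with
  | static κ => IsProbabilityMeasure κ ∧ κ P.Xᶜ = 0
  | adaptive M => ∀ n, IsMarkovKernel (M n) ∧ ∀ z ∈ P.X, M n z P.Oᶜ = 0

/-- The law of one pair of the data set for the statistical estimates. -/
def learnLaw (S : Oracle d) (P : Problem d l) (n : ℕ) (z : Vec d) : Measure (Vec d × Vec l) :=
  match S with
  | static κ => P.obsLaw κ
  | adaptive M => P.obsLaw (M n z)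

/-- The law of one pair of the data set for the residuals. -/
def residLaw (S : Oracle d) (P : Problem d l) (z : Vec d) : Measure (Vec d × Vec l) :=
  match S with
  | static κ => P.obsLaw κ
  | adaptive _ => P.obsLaw (Measure.dirac z)

/-- The law of the data set `S_n` of `n` i.i.d. pairs, at the reference point `z`. -/
def dataLaw (S : Oracle d) (P : Problem d l) (n : ℕ) (z : Vec d) : Measure (Dataset d l n) :=
  Measure.pi fun _ : Fin n => S.learnLaw P n z

/-- The law of the samples `(S_n, W_m)` of one iteration, at the reference point `z`. -/
def batchLaw (S : Oracle d) (P : Problem d l) (n m : ℕ) (z : Vec d) :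
    Measure (Dataset d l n × Dataset d l m) :=
  (S.dataLaw P n z).prod (Measure.pi fun _ : Fin m => S.residLaw P z)

end Oracle

/-- Statistical estimators: `c n s z` estimates `c(z)` from the data set `s` of size `n`, and
likewise for the Jacobian of `c`, for the rows `qⱼ` and for their Jacobians. -/
structure Estimators (d l : ℕ) where
  c : (n : ℕ) → Dataset d l n → Vec d → Vec l
  dc : (n : ℕ) → Dataset d l n → Vec d → (Vec d →L[ℝ] Vec l)
  q : (n : ℕ) → Dataset d l n → Fin l → Vec d → Vec l
  dq : (n : ℕ) → Dataset d l n → Fin l → Vec d → (Vec d →L[ℝ] Vec l)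

namespace Estimators

variable {d l : ℕ}

/-- The estimator of the matrix `Q(z)`. -/
def Q (est : Estimators d l) (n : ℕ) (s : Dataset d l n) (z : Vec d) :
    Matrix (Fin l) (Fin l) ℝ :=
  rowMatrix fun j => est.q n s j z

/-- The estimators are jointly measurable, and the estimated matrices are a.s. invertible. -/
structure Valid (est : Estimators d l) (P : Problem d l) (S : Oracle d) : Prop where
  meas_c : ∀ n, Measurable fun p : Dataset d l n × Vec d => est.c n p.1 p.2
  meas_dc : ∀ n, Measurable fun p : Dataset d l n × Vec d => est.dc n p.1 p.2
  meas_q : ∀ n j, Measurable fun p : Dataset d l n × Vec d => est.q n p.1 j p.2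
  meas_dq : ∀ n j, Measurable fun p : Dataset d l n × Vec d => est.dq n p.1 j p.2
  invertible : ∀ n, 0 < n → ∀ z ∈ P.X, ∀ᵐ s ∂S.dataLaw P n z, IsUnit (est.Q n s z)

/-- The noise is a.s. bounded, and so are the estimates of `c`, uniformly in `n` and `z`. -/
structure Bounded (est : Estimators d l) (P : Problem d l) (S : Oracle d) : Prop where
  noise : ∃ B : ℝ, 0 < B ∧ ∀ᵐ e ∂P.noise, ‖e‖ ≤ B
  estimate : ∃ B : ℝ, 0 < B ∧ ∀ n, 0 < n → ∀ z ∈ P.X, ∀ᵐ s ∂S.dataLaw P n z, ‖est.c n s z‖ ≤ B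

/-- All mean squared errors are at most `C n^{-r}`, uniformly on `X`. -/
structure MSERate (est : Estimators d l) (P : Problem d l) (S : Oracle d) (C r : ℝ) : Prop where
  c : ∀ n, 0 < n → ∀ z ∈ P.X,
    ∫⁻ s, ‖est.c n s z - P.c z‖ₑ ^ 2 ∂S.dataLaw P n z ≤ ENNReal.ofReal (C * (n : ℝ) ^ (-r))
  dc : ∀ n, 0 < n → ∀ z ∈ P.X,
    ∫⁻ s, ‖est.dc n s z - fderiv ℝ P.c z‖ₑ ^ 2 ∂S.dataLaw P n z
      ≤ ENNReal.ofReal (C * (n : ℝ) ^ (-r))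
  Q : ∀ n, 0 < n → ∀ z ∈ P.X,
    ∫⁻ s, ‖matOp (est.Q n s z - P.Q z)‖ₑ ^ 2 ∂S.dataLaw P n z
      ≤ ENNReal.ofReal (C * (n : ℝ) ^ (-r))
  dq : ∀ n, 0 < n → ∀ j, ∀ z ∈ P.X,
    ∫⁻ s, ‖est.dq n s j z - fderiv ℝ (P.q j) z‖ₑ ^ 2 ∂S.dataLaw P n z
      ≤ ENNReal.ofReal (C * (n : ℝ) ^ (-r))
  Qinv : ∀ n, 0 < n → ∀ z ∈ P.X,
    ∫⁻ s, ‖matOp ((est.Q n s z)⁻¹ - (P.Q z)⁻¹)‖ₑ ^ 2 ∂S.dataLaw P n z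
      ≤ ENNReal.ofReal (C * (n : ℝ) ^ (-r))

end Estimators

/-! ### Surrogate functions -/

section Surrogates

variable {d l : ℕ}

/-- The prox-linear model
`φ(x, c₀ + dc₀ (x - z) + Q₀ e + G₀(e) (x - z)) + (α / 2) ‖x - z‖²`. -/
def linModel (P : Problem d l) (c₀ : Vec l) (dc₀ : Vec d →L[ℝ] Vec l) (q₀ : Fin l → Vec l)
    (dq₀ : Fin l → Vec d →L[ℝ] Vec l) (α : ℝ) (z : Vec d) (e : Vec l) (x : Vec d) : ℝ :=
  P.φ x (c₀ + dc₀ (x - z) + matOp (rowMatrix q₀) e + gradRows dq₀ e (x - z))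
    + α / 2 * ‖x - z‖ ^ 2

/-- The conceptual surrogate, from the true values and Jacobians at `z`. -/
def concept (P : Problem d l) (α : ℝ) (z : Vec d) (e : Vec l) (x : Vec d) : ℝ :=
  linModel P (P.c z) (fderiv ℝ P.c z) (fun j => P.q j z) (fun j => fderiv ℝ (P.q j) z) α z e x

/-- The learning-based surrogate, from the estimates at `z`. -/
def learned (P : Problem d l) (est : Estimators d l) {n : ℕ} (s : Dataset d l n)
    (α : ℝ) (z : Vec d) (e : Vec l) (x : Vec d) : ℝ :=
  linModel P (est.c n s z) (est.dc n s z) (fun j => est.q n s j z) (fun j => est.dq n s j z)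
    α z e x

/-- The true residual `Q(Y)⁻¹ (η - c(Y))`. -/
def trueResid (P : Problem d l) (w : Vec d × Vec l) : Vec l :=
  matOp (P.Q w.1)⁻¹ (w.2 - P.c w.1)

/-- The empirical residual, with estimates in place of `Q(Y)` and `c(Y)`. -/
def empResid (est : Estimators d l) {n : ℕ} (s : Dataset d l n) (w : Vec d × Vec l) : Vec l :=
  matOp (est.Q n s w.1)⁻¹ (w.2 - est.c n s w.1)

/-- The conceptual mini-batch surrogate, at the true residuals of the data set `w`. -/
def conceptBatch (P : Problem d l) {m : ℕ} (w : Dataset d l m) (α : ℝ) (z x : Vec d) : ℝ :=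
  1 / (m : ℝ) * ∑ i, concept P α z (trueResid P (w i)) x

/-- The learning-based mini-batch surrogate, at the empirical residuals of the data set `w`. -/
def learnedBatch (P : Problem d l) (est : Estimators d l) {n m : ℕ} (s : Dataset d l n)
    (w : Dataset d l m) (α : ℝ) (z x : Vec d) : ℝ :=
  1 / (m : ℝ) * ∑ i, learned P est s α z (empResid est s (w i)) x

/-- `C n^{-r/2}` bounds the expected uniform error of the learning-based mini-batch surrogate, for
all reference points, all sample sizes and all proximal parameters. -/
def SurrogateErrorBound (P : Problem d l) (S : Oracle d) (est : Estimators d l) (r C : ℝ) : Prop :=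
  ∀ n m : ℕ, 0 < n → 0 < m → ∀ α : ℝ, 0 < α → ∀ z ∈ P.X,
    ∫⁻ D, ⨆ x ∈ P.X, ‖learnedBatch P est D.1 D.2 α z x - conceptBatch P D.2 α z x‖ₑ
        ∂S.batchLaw P n m z
      ≤ ENNReal.ofReal (C * (n : ℝ) ^ (-(r / 2)))

end Surrogates

/-! ### The ALS algorithm -/

section Algorithm

variable {d l : ℕ}

/-- The σ-algebra of the samples drawn before iteration `t`. -/
abbrev history {Ω : Type*} {n m : ℕ} (D : ℕ → Ω → Dataset d l n × Dataset d l m) (t : ℕ) :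
    MeasurableSpace Ω :=
  ⨆ s : ℕ, ⨆ _ : s < t, MeasurableSpace.comap (D s) inferInstance

/-- `z` are the iterates and `D t` the samples of `T + 1` iterations (`t = 0, …, T`) of the
algorithm, with sample sizes `n`, `m`, proximal parameters `α t` and starting point `z₀`. Given
the past, the samples of iteration `t` are drawn by the oracle at the reference point `z t`. -/
structure IsRun (P : Problem d l) (S : Oracle d) (est : Estimators d l) (n m : ℕ) (α : ℕ → ℝ)
    (T : ℕ) (z₀ : Vec d) {Ω : Type*} [MeasurableSpace Ω] (μ : Measure Ω)
    (D : ℕ → Ω → Dataset d l n × Dataset d l m) (z : ℕ → Ω → Vec d) : Prop where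
  start_mem : z₀ ∈ P.X
  start : ∀ ω, z 0 ω = z₀
  meas_samples : ∀ t ≤ T, Measurable (D t)
  meas_iterate : ∀ t ≤ T, Measurable[history D t] (z t)
  sampling : ∀ t ≤ T, ∀ A : Set Ω, MeasurableSet[history D t] A →
    ∀ U : Set (Dataset d l n × Dataset d l m), MeasurableSet U →
      μ (A ∩ D t ⁻¹' U) = ∫⁻ ω in A, S.batchLaw P n m (z t ω) U ∂μ
  step : ∀ t ≤ T, ∀ ω,
    z (t + 1) ω ∈ argminOn (learnedBatch P est (D t ω).1 (D t ω).2 (α t) (z t ω)) P.X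

/-- The output index: `tstar` has the distribution `p` on `{0, …, T}` and is independent of all
samples. -/
structure IsOutputIndex {Ω : Type*} [MeasurableSpace Ω] (μ : Measure Ω) {n m : ℕ}
    (D : ℕ → Ω → Dataset d l n × Dataset d l m) (T : ℕ) (p : ℕ → ℝ) (tstar : Ω → ℕ) : Prop where
  meas : Measurable tstar
  dist : ∀ t ≤ T, μ (tstar ⁻¹' {t}) = ENNReal.ofReal (p t)
  indep : Indep (MeasurableSpace.comap tstar ⊤) (history D (T + 1)) μ

end Algorithm

/-! ### The guarantee and the iteration complexity it yields -/

/-- The averaging weight `P_t = ρ_{t+1} (ρ_t - τ) / α_t - (ρ_{t+1} - ρ_t)`. -/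
def weight (τ : ℝ) (ρ α : ℕ → ℝ) (t : ℕ) : ℝ :=
  ρ (t + 1) * (ρ t - τ) / α t - (ρ (t + 1) - ρ t)

/-- The averaging probability `p_t = P_t / ∑_{s ≤ T} P_s`. -/
def polyak (τ : ℝ) (ρ α : ℕ → ℝ) (T t : ℕ) : ℝ :=
  weight τ ρ α t / ∑ s ∈ Finset.range (T + 1), weight τ ρ α s

section Complexity

variable {d l : ℕ}

/-- `Δ(T) = 2 Δ₀ + ∑_{t ≤ T} 4 ρ_{t+1} L² / (m α_t²) + ∑_{t ≤ T} 4 ρ_{t+1} C / (n^{r/2} α_t)`. -/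
def errorSum (P : Problem d l) (C r : ℝ) (n m : ℕ) (ρ α : ℕ → ℝ) (T : ℕ) : ℝ :=
  2 * P.Δ₀ + ∑ t ∈ Finset.range (T + 1), 4 * ρ (t + 1) * P.L ^ 2 / (m * α t ^ 2)
    + ∑ t ∈ Finset.range (T + 1), 4 * ρ (t + 1) * C / ((n : ℝ) ^ (r / 2) * α t)

/-- The guaranteed bound `Δ(T) / ∑ P_t` on `𝔼 ‖z - ẑ‖²` for the output `z` of `T + 1`
iterations. -/
def guarantee (P : Problem d l) (C r : ℝ) (n m : ℕ) (ρ α : ℕ → ℝ) (T : ℕ) : ℝ :=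
  errorSum P C r n m ρ α T / ∑ t ∈ Finset.range (T + 1), weight P.τ ρ α t

/-- The guaranteed bound `(∑ ρ_t² P_t) Δ(T) / (∑ P_t)²` on `𝔼 ρ² 𝔼 ‖z - ẑ‖²`. -/
def scaledGuarantee (P : Problem d l) (C r : ℝ) (n m : ℕ) (ρ α : ℕ → ℝ) (T : ℕ) : ℝ :=
  (∑ t ∈ Finset.range (T + 1), ρ t ^ 2 * weight P.τ ρ α t) * errorSum P C r n m ρ α T
    / (∑ t ∈ Finset.range (T + 1), weight P.τ ρ α t) ^ 2

/-- The guarantee for `T + 1` iterations is small enough for `(ν, δ)`-near stationarity. -/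
def Certified (P : Problem d l) (C r : ℝ) (n m : ℕ) (ρ α : ℕ → ℝ) (ν δ : ℝ) (T : ℕ) : Prop :=
  guarantee P C r n m ρ α T ≤ δ ^ 2 ∧ scaledGuarantee P C r n m ρ α T ≤ ν ^ 2

/-- The iteration complexity for a `(ν, δ)`-nearly stationary point: the least number `T + 1` of
iterations whose guarantee suffices (`⊤` if there is none). -/
def iterComplexity (P : Problem d l) (C r : ℝ) (n m : ℕ) (ρ α : ℕ → ℝ) (ν δ : ℝ) : ℕ∞ :=
  ⨅ T : ℕ, ⨅ _ : Certified P C r n m ρ α ν δ T, ((T + 1 : ℕ) : ℕ∞)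

end Complexity

/-- The proximal parameters `α_t = α₀ (t + 1)^b`. -/
def powerSeq (α₀ b : ℝ) (t : ℕ) : ℝ := α₀ * ((t : ℝ) + 1) ^ b

/-- The constant sequence `ρ_t = ρ₀`. -/
def constSeq (ρ₀ : ℝ) (_ : ℕ) : ℝ := ρ₀

end SPDDU

end

noncomputable section

namespace SPDDU

/-! ### Minimization over compact convex sets -/

/-! The potential function is the Moreau envelope of `f` over `X` with parameter `ρ₀`. The expected
prox-linear model at `z` is convex, as a mean of convex functions of affine maps, and it differs
from `f` by at most `τ/2 ‖x - z‖²` on either side (`Problem.Regular.abs_model_sub_le`). This makes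
`f` weakly convex with modulus `τ`. So for `ρ₀ > τ` the proximal point is unique and Lipschitz in
its center, and the envelope decreases at every point that nearly minimizes the model plus `α/2 ‖x -
z‖²`, by a multiple of the squared distance from `z` to its proximal point
(`Problem.Regular.envelope_le_of_model`).

The algorithm minimizes an empirical average of learned models instead. With the data set of the
estimates fixed, these are convex functions that are uniformly close to Lipschitz ones.
`integral_excess_le` compares them with the population model by a ghost sample: the proximal term
makes the minimizer stable, so exchanging one of `m` samples has an effect of order `1/(m α)`. The
price of sampling is `2 L²/(m α)`, and the learning error enters additively, through the uniform
surrogate gap. Conditioning on the past, multiplying the descent at step `t` by `(α t + ρ₀ - τ)/α t`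
and summing by parts gives the weighted bound `IsRun.sum_weight_mul_le`; an independent index with
the weights as probabilities turns it into the guarantee.

Small distances to proximal points mean near stationarity, because `ρ₀ (z - ẑ)` bounds the distance
from `0` to the Clarke subdifferential plus the normal cone at the proximal point `ẑ`
(`Problem.Regular.infEDist_prox_le`). Directional optimality is tested by limits of gradients, a
different one for each direction, and Sion's minimax theorem replaces them by a single one.

A surrogate error bound exists because the gap at one residual is controlled by terms linear in the
estimation errors and products of two of them. Boundedness of the noise and of the estimates of `c`
excludes higher products, so second moments of order `n^{-r}` suffice for a rate `n^{-r/2}`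
(`combination_le`).

For constant `ρ` the guarantee equals `(A + B S(2b)) / S(b)` plus a term free of `T` and `b`, where
`S` denotes partial sums of powers. The quotient is at least of order `N^{-γ}` with some `γ < 1/2`
if `b ≠ 1/2`, and of order at most `log N / √N` if `b = 1/2`. That gap in exponents gives both
statements on the iteration complexity, uniformly in `n`. -/

lemma norm_lineMap_sub_sq {E : Type*} [NormedAddCommGroup E] [InnerProductSpace ℝ E]
    (x y z : E) (t : ℝ) :
    ‖(1 - t) • y + t • x - z‖ ^ 2
      = (1 - t) * ‖y - z‖ ^ 2 + t * ‖x - z‖ ^ 2 - t * (1 - t) * ‖x - y‖ ^ 2 := by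
  have h1 : (1 - t) • y + t • x - z = (1 - t) • (y - z) + t • (x - z) := by
    simp only [smul_sub, sub_smul, one_smul]; abel
  have h2 : x - y = (x - z) - (y - z) := by abel
  rw [h1, h2, norm_add_sq_real, norm_sub_sq_real (x - z), norm_smul, norm_smul, mul_pow, mul_pow,
    inner_smul_left, inner_smul_right, real_inner_comm (x - z)]
  simp only [Real.norm_eq_abs, sq_abs, conj_trivial]
  ring

/-- Quadratic growth of a convex function plus a proximal term away from its minimizer. -/
lemma argminOn_growth {d : ℕ} {X : Set (Vec d)} {h : Vec d → ℝ} (hh : ConvexOn ℝ X h)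
    {α : ℝ} {z y x : Vec d}
    (hy : y ∈ argminOn (fun x => h x + α / 2 * ‖x - z‖ ^ 2) X) (hx : x ∈ X) :
    h y + α / 2 * ‖y - z‖ ^ 2 + α / 2 * ‖x - y‖ ^ 2 ≤ h x + α / 2 * ‖x - z‖ ^ 2 := by
  obtain ⟨hyX, hmin⟩ := hy
  -- Comparison with the point at fraction `t` of the segment from `y` to `x`, divided by `t`, gives
  -- the growth term up to the factor `1 - t`; the limit `t → 0` removes it.
  have key : ∀ t ∈ Ioo (0 : ℝ) 1, h y + α / 2 * ‖y - z‖ ^ 2 + α / 2 * (1 - t) * ‖x - y‖ ^ 2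
      ≤ h x + α / 2 * ‖x - z‖ ^ 2 := by
    rintro t ⟨ht0, ht1⟩
    have hmem : (1 - t) • y + t • x ∈ X := hh.1 hyX hx (by linarith) ht0.le (by ring)
    have h1 := hh.2 hyX hx (by linarith : 0 ≤ 1 - t) ht0.le (by ring)
    have h2 := isMinOn_iff.1 hmin _ hmem
    simp only [norm_lineMap_sub_sq] at h2
    simp only [smul_eq_mul] at h1
    have : 0 ≤ t * (h x + α / 2 * ‖x - z‖ ^ 2
        - (h y + α / 2 * ‖y - z‖ ^ 2 + α / 2 * (1 - t) * ‖x - y‖ ^ 2)) := by nlinarith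
    nlinarith [(mul_nonneg_iff_of_pos_left ht0).1 this]
  have hlim : Tendsto (fun t : ℝ => h y + α / 2 * ‖y - z‖ ^ 2 + α / 2 * (1 - t) * ‖x - y‖ ^ 2)
      (𝓝[>] 0) (𝓝 (h y + α / 2 * ‖y - z‖ ^ 2 + α / 2 * (1 - 0) * ‖x - y‖ ^ 2)) := by
    apply Tendsto.mono_left _ nhdsWithin_le_nhds
    apply Continuous.tendsto
    fun_prop
  rw [sub_zero, mul_one] at hlim
  refine le_of_tendsto hlim ?_
  filter_upwards [Ioo_mem_nhdsGT (zero_lt_one : (0 : ℝ) < 1)] with t ht using key t ht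

/-- Compactness yields a minimizer, and quadratic growth away from any minimizer forces two of them
to coincide. -/
lemma exists_argminOn_eq_singleton {d : ℕ} {X : Set (Vec d)} (hX : IsCompact X)
    (hne : X.Nonempty) {h : Vec d → ℝ} (hh : ConvexOn ℝ X h) (hc : ContinuousOn h X)
    {α : ℝ} (hα : 0 < α) (z : Vec d) :
    ∃ y, argminOn (fun x => h x + α / 2 * ‖x - z‖ ^ 2) X = {y} := by
  have hc' : ContinuousOn (fun x => h x + α / 2 * ‖x - z‖ ^ 2) X := by fun_prop
  obtain ⟨y, hyX, hy⟩ := hX.exists_isMinOn hne hc'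
  refine ⟨y, Subset.antisymm ?_ (by rintro _ rfl; exact ⟨hyX, hy⟩)⟩
  intro w hw
  have h1 := argminOn_growth hh hw hyX
  have h2 := isMinOn_iff.1 hy _ hw.1
  have h3 : ‖y - w‖ ^ 2 ≤ 0 := by nlinarith [sq_nonneg ‖y - w‖]
  have h4 : ‖y - w‖ = 0 := by nlinarith [norm_nonneg (y - w)]
  rw [norm_eq_zero, sub_eq_zero] at h4
  exact h4.symm

/-! ### Measurability of suprema and minimizers -/

lemma exists_countable_subset_dense {E : Type*} [TopologicalSpace E] [SecondCountableTopology E]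
    (X : Set E) : ∃ D : Set E, D.Countable ∧ D ⊆ X ∧ X ⊆ closure D := by
  obtain ⟨u, hu, hd⟩ := TopologicalSpace.exists_countable_dense X
  refine ⟨Subtype.val '' u, hu.image _, by rintro _ ⟨x, _, rfl⟩; exact x.2, fun x hx => ?_⟩
  have := hd ⟨x, hx⟩
  rwa [closure_subtype] at this

/-- Makes uniform errors measurable: the supremum becomes a countable one. -/
lemma biSup_eq_of_dense {E : Type*} [TopologicalSpace E] {X D : Set E} (hDX : D ⊆ X)
    (hXD : X ⊆ closure D) {F : E → ℝ≥0∞} (hF : ContinuousOn F X) :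
    ⨆ x ∈ X, F x = ⨆ x ∈ D, F x := by
  refine le_antisymm (iSup₂_le fun x hx => ?_) (biSup_mono hDX)
  have h1 : Tendsto F (𝓝[D] x) (𝓝 (F x)) := (hF x hx).mono_left (nhdsWithin_mono _ hDX)
  have : (𝓝[D] x).NeBot := mem_closure_iff_nhdsWithin_neBot.1 (hXD hx)
  refine le_of_tendsto h1 ?_
  filter_upwards [self_mem_nhdsWithin] with y hy
  exact le_iSup₂ (f := fun y _ => F y) y hy

lemma aemeasurable_biSup_of_continuousOn {E Ω : Type*} [TopologicalSpace E]
    [SecondCountableTopology E] [MeasurableSpace Ω] {μ : Measure Ω} {X : Set E}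
    {F : Ω → E → ℝ≥0∞} (hc : ∀ ω, ContinuousOn (F ω) X)
    (hm : ∀ x ∈ X, AEMeasurable (fun ω => F ω x) μ) :
    AEMeasurable (fun ω => ⨆ x ∈ X, F ω x) μ := by
  obtain ⟨D, hD, hDX, hXD⟩ := exists_countable_subset_dense X
  simp_rw [fun ω => biSup_eq_of_dense hDX hXD (hc ω)]
  exact AEMeasurable.biSup D hD fun x hx => hm x (hDX hx)

/-- The minimizer lies in a closed set `F` exactly when, for every tolerance, some point of a
countable dense subset of `X ∩ F` is optimal up to that tolerance against a countable dense subset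
of `X`. For the converse direction, a minimizer over the compact set `X ∩ F` is then a global one,
hence the unique one. -/
lemma measurable_argmin {d : ℕ} {Ω : Type*} [MeasurableSpace Ω] {X : Set (Vec d)}
    (hX : IsCompact X) {g : Ω → Vec d → ℝ} (hc : ∀ ω, ContinuousOn (g ω) X)
    (hm : ∀ x ∈ X, Measurable fun ω => g ω x) {A : Ω → Vec d}
    (hA : ∀ ω, argminOn (g ω) X = {A ω}) : Measurable A := by
  refine measurable_of_isClosed fun F hF => ?_
  obtain ⟨D, hD, hDX, hXD⟩ := exists_countable_subset_dense X
  obtain ⟨D', hD', hDX', hXD'⟩ := exists_countable_subset_dense (X ∩ F)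
  have hXF : IsCompact (X ∩ F) := hX.inter_right hF
  have hAm : ∀ ω, A ω ∈ argminOn (g ω) X := fun ω => by rw [hA]; rfl
  have key : A ⁻¹' F = ⋂ k : ℕ, ⋃ y ∈ D', ⋂ x ∈ D, {ω | g ω y ≤ g ω x + 1 / ((k : ℝ) + 1)} := by
    ext ω
    simp only [mem_preimage, mem_iInter, mem_iUnion, mem_ofPred_eq, exists_prop]
    constructor
    · intro hω k
      have hmem : A ω ∈ X ∩ F := ⟨(hAm ω).1, hω⟩
      have hcon : Tendsto (g ω) (𝓝[D'] (A ω)) (𝓝 (g ω (A ω))) :=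
        (hc ω _ hmem.1).mono_left (nhdsWithin_mono _ (hDX'.trans inter_subset_left))
      have : (𝓝[D'] (A ω)).NeBot := mem_closure_iff_nhdsWithin_neBot.1 (hXD' hmem)
      have hpos : g ω (A ω) < g ω (A ω) + 1 / ((k : ℝ) + 1) := by
        have : 0 < 1 / ((k : ℝ) + 1) := by positivity
        linarith
      obtain ⟨y, hy1, hy2⟩ := ((hcon.eventually (gt_mem_nhds hpos)).and self_mem_nhdsWithin).exists
      refine ⟨y, hy2, fun x hx => ?_⟩
      have := isMinOn_iff.1 (hAm ω).2 x (hDX hx)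
      linarith
    · intro h
      have hne : (X ∩ F).Nonempty := by
        obtain ⟨y, hy, -⟩ := h 0
        exact ⟨y, hDX' hy⟩
      obtain ⟨y₀, hy₀, hmin⟩ := hXF.exists_isMinOn hne ((hc ω).mono inter_subset_left)
      have hle : ∀ x ∈ X, g ω y₀ ≤ g ω x := by
        intro x hx
        have h1 : ∀ x ∈ D, g ω y₀ ≤ g ω x := by
          intro x hx
          refine le_of_forall_pos_lt_add fun ε hε => ?_
          obtain ⟨k, hk⟩ := exists_nat_one_div_lt hε
          obtain ⟨y, hy, hy'⟩ := h k
          have := isMinOn_iff.1 hmin y (hDX' hy)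
          have := hy' x hx
          linarith
        have hcon : Tendsto (g ω) (𝓝[D] x) (𝓝 (g ω x)) :=
          (hc ω _ hx).mono_left (nhdsWithin_mono _ hDX)
        have : (𝓝[D] x).NeBot := mem_closure_iff_nhdsWithin_neBot.1 (hXD hx)
        exact ge_of_tendsto hcon (by filter_upwards [self_mem_nhdsWithin] with y hy using h1 y hy)
      have : y₀ ∈ argminOn (g ω) X := ⟨hy₀.1, isMinOn_iff.2 hle⟩
      rw [hA] at this
      rw [← (this : y₀ = A ω)]
      exact hy₀.2
  rw [key]
  refine MeasurableSet.iInter fun k => MeasurableSet.biUnion hD' fun y hy =>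
    MeasurableSet.biInter hD fun x hx => measurableSet_le (hm y (hDX' hy).1) ?_
  exact (hm x (hDX hx)).add_const _

/-! ### First-order expansion with Lipschitz derivative -/

/-- Along the segment from `z` with direction `v = x - z`, the remainder has a derivative of norm at
most `K t ‖v‖²`, whose integral over `[0, 1]` is the bound. -/
lemma norm_sub_fderiv_le {d l : ℕ} {O : Set (Vec d)} (hO : IsOpen O) (hOc : Convex ℝ O)
    {c : Vec d → Vec l} (hc : ContDiffOn ℝ 1 c O) {K : ℝ≥0}
    (hK : LipschitzOnWith K (fderiv ℝ c) O) {x z : Vec d} (hx : x ∈ O) (hz : z ∈ O) :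
    ‖c x - c z - fderiv ℝ c z (x - z)‖ ≤ K / 2 * ‖x - z‖ ^ 2 := by
  set v := x - z
  have hseg : ∀ t ∈ Icc (0 : ℝ) 1, z + t • v ∈ O := fun t ht => by
    have : z + t • v = (1 - t) • z + t • x := by simp only [v, smul_sub, sub_smul, one_smul]; abel
    rw [this]
    exact hOc hz hx (by linarith [ht.2]) ht.1 (by ring)
  have hder : ∀ t ∈ Icc (0 : ℝ) 1, HasDerivAt (fun t : ℝ => c (z + t • v) - c z - t • fderiv ℝ c z v)
      (fderiv ℝ c (z + t • v) v - fderiv ℝ c z v) t := fun t ht => by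
    have h1 : HasFDerivAt c (fderiv ℝ c (z + t • v)) (z + t • v) :=
      ((hc.differentiableOn one_ne_zero).differentiableAt (hO.mem_nhds (hseg t ht))).hasFDerivAt
    have h2 : HasDerivAt (fun t : ℝ => z + t • v) v t := by
      simpa using ((hasDerivAt_id t).smul_const v).const_add z
    have h3 : HasDerivAt (fun t : ℝ => t • fderiv ℝ c z v) (fderiv ℝ c z v) t := by
      simpa using (hasDerivAt_id t).smul_const (fderiv ℝ c z v)
    exact ((h1.comp_hasDerivAt t h2).sub_const (c z)).sub h3
  have hB : ∀ t : ℝ, HasDerivAt (fun t : ℝ => K / 2 * ‖v‖ ^ 2 * t ^ 2) (K * ‖v‖ ^ 2 * t) t := by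
    intro t
    exact ((hasDerivAt_pow 2 t).const_mul (K / 2 * ‖v‖ ^ 2 : ℝ)).congr_deriv (by norm_num; ring)
  have := image_norm_le_of_norm_deriv_right_le_deriv_boundary
    (f := fun t : ℝ => c (z + t • v) - c z - t • fderiv ℝ c z v) (a := 0) (b := 1)
    (fun t ht => (hder t ht).continuousAt.continuousWithinAt)
    (fun t ht => (hder t (Ico_subset_Icc_self ht)).hasDerivWithinAt) (by simp) hB
    (fun t ht => by
      have h1 := hK.norm_sub_le (hseg t (Ico_subset_Icc_self ht)) hz
      rw [add_sub_cancel_left, norm_smul, Real.norm_of_nonneg ht.1] at h1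
      calc ‖fderiv ℝ c (z + t • v) v - fderiv ℝ c z v‖
          = ‖(fderiv ℝ c (z + t • v) - fderiv ℝ c z) v‖ := rfl
        _ ≤ ‖fderiv ℝ c (z + t • v) - fderiv ℝ c z‖ * ‖v‖ := ContinuousLinearMap.le_opNorm _ _
        _ ≤ K * (t * ‖v‖) * ‖v‖ := by gcongr
        _ = K * ‖v‖ ^ 2 * t := by ring) (right_mem_Icc.2 zero_le_one)
  simpa [v] using this

/-! ### Partial sums of powers -/

/-- `∑_{t ≤ N} t^{-b}`. -/
def powerSum (b : ℝ) (N : ℕ) : ℝ := ∑ t ∈ Finset.range N, ((t : ℝ) + 1) ^ (-b)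

lemma one_le_powerSum (b : ℝ) {N : ℕ} (hN : 0 < N) : 1 ≤ powerSum b N := by
  have := Finset.single_le_sum (f := fun t : ℕ => ((t : ℝ) + 1) ^ (-b)) (s := Finset.range N)
    (fun t _ => by positivity) (Finset.mem_range.2 hN)
  simpa [powerSum] using this

lemma powerSum_anti {b b' : ℝ} (h : b' ≤ b) (N : ℕ) : powerSum b N ≤ powerSum b' N :=
  Finset.sum_le_sum fun t _ => Real.rpow_le_rpow_of_exponent_le
    (by linarith [(Nat.cast_nonneg t : (0 : ℝ) ≤ t)]) (by linarith)

lemma le_powerSum {b : ℝ} (hb : 0 ≤ b) (N : ℕ) : (N : ℝ) * (N : ℝ) ^ (-b) ≤ powerSum b N := by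
  have : ∀ t ∈ Finset.range N, (N : ℝ) ^ (-b) ≤ ((t : ℝ) + 1) ^ (-b) := fun t ht => by
    apply Real.rpow_le_rpow_of_nonpos (by positivity) _ (by linarith)
    exact_mod_cast Finset.mem_range.1 ht
  simpa [powerSum] using Finset.sum_le_sum this

/-- Cauchy–Schwarz; it bounds `S(2b) / S(b)` from below when `b < 1/2`. -/
lemma powerSum_sq_le (b : ℝ) (N : ℕ) : powerSum b N ^ 2 ≤ N * powerSum (2 * b) N := by
  have h := sq_sum_le_card_mul_sum_sq (s := Finset.range N)
    (f := fun t : ℕ => ((t : ℝ) + 1) ^ (-b))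
  rw [Finset.card_range] at h
  refine h.trans_eq ?_
  congr 1
  refine Finset.sum_congr rfl fun t _ => ?_
  rw [← Real.rpow_natCast, ← Real.rpow_mul (by positivity)]
  congr 1
  push_cast
  ring

/-- Induction. Bernoulli's inequality `(1 - 1/(N+1))^γ ≤ 1 - γ/(N+1)` says that the new term is at
most the increment of `N^γ / γ`. -/
lemma powerSum_le_rpow {γ : ℝ} (h0 : 0 < γ) (h1 : γ ≤ 1) (N : ℕ) :
    powerSum (1 - γ) N ≤ (N : ℝ) ^ γ / γ := by
  induction N with
  | zero => simp [powerSum, Real.zero_rpow h0.ne']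
  | succ N ih =>
    rw [powerSum, Finset.sum_range_succ]
    change powerSum (1 - γ) N + _ ≤ _
    have hN : (0 : ℝ) < (N : ℝ) + 1 := by positivity
    have hb := rpow_one_add_le_one_add_mul_self (s := -1 / ((N : ℝ) + 1)) (p := γ)
      (by rw [le_div_iff₀ hN]; linarith [(Nat.cast_nonneg N : (0 : ℝ) ≤ N)]) h0.le h1
    have e1 : 1 + -1 / ((N : ℝ) + 1) = N / ((N : ℝ) + 1) := by field_simp; ring
    rw [e1, Real.div_rpow (by positivity) hN.le, div_le_iff₀ (by positivity)] at hb
    have e2 : ((N : ℝ) + 1) ^ (-(1 - γ)) = ((N : ℝ) + 1) ^ γ / ((N : ℝ) + 1) := by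
      rw [neg_sub, Real.rpow_sub hN, Real.rpow_one]
    rw [e2, le_div_iff₀ h0]
    rw [le_div_iff₀ h0] at ih
    push_cast
    have e3 : (1 + γ * (-1 / ((N : ℝ) + 1))) * ((N : ℝ) + 1) ^ γ
      = ((N : ℝ) + 1) ^ γ - ((N : ℝ) + 1) ^ γ / ((N : ℝ) + 1) * γ := by ring
    rw [e3] at hb
    linarith

lemma powerSum_one_le (N : ℕ) : powerSum 1 N ≤ 1 + Real.log N := by
  have := harmonic_le_one_add_log N
  refine le_trans (le_of_eq ?_) this
  rw [powerSum, harmonic]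
  push_cast
  exact Finset.sum_congr rfl fun t _ => Real.rpow_neg_one _

lemma powerSum_half_ge {N : ℕ} : Real.sqrt N ≤ powerSum (1 / 2) N := by
  rcases Nat.eq_zero_or_pos N with rfl | hN
  · simp [powerSum]
  · refine le_trans (le_of_eq ?_) (le_powerSum (by norm_num) N)
    have hN' : (0 : ℝ) < N := by exact_mod_cast hN
    nth_rewrite 2 [← Real.rpow_one (N : ℝ)]
    rw [← Real.rpow_add hN', Real.sqrt_eq_rpow]
    norm_num

/-! ### Growth of the guarantee -/

/-- The part of the guarantee for `N` iterations that depends on `N`. -/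
def decay (A B b : ℝ) (N : ℕ) : ℝ := (A + B * powerSum (2 * b) N) / powerSum b N

/-- For `b < 1/2` the sampling term dominates: `S(2b) / S(b) ≥ S(b) / N ≥ N^{-b}`. For `b > 1/2` the
denominator grows too slowly: `S(2b) ≥ 1`, while `S(b)` is at most of order `N^γ` with `γ` about `1
- b`. -/
lemma decay_lower {A B b : ℝ} (hA : 0 ≤ A) (hB : 0 < B) (hb : b ∈ Icc (0 : ℝ) 1)
    (hb2 : b ≠ 1 / 2) :
    ∃ c γ : ℝ, 0 < c ∧ 0 ≤ γ ∧ γ < 1 / 2 ∧ ∀ N : ℕ, 0 < N → c * (N : ℝ) ^ (-γ) ≤ decay A B b N := by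
  rcases lt_or_gt_of_ne hb2 with hlt | hgt
  · refine ⟨B, b, hB, hb.1, hlt, fun N hN => ?_⟩
    have hN' : (0 : ℝ) < N := by exact_mod_cast hN
    have hS := one_le_powerSum b hN
    rw [decay, le_div_iff₀ (by linarith)]
    have h1 := powerSum_sq_le b N
    have h2 := le_powerSum hb.1 N
    have h3 : (N : ℝ) * ((N : ℝ) ^ (-b) * powerSum b N) ≤ N * powerSum (2 * b) N := by
      nlinarith
    have h4 := le_of_mul_le_mul_left h3 hN'
    nlinarith
  -- The cap `3/4` keeps `γ` positive at `b = 1`, where `S(b)` grows logarithmically and `N^γ / γ`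
  -- is still a valid bound.
  · set γ := 1 - min b (3 / 4) with hγ
    have hγ0 : 0 < γ := by
      have := min_le_right b (3 / 4); linarith
    have hγ1 : γ < 1 / 2 := by
      have : 1 / 2 < min b (3 / 4) := lt_min hgt (by norm_num)
      linarith
    refine ⟨B * γ, γ, by positivity, hγ0.le, hγ1, fun N hN => ?_⟩
    have hN' : (0 : ℝ) < N := by exact_mod_cast hN
    have hS := one_le_powerSum b hN
    rw [decay, le_div_iff₀ (by linarith)]
    have h1 : powerSum b N ≤ (N : ℝ) ^ γ / γ :=
      (powerSum_anti (b' := 1 - γ) (by simp [hγ]) N).trans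
        (powerSum_le_rpow hγ0 (by linarith) N)
    have h2 := one_le_powerSum (2 * b) hN
    calc B * γ * (N : ℝ) ^ (-γ) * powerSum b N
        ≤ B * γ * (N : ℝ) ^ (-γ) * ((N : ℝ) ^ γ / γ) := by gcongr
      _ = B * ((N : ℝ) ^ (-γ) * (N : ℝ) ^ γ) := by field_simp
      _ = B := by rw [← Real.rpow_add hN']; simp
      _ ≤ _ := by nlinarith

/-- The numerator grows like `log N` and the denominator at least like `√N`; the logarithm is
absorbed by `N^κ` with `κ = 1/2 - γ`. -/
lemma decay_upper {A B γ : ℝ} (hA : 0 ≤ A) (hB : 0 < B) (hγ : γ < 1 / 2) :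
    ∃ C : ℝ, 0 < C ∧ ∀ N : ℕ, 0 < N → decay A B (1 / 2) N ≤ C * (N : ℝ) ^ (-γ) := by
  set κ := 1 / 2 - γ with hκ
  have hκ0 : 0 < κ := by linarith
  refine ⟨A + B + B / κ, by positivity, fun N hN => ?_⟩
  have hN' : (1 : ℝ) ≤ N := by exact_mod_cast hN
  have hN0 : (0 : ℝ) < N := by linarith
  have hsq : 0 < Real.sqrt N := Real.sqrt_pos.2 hN0
  have h1 : powerSum (2 * (1 / 2)) N ≤ 1 + Real.log N := by norm_num; exact powerSum_one_le N
  have h2 : Real.log N ≤ (N : ℝ) ^ κ / κ := Real.log_le_rpow_div hN0.le hκ0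
  have h3 : (1 : ℝ) ≤ (N : ℝ) ^ κ := Real.one_le_rpow hN' hκ0.le
  calc decay A B (1 / 2) N
      ≤ ((A + B + B / κ) * (N : ℝ) ^ κ) / Real.sqrt N := by
        rw [decay]
        refine div_le_div₀ (by positivity) ?_ hsq powerSum_half_ge
        calc A + B * powerSum (2 * (1 / 2)) N ≤ A + B * (1 + (N : ℝ) ^ κ / κ) := by
              gcongr; linarith
          _ ≤ A * (N : ℝ) ^ κ + B * ((N : ℝ) ^ κ + (N : ℝ) ^ κ / κ) := by
              gcongr
              exact le_mul_of_one_le_right hA h3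
          _ = _ := by ring
    _ = _ := by
        rw [Real.sqrt_eq_rpow, mul_div_assoc, ← Real.rpow_sub hN0]
        congr 2
        rw [hκ]; ring

/-- Up to a constant factor, the exponent `1/2` needs no more iterations than any other one. -/
lemma exists_decay_half_le {A B b : ℝ} (hA : 0 ≤ A) (hB : 0 < B) (hb : b ∈ Icc (0 : ℝ) 1) :
    ∃ K : ℕ, 0 < K ∧ ∀ N : ℕ, 0 < N → decay A B (1 / 2) (K * N) ≤ decay A B b N := by
  by_cases hb2 : b = 1 / 2
  · exact ⟨1, one_pos, fun N _ => by rw [hb2, one_mul]⟩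
  obtain ⟨c, γ, hc, hγ0, hγ1, hlow⟩ := decay_lower hA hB hb hb2
  -- With an exponent strictly between `γ` and `1/2`, a `K` with `C K^{-γ'} < c` suffices: `C (K
  -- N)^{-γ'} ≤ c N^{-γ'} ≤ c N^{-γ}`.
  set γ' := (γ + 1 / 2) / 2 with hγ'
  have h1 : γ < γ' := by rw [hγ']; linarith
  have h2 : γ' < 1 / 2 := by rw [hγ']; linarith
  obtain ⟨C, hC, hup⟩ := decay_upper hA hB h2
  have hlim : Tendsto (fun K : ℕ => C * (K : ℝ) ^ (-γ')) atTop (𝓝 (C * 0)) :=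
    ((tendsto_rpow_neg_atTop (by linarith)).comp tendsto_natCast_atTop_atTop).const_mul C
  rw [mul_zero] at hlim
  obtain ⟨K, hK, hK0⟩ := ((hlim.eventually (gt_mem_nhds hc)).and (eventually_gt_atTop 0)).exists
  refine ⟨K, hK0, fun N hN => ?_⟩
  have hN' : (1 : ℝ) ≤ N := by exact_mod_cast hN
  refine (hup _ (Nat.mul_pos hK0 hN)).trans (le_trans ?_ (hlow N hN))
  push_cast
  rw [Real.mul_rpow (by positivity) (by positivity), ← mul_assoc]
  gcongr

/-- The order of the number of iterations for the exponent `1/2` is strictly better. -/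
lemma exists_decay_half_lt {A B b : ℝ} (hA : 0 ≤ A) (hB : 0 < B) (hb : b ∈ Icc (0 : ℝ) 1)
    (hb2 : b ≠ 1 / 2) (K : ℕ) (hK : 0 < K) :
    ∃ ε : ℝ, 0 < ε ∧ ∀ N : ℕ, 0 < N → decay A B b N ≤ ε →
      ∃ N' : ℕ, 0 < N' ∧ K * N' ≤ N ∧ decay A B (1 / 2) N' ≤ decay A B b N := by
  obtain ⟨c, γ, hc, hγ0, hγ1, hlow⟩ := decay_lower hA hB hb hb2
  set γ' := (γ + 1 / 2) / 2 with hγ'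
  have h1 : γ < γ' := by rw [hγ']; linarith
  have h2 : γ' < 1 / 2 := by rw [hγ']; linarith
  obtain ⟨C, hC, hup⟩ := decay_upper hA hB h2
  -- The surplus `γ' - γ` in the exponent eventually beats any constant factor, in particular the
  -- one lost by dividing the number of iterations by `2 K`.
  have hlim : Tendsto (fun N : ℕ => C * (2 * K : ℝ) ^ γ' * (N : ℝ) ^ (-(γ' - γ))) atTop
      (𝓝 (C * (2 * K : ℝ) ^ γ' * 0)) :=
    ((tendsto_rpow_neg_atTop (by linarith)).comp tendsto_natCast_atTop_atTop).const_mul _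
  rw [mul_zero] at hlim
  obtain ⟨N₁, hN₁⟩ := eventually_atTop.1
    ((hlim.eventually (gt_mem_nhds hc)).and (eventually_ge_atTop K))
  have hM : (0 : ℝ) < (N₁ : ℝ) + 1 := by positivity
  -- Half of the lower bound at `N₁ + 1`: for `N < N₁` the quotient exceeds this `ε`, so a value
  -- below it forces `N ≥ N₁`. The shift by one keeps the base positive.
  refine ⟨c * ((N₁ : ℝ) + 1) ^ (-γ) / 2, by positivity, fun N hN hdec => ?_⟩
  have hN0 : (0 : ℝ) < N := by exact_mod_cast hN
  have hlarge : N₁ ≤ N := by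
    by_contra! hlt
    have h3 : ((N₁ : ℝ) + 1) ^ (-γ) ≤ (N : ℝ) ^ (-γ) := by
      apply Real.rpow_le_rpow_of_nonpos hN0 _ (by linarith)
      have : (N : ℝ) < N₁ := by exact_mod_cast hlt
      linarith
    have h4 := (hlow N hN).trans hdec
    have h5 : 0 < c * ((N₁ : ℝ) + 1) ^ (-γ) := by positivity
    nlinarith
  obtain ⟨h3, h4⟩ := hN₁ N hlarge
  have hdiv : 0 < N / K := Nat.div_pos h4 hK
  -- Integer division; since `N ≥ K`, the rounded quotient is still at least `N / (2 K)`.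
  refine ⟨N / K, hdiv, Nat.mul_div_le N K, (hup _ hdiv).trans (le_trans ?_ (hlow N hN))⟩
  have hKr : (0 : ℝ) < K := by exact_mod_cast hK
  have hge : (N : ℝ) / (2 * K) ≤ ((N / K : ℕ) : ℝ) := by
    rw [div_le_iff₀ (by positivity)]
    have : N < K * (N / K) + K := by
      have := Nat.mod_lt N hK; have := Nat.div_add_mod N K; omega
    have h5 : N ≤ N / K * (2 * K) := by nlinarith
    exact_mod_cast h5
  calc C * ((N / K : ℕ) : ℝ) ^ (-γ') ≤ C * ((N : ℝ) / (2 * K)) ^ (-γ') := by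
        gcongr 1
        exact Real.rpow_le_rpow_of_nonpos (by positivity) hge (by linarith)
    _ = C * (2 * K : ℝ) ^ γ' * (N : ℝ) ^ (-(γ' - γ)) * (N : ℝ) ^ (-γ) := by
        rw [Real.div_rpow hN0.le (by positivity), mul_assoc _ _ ((N : ℝ) ^ (-γ)),
          ← Real.rpow_add hN0]
        rw [show -(γ' - γ) + -γ = -γ' by ring]
        rw [Real.rpow_neg hN0.le γ', Real.rpow_neg (by positivity : (0 : ℝ) ≤ 2 * K) γ']
        field_simp
    _ ≤ c * (N : ℝ) ^ (-γ) := by gcongr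

/-! ### Iteration complexity -/

section Complexity

variable {d l : ℕ}

lemma weight_powerSeq (τ ρ₀ α₀ b : ℝ) (t : ℕ) :
    weight τ (constSeq ρ₀) (powerSeq α₀ b) t
      = ρ₀ * (ρ₀ - τ) / α₀ * ((t : ℝ) + 1) ^ (-b) := by
  rw [weight, constSeq, constSeq, powerSeq, sub_self, sub_zero, Real.rpow_neg (by positivity)]
  rw [← div_div, div_eq_mul_inv (_ / _)]

lemma sum_weight_powerSeq (τ ρ₀ α₀ b : ℝ) (N : ℕ) :
    ∑ t ∈ Finset.range N, weight τ (constSeq ρ₀) (powerSeq α₀ b) t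
      = ρ₀ * (ρ₀ - τ) / α₀ * powerSum b N := by
  simp_rw [weight_powerSeq, powerSum, Finset.mul_sum]

/-- The learning errors and the weights are both proportional to `1/α t`, so their quotient is a
constant in `T` and `b`. Hence comparing exponents only involves `decay`, whose coefficients do not
depend on `n`. -/
lemma guarantee_eq_decay (P : Problem d l) (C r : ℝ) {n m : ℕ} (hn : 0 < n) (hm : 0 < m)
    {ρ₀ α₀ : ℝ} (hρ : 0 < ρ₀) (hτ : P.τ < ρ₀) (hα : 0 < α₀) (b : ℝ) (T : ℕ) :
    guarantee P C r n m (constSeq ρ₀) (powerSeq α₀ b) T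
      = decay (2 * P.Δ₀ * α₀ / (ρ₀ * (ρ₀ - P.τ))) (4 * P.L ^ 2 / (m * α₀ * (ρ₀ - P.τ))) b (T + 1)
        + 4 * C / ((n : ℝ) ^ (r / 2) * (ρ₀ - P.τ)) := by
  have hS : 0 < powerSum b (T + 1) := by linarith [one_le_powerSum b (Nat.succ_pos T)]
  have hn' : (0 : ℝ) < n := by exact_mod_cast hn
  have hm' : (0 : ℝ) < m := by exact_mod_cast hm
  have hnr : 0 < (n : ℝ) ^ (r / 2) := by positivity
  have hρτ : 0 < ρ₀ - P.τ := by linarith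
  have e1 : ∑ t ∈ Finset.range (T + 1), 4 * constSeq ρ₀ (t + 1) * P.L ^ 2
      / (m * powerSeq α₀ b t ^ 2) = 4 * ρ₀ * P.L ^ 2 / (m * α₀ ^ 2) * powerSum (2 * b) (T + 1) := by
    rw [powerSum, Finset.mul_sum]
    refine Finset.sum_congr rfl fun t _ => ?_
    have ht : (0 : ℝ) < (t : ℝ) + 1 := by positivity
    rw [constSeq, powerSeq, mul_pow, ← Real.rpow_natCast (_ ^ b), ← Real.rpow_mul ht.le,
      Real.rpow_neg ht.le, Nat.cast_ofNat, mul_comm b 2]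
    field_simp
  have e2 : ∑ t ∈ Finset.range (T + 1), 4 * constSeq ρ₀ (t + 1) * C
      / ((n : ℝ) ^ (r / 2) * powerSeq α₀ b t)
      = 4 * ρ₀ * C / ((n : ℝ) ^ (r / 2) * α₀) * powerSum b (T + 1) := by
    rw [powerSum, Finset.mul_sum]
    refine Finset.sum_congr rfl fun t _ => ?_
    have ht : (0 : ℝ) < (t : ℝ) + 1 := by positivity
    rw [constSeq, powerSeq, Real.rpow_neg ht.le]
    field_simp
  rw [guarantee, errorSum, e1, e2, sum_weight_powerSeq, decay]
  generalize P.τ = τ at *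
  field_simp

/-- With `ρ` constant both certification inequalities bound the same number, by `δ²` and by `(ν /
ρ₀)²`. -/
lemma scaledGuarantee_eq (P : Problem d l) (C r : ℝ) (n m : ℕ) {ρ₀ α₀ : ℝ}
    (hρ : 0 < ρ₀) (hτ : P.τ < ρ₀) (hα : 0 < α₀) (b : ℝ) (T : ℕ) :
    scaledGuarantee P C r n m (constSeq ρ₀) (powerSeq α₀ b) T
      = ρ₀ ^ 2 * guarantee P C r n m (constSeq ρ₀) (powerSeq α₀ b) T := by
  have hS : 0 < powerSum b (T + 1) := by linarith [one_le_powerSum b (Nat.succ_pos T)]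
  have hρτ : 0 < ρ₀ - P.τ := by linarith
  have hw : 0 < ∑ t ∈ Finset.range (T + 1), weight P.τ (constSeq ρ₀) (powerSeq α₀ b) t := by
    rw [sum_weight_powerSeq]; positivity
  rw [scaledGuarantee, guarantee]
  simp only [constSeq, ← Finset.mul_sum]
  field_simp

lemma certified_of_decay_le (P : Problem d l) (C r : ℝ) {n m : ℕ} (hn : 0 < n) (hm : 0 < m)
    {ρ₀ α₀ : ℝ} (hρ : 0 < ρ₀) (hτ : P.τ < ρ₀) (hα : 0 < α₀) {b b' ν δ : ℝ} {T T' : ℕ}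
    (h : decay (2 * P.Δ₀ * α₀ / (ρ₀ * (ρ₀ - P.τ))) (4 * P.L ^ 2 / (m * α₀ * (ρ₀ - P.τ))) b' (T' + 1)
      ≤ decay (2 * P.Δ₀ * α₀ / (ρ₀ * (ρ₀ - P.τ))) (4 * P.L ^ 2 / (m * α₀ * (ρ₀ - P.τ))) b (T + 1))
    (hc : Certified P C r n m (constSeq ρ₀) (powerSeq α₀ b) ν δ T) :
    Certified P C r n m (constSeq ρ₀) (powerSeq α₀ b') ν δ T' := by
  rw [Certified, scaledGuarantee_eq _ _ _ _ _ hρ hτ hα] at hc ⊢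
  have hg : guarantee P C r n m (constSeq ρ₀) (powerSeq α₀ b') T'
      ≤ guarantee P C r n m (constSeq ρ₀) (powerSeq α₀ b) T := by
    rw [guarantee_eq_decay _ _ _ hn hm hρ hτ hα, guarantee_eq_decay _ _ _ hn hm hρ hτ hα]
    linarith
  exact ⟨hg.trans hc.1, (mul_le_mul_of_nonneg_left hg (sq_nonneg _)).trans hc.2⟩

lemma iterComplexity_le_of_certified {P : Problem d l} {C r : ℝ} {n m : ℕ} {ρ α : ℕ → ℝ}
    {ν δ : ℝ} {T : ℕ} (h : Certified P C r n m ρ α ν δ T) :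
    iterComplexity P C r n m ρ α ν δ ≤ ((T + 1 : ℕ) : ℕ∞) :=
  iInf₂_le (f := fun (T : ℕ) (_ : Certified P C r n m ρ α ν δ T) => ((T + 1 : ℕ) : ℕ∞)) T h

/-- An infimum in the well-ordered `ℕ∞` is attained, here either at a certified index or at the
empty inner infimum. -/
lemma iterComplexity_eq (P : Problem d l) (C r : ℝ) (n m : ℕ) (ρ α : ℕ → ℝ) (ν δ : ℝ) :
    iterComplexity P C r n m ρ α ν δ = ⊤ ∨ ∃ T, Certified P C r n m ρ α ν δ T ∧
      iterComplexity P C r n m ρ α ν δ = ((T + 1 : ℕ) : ℕ∞) := by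
  obtain ⟨T, hT⟩ := ciInf_mem fun T : ℕ =>
    ⨅ _ : Certified P C r n m ρ α ν δ T, ((T + 1 : ℕ) : ℕ∞)
  rw [iterComplexity, ← hT]
  by_cases h : Certified P C r n m ρ α ν δ T
  · exact Or.inr ⟨T, h, by simp [h]⟩
  · exact Or.inl (by simp [h])

/-- Whatever certifies `N` iterations with `b` certifies `K N` iterations with `1/2`, as the part of
the guarantee that depends on the number of iterations is no larger there. -/
theorem exists_iterComplexity_half_le (P : Problem d l) (C r : ℝ) {m : ℕ} (hm : 0 < m)
    {ρ₀ α₀ : ℝ} (hρ : 0 < ρ₀) (hτ : P.τ < ρ₀) (hα : 0 < α₀) (hΔ : 0 ≤ P.Δ₀)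
    (hL : P.L = 0 → P.Δ₀ = 0) {b : ℝ} (hb : b ∈ Icc (0 : ℝ) 1) :
    ∃ K : ℕ, ∀ n : ℕ, 0 < n → ∀ ν δ : ℝ,
      iterComplexity P C r n m (constSeq ρ₀) (powerSeq α₀ (1 / 2)) ν δ
        ≤ K * iterComplexity P C r n m (constSeq ρ₀) (powerSeq α₀ b) ν δ := by
  have hρτ : 0 < ρ₀ - P.τ := by linarith
  have hm' : (0 : ℝ) < m := by exact_mod_cast hm
  obtain ⟨K, hK, hKN⟩ : ∃ K : ℕ, 0 < K ∧ ∀ N : ℕ, 0 < N →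
      decay (2 * P.Δ₀ * α₀ / (ρ₀ * (ρ₀ - P.τ))) (4 * P.L ^ 2 / (m * α₀ * (ρ₀ - P.τ)))
        (1 / 2) (K * N) ≤
      decay (2 * P.Δ₀ * α₀ / (ρ₀ * (ρ₀ - P.τ))) (4 * P.L ^ 2 / (m * α₀ * (ρ₀ - P.τ))) b N := by
    -- For `L = 0` both coefficients of `decay` vanish, since then `Δ₀ = 0` too, and the asymptotic
    -- comparison, which needs `B > 0`, is replaced by `0 ≤ 0`.
    by_cases hL0 : P.L = 0
    · exact ⟨1, one_pos, fun N _ => by simp [decay, hL0, hL hL0]⟩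
    · exact exists_decay_half_le (by positivity) (by positivity) hb
  refine ⟨K, fun n hn ν δ => ?_⟩
  rcases iterComplexity_eq P C r n m (constSeq ρ₀) (powerSeq α₀ b) ν δ with h | ⟨T, hT, h⟩
  · rw [h, ENat.mul_top (by exact_mod_cast hK.ne')]
    exact le_top
  · rw [h]
    -- An index `T` stands for `T + 1` iterations, so `K (T + 1)` iterations have index `K (T + 1) -
    -- 1`.
    have hpos : 0 < K * (T + 1) := by positivity
    have := iterComplexity_le_of_certified (certified_of_decay_le P C r hn hm hρ hτ hα
      (T' := K * (T + 1) - 1) (by rw [Nat.sub_add_cancel hpos]; exact hKN _ (Nat.succ_pos T)) hT)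
    rw [Nat.sub_add_cancel hpos] at this
    exact_mod_cast this

/-- A small tolerance makes the required number of iterations for `b` large, and then a `K`-th part
of it suffices for `1/2`. -/
theorem exists_mul_iterComplexity_half_le (P : Problem d l) {C : ℝ} (hC : 0 < C) (r : ℝ) {m : ℕ}
    (hm : 0 < m) {ρ₀ α₀ : ℝ} (hρ : 0 < ρ₀) (hτ : P.τ < ρ₀) (hα : 0 < α₀) (hΔ : 0 ≤ P.Δ₀)
    (hL : 0 < P.L) {b : ℝ} (hb : b ∈ Icc (0 : ℝ) 1) (hb2 : b ≠ 1 / 2) (K : ℕ) :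
    ∃ ε : ℝ, 0 < ε ∧ ∀ n : ℕ, 0 < n → ∀ ν δ : ℝ, 0 < ν → 0 < δ → min (ρ₀ * δ) ν ≤ ε →
      K * iterComplexity P C r n m (constSeq ρ₀) (powerSeq α₀ (1 / 2)) ν δ
        ≤ iterComplexity P C r n m (constSeq ρ₀) (powerSeq α₀ b) ν δ := by
  have hρτ : 0 < ρ₀ - P.τ := by linarith
  have hm' : (0 : ℝ) < m := by exact_mod_cast hm
  rcases Nat.eq_zero_or_pos K with rfl | hK
  · exact ⟨1, one_pos, fun n _ ν δ _ _ _ => by simp⟩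
  obtain ⟨ε, hε, hdec⟩ := exists_decay_half_lt
    (A := 2 * P.Δ₀ * α₀ / (ρ₀ * (ρ₀ - P.τ))) (B := 4 * P.L ^ 2 / (m * α₀ * (ρ₀ - P.τ)))
    (by positivity) (by positivity) hb hb2 K hK
  -- Whichever of `ρ₀ δ` and `ν` is at most `ρ₀ √ε`, the matching certification inequality makes the
  -- guarantee at most `ε`.
  refine ⟨ρ₀ * Real.sqrt ε, by positivity, fun n hn ν δ hν hδ hmin => ?_⟩
  rcases iterComplexity_eq P C r n m (constSeq ρ₀) (powerSeq α₀ b) ν δ with h | ⟨T, hT, h⟩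
  · rw [h]; exact le_top
  have hn' : (0 : ℝ) < n := by exact_mod_cast hn
  have hg : guarantee P C r n m (constSeq ρ₀) (powerSeq α₀ b) T ≤ ε := by
    have hT' := hT
    rw [Certified, scaledGuarantee_eq _ _ _ _ _ hρ hτ hα] at hT'
    have hsq := Real.sq_sqrt hε.le
    rcases min_le_iff.1 hmin with h1 | h1
    · have h2 : δ ≤ Real.sqrt ε := le_of_mul_le_mul_left h1 hρ
      have h3 : δ ^ 2 ≤ Real.sqrt ε ^ 2 := by gcongr
      linarith [hT'.1]
    · have h3 : ν ^ 2 ≤ (ρ₀ * Real.sqrt ε) ^ 2 := by gcongr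
      rw [mul_pow, hsq] at h3
      exact le_of_mul_le_mul_left (hT'.2.trans h3) (by positivity)
  rw [guarantee_eq_decay _ _ _ hn hm hρ hτ hα] at hg
  -- The learning term is positive, so dropping it bounds `decay` alone by `ε`, for every `n`.
  have hE : 0 < 4 * C / ((n : ℝ) ^ (r / 2) * (ρ₀ - P.τ)) := by positivity
  obtain ⟨N', hN', hKN, hle⟩ := hdec (T + 1) (Nat.succ_pos T) (by linarith)
  have := iterComplexity_le_of_certified (certified_of_decay_le P C r hn hm hρ hτ hα
      (T' := N' - 1) (by rw [Nat.sub_add_cancel hN']; exact hle) hT)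
  rw [Nat.sub_add_cancel hN'] at this
  rw [h]
  calc (K : ℕ∞) * _ ≤ K * (N' : ℕ∞) := by gcongr
    _ ≤ _ := by exact_mod_cast hKN

lemma polyak_half {τ ρ₀ α₀ : ℝ} (hρ : 0 < ρ₀) (hτ : τ < ρ₀) (hα : 0 < α₀) (T t : ℕ) :
    polyak τ (constSeq ρ₀) (powerSeq α₀ (1 / 2)) T t
      = ((t : ℝ) + 1) ^ (-(1 / 2) : ℝ)
        / ∑ s ∈ Finset.range (T + 1), ((s : ℝ) + 1) ^ (-(1 / 2) : ℝ) := by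
  have hρτ : 0 < ρ₀ - τ := by linarith
  rw [polyak, sum_weight_powerSeq, weight_powerSeq, mul_div_mul_left _ _ (by positivity)]
  rfl

/-- The explicit form of the guarantee for the exponent `1/2`. -/
lemma guarantee_half_le (P : Problem d l) (C r : ℝ) {n m : ℕ} (hn : 0 < n) (hm : 0 < m)
    {ρ₀ α₀ : ℝ} (hρ : 0 < ρ₀) (hτ : P.τ < ρ₀) (hα : 0 < α₀) (hΔ : 0 ≤ P.Δ₀) {T : ℕ}
    (hT : 0 < T) :
    guarantee P C r n m (constSeq ρ₀) (powerSeq α₀ (1 / 2)) T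
      ≤ 4 * P.Δ₀ * α₀ / (ρ₀ * (ρ₀ - P.τ)) * (1 / Real.sqrt ((T : ℝ) + 1))
        + 16 * P.L ^ 2 / (m * α₀ * (ρ₀ - P.τ))
          * (Real.log ((T : ℝ) + 1) / Real.sqrt ((T : ℝ) + 1))
        + 4 * C / ((n : ℝ) ^ (r / 2) * (ρ₀ - P.τ)) := by
  have hρτ : 0 < ρ₀ - P.τ := by linarith
  have hm' : (0 : ℝ) < m := by exact_mod_cast hm
  rw [guarantee_eq_decay _ _ _ hn hm hρ hτ hα]
  gcongr
  have h1 : powerSum (2 * (1 / 2)) (T + 1) ≤ 1 + Real.log ((T : ℝ) + 1) := by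
    norm_num; exact_mod_cast powerSum_one_le (T + 1)
  have h2 : Real.sqrt ((T : ℝ) + 1) ≤ powerSum (1 / 2) (T + 1) := by
    exact_mod_cast powerSum_half_ge (N := T + 1)
  -- For `T ≥ 1` the logarithm exceeds `1/3`, so `1 + log ≤ 4 log`; this is the passage from the
  -- coefficient `4` to `16`.
  have h3 : Real.log 2 ≤ Real.log ((T : ℝ) + 1) := by
    apply Real.log_le_log (by norm_num)
    have : (1 : ℝ) ≤ T := by exact_mod_cast hT
    linarith
  have h4 := Real.log_two_gt_d9
  have hs : 0 < Real.sqrt ((T : ℝ) + 1) := Real.sqrt_pos.2 (by positivity)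
  set A := P.Δ₀ * α₀ / (ρ₀ * (ρ₀ - P.τ)) with hA
  set B := P.L ^ 2 / (m * α₀ * (ρ₀ - P.τ)) with hB
  have hA0 : 0 ≤ A := by positivity
  have hB0 : 0 ≤ B := by positivity
  have e1 : 2 * P.Δ₀ * α₀ / (ρ₀ * (ρ₀ - P.τ)) = 2 * A := by rw [hA]; ring
  have e2 : 4 * P.L ^ 2 / (m * α₀ * (ρ₀ - P.τ)) = 4 * B := by rw [hB]; ring
  have e3 : 4 * P.Δ₀ * α₀ / (ρ₀ * (ρ₀ - P.τ)) = 4 * A := by rw [hA]; ring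
  have e4 : 16 * P.L ^ 2 / (m * α₀ * (ρ₀ - P.τ)) = 16 * B := by rw [hB]; ring
  rw [e1, e2, e3, e4, decay]
  calc (2 * A + 4 * B * powerSum (2 * (1 / 2)) (T + 1)) / powerSum (1 / 2) (T + 1)
      ≤ (4 * A + 16 * B * Real.log ((T : ℝ) + 1)) / Real.sqrt ((T : ℝ) + 1) := by
        apply div_le_div₀ _ _ hs h2
        · have : 0 ≤ Real.log ((T : ℝ) + 1) := by linarith
          positivity
        · have : B * powerSum (2 * (1 / 2)) (T + 1) ≤ B * (4 * Real.log ((T : ℝ) + 1)) := by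
            gcongr; linarith
          linarith
    _ = _ := by ring

end Complexity

/-! ### The linearized argument of the cost -/

section LinArg

variable {d l : ℕ}

/-- The product of the matrix with the rows `r j` and the vector `e`. -/
def rowsMul (r : Fin l → Vec l) (e : Vec l) : Vec l := WithLp.toLp 2 fun j => inner ℝ e (r j)

/-- Cauchy–Schwarz in each row: the operator norm is at most the Frobenius norm. -/
lemma norm_rowsMul_le (r : Fin l → Vec l) (e : Vec l) :
    ‖rowsMul r e‖ ≤ Real.sqrt (∑ j, ‖r j‖ ^ 2) * ‖e‖ := by
  rw [EuclideanSpace.norm_eq, ← Real.sqrt_sq (norm_nonneg e), ← Real.sqrt_mul (by positivity)]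
  apply Real.sqrt_le_sqrt
  rw [Finset.sum_mul]
  refine Finset.sum_le_sum fun j _ => ?_
  rw [rowsMul, Real.norm_eq_abs, sq_abs, ← mul_pow]
  have := abs_real_inner_le_norm e (r j)
  rw [mul_comm ‖r j‖]
  exact sq_le_sq' (by linarith [neg_abs_le (inner ℝ e (r j))]) ((le_abs_self _).trans this)

lemma rowsMul_add (r s : Fin l → Vec l) (e : Vec l) :
    rowsMul (r + s) e = rowsMul r e + rowsMul s e := by
  ext j; simp [rowsMul, inner_add_right]

lemma rowsMul_sub (r s : Fin l → Vec l) (e : Vec l) :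
    rowsMul (r - s) e = rowsMul r e - rowsMul s e := by
  ext j; simp [rowsMul, inner_sub_right]

lemma rowsMul_smul (a : ℝ) (r : Fin l → Vec l) (e : Vec l) :
    rowsMul (a • r) e = a • rowsMul r e := by
  ext j; simp [rowsMul, inner_smul_right]

lemma rowsMul_vec_sub (r : Fin l → Vec l) (e e' : Vec l) :
    rowsMul r (e - e') = rowsMul r e - rowsMul r e' := by
  ext j; simp [rowsMul, inner_sub_left]

lemma matOp_rowMatrix (q : Fin l → Vec l) (e : Vec l) :
    matOp (rowMatrix q) e = rowsMul q e := by
  ext j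
  simp [matOp, rowMatrix, rowsMul, Matrix.mulVec, dotProduct,
    PiLp.inner_apply]

lemma gradRows_eq (dq : Fin l → Vec d →L[ℝ] Vec l) (e : Vec l) (v : Vec d) :
    gradRows dq e v = rowsMul (fun j => dq j v) e := rfl

lemma norm_gradRows_le (dq : Fin l → Vec d →L[ℝ] Vec l) (e : Vec l) (v : Vec d) :
    ‖gradRows dq e v‖ ≤ Real.sqrt (∑ j, ‖dq j‖ ^ 2) * ‖e‖ * ‖v‖ := by
  rw [gradRows_eq]
  refine (norm_rowsMul_le _ _).trans ?_
  rw [mul_right_comm]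
  gcongr
  rw [← Real.sqrt_sq (norm_nonneg v), ← Real.sqrt_mul (by positivity), Finset.sum_mul]
  apply Real.sqrt_le_sqrt
  gcongr with j
  rw [← mul_pow]
  gcongr
  exact (dq j).le_opNorm v

lemma gradRows_combo (dq : Fin l → Vec d →L[ℝ] Vec l) (e : Vec l) (a b : ℝ) (v w : Vec d) :
    gradRows dq e (a • v + b • w) = a • gradRows dq e v + b • gradRows dq e w := by
  rw [gradRows_eq, gradRows_eq, gradRows_eq, ← rowsMul_smul, ← rowsMul_smul, ← rowsMul_add]
  congr 1
  ext j : 1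
  simp

lemma gradRows_sub (dq : Fin l → Vec d →L[ℝ] Vec l) (e : Vec l) (v w : Vec d) :
    gradRows dq e (v - w) = gradRows dq e v - gradRows dq e w := by
  rw [gradRows_eq, gradRows_eq, gradRows_eq, ← rowsMul_sub]
  congr 1
  ext j : 1
  simp

/-- The argument `c₀ + dc₀ (x - z) + Q₀ e + G₀(e) (x - z)` of the cost in the prox-linear model. -/
def linArg (c₀ : Vec l) (dc₀ : Vec d →L[ℝ] Vec l) (q₀ : Fin l → Vec l)
    (dq₀ : Fin l → Vec d →L[ℝ] Vec l) (z : Vec d) (e : Vec l) (x : Vec d) : Vec l :=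
  c₀ + dc₀ (x - z) + matOp (rowMatrix q₀) e + gradRows dq₀ e (x - z)

/-- For a fixed residual the argument is affine in `x`, which is why the jointly convex cost of it
is convex in `x`. -/
lemma linArg_combo (c₀ : Vec l) (dc₀ : Vec d →L[ℝ] Vec l) (q₀ : Fin l → Vec l)
    (dq₀ : Fin l → Vec d →L[ℝ] Vec l) (z : Vec d) (e : Vec l) (x y : Vec d) {a b : ℝ}
    (hab : a + b = 1) :
    linArg c₀ dc₀ q₀ dq₀ z e (a • x + b • y)
      = a • linArg c₀ dc₀ q₀ dq₀ z e x + b • linArg c₀ dc₀ q₀ dq₀ z e y := by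
  have h : a • x + b • y - z = a • (x - z) + b • (y - z) := by
    nth_rewrite 1 [← one_smul ℝ z]
    rw [← hab]
    module
  obtain rfl : b = 1 - a := by linarith
  rw [linArg, linArg, linArg, h, gradRows_combo, map_add, map_smul, map_smul]
  module

lemma linArg_sub (c₀ : Vec l) (dc₀ : Vec d →L[ℝ] Vec l) (q₀ : Fin l → Vec l)
    (dq₀ : Fin l → Vec d →L[ℝ] Vec l) (z : Vec d) (e : Vec l) (x y : Vec d) :
    linArg c₀ dc₀ q₀ dq₀ z e x - linArg c₀ dc₀ q₀ dq₀ z e y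
      = dc₀ (x - y) + gradRows dq₀ e (x - y) := by
  have h : x - y = (x - z) - (y - z) := by abel
  rw [linArg, linArg, h, gradRows_sub dq₀ e (x - z) (y - z), map_sub dc₀ (x - z) (y - z)]
  abel

lemma continuous_rowsMul {E : Type*} [TopologicalSpace E] {r : E → Fin l → Vec l} {e : E → Vec l}
    (hr : ∀ j, Continuous fun p => r p j) (he : Continuous e) :
    Continuous fun p => rowsMul (r p) (e p) := by
  unfold rowsMul
  fun_prop

lemma continuous_linArg (c₀ : Vec l) (dc₀ : Vec d →L[ℝ] Vec l) (q₀ : Fin l → Vec l)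
    (dq₀ : Fin l → Vec d →L[ℝ] Vec l) (z : Vec d) :
    Continuous fun p : Vec l × Vec d => linArg c₀ dc₀ q₀ dq₀ z p.1 p.2 := by
  simp only [linArg, gradRows_eq, matOp_rowMatrix]
  refine ((by fun_prop : Continuous fun p : Vec l × Vec d => c₀ + dc₀ (p.2 - z)).add
    (continuous_rowsMul (fun j => by fun_prop) (by fun_prop))).add
    (continuous_rowsMul (fun j => by fun_prop) (by fun_prop))

end LinArg

/-! ### Consequences of the standing assumptions -/

namespace Problem

variable {d l : ℕ} {P : Problem d l}

lemma Regular.convex_O (hP : P.Regular) : Convex ℝ P.O := by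
  intro x hx y hy a b ha hb hab
  exact (hP.convex_cost.1 (x := (x, 0)) (y := (y, 0)) ⟨hx, trivial⟩ ⟨hy, trivial⟩ ha hb hab).1

lemma Regular.abs_cost_sub_le (hP : P.Regular) {x y : Vec d} (hx : x ∈ P.O) (hy : y ∈ P.O)
    (u v : Vec l) : |P.φ x u - P.φ y v| ≤ P.Lφ * (‖x - y‖ + ‖u - v‖) := by
  refine (hP.lipschitz_cost x hx y hy u v).trans ?_
  gcongr
  rw [Real.sqrt_le_left (by positivity)]
  nlinarith [norm_nonneg (x - y), norm_nonneg (u - v)]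

lemma Regular.continuousOn_cost (hP : P.Regular) :
    ContinuousOn (fun p : Vec d × Vec l => P.φ p.1 p.2) (P.O ×ˢ univ) := by
  have : LipschitzOnWith (P.Lφ * 2) (fun p : Vec d × Vec l => P.φ p.1 p.2) (P.O ×ˢ univ) := by
    refine LipschitzOnWith.of_dist_le_mul fun p hp p' hp' => ?_
    rw [Real.dist_eq, dist_eq_norm]
    refine (hP.abs_cost_sub_le hp.1 hp'.1 _ _).trans ?_
    push_cast
    rw [mul_assoc]
    gcongr
    have h1 : ‖p.1 - p'.1‖ ≤ ‖p - p'‖ := norm_fst_le (p - p')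
    have h2 : ‖p.2 - p'.2‖ ≤ ‖p - p'‖ := norm_snd_le (p - p')
    linarith
  exact this.continuousOn

lemma Regular.continuous_cost (hP : P.Regular) {x : Vec d} (hx : x ∈ P.O) :
    Continuous (P.φ x) := by
  have h : Continuous fun u : Vec l => (x, u) := by fun_prop
  exact hP.continuousOn_cost.comp_continuous h fun u => ⟨hx, trivial⟩

lemma Regular.convexOn_linModel (hP : P.Regular) (c₀ : Vec l) (dc₀ : Vec d →L[ℝ] Vec l)
    (q₀ : Fin l → Vec l) (dq₀ : Fin l → Vec d →L[ℝ] Vec l) (z : Vec d) (e : Vec l) :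
    ConvexOn ℝ P.O fun x => P.φ x (linArg c₀ dc₀ q₀ dq₀ z e x) := by
  refine ⟨hP.convex_O, fun x hx y hy a b ha hb hab => ?_⟩
  simp only [linArg_combo c₀ dc₀ q₀ dq₀ z e x y hab]
  exact hP.convex_cost.2 (x := (x, linArg c₀ dc₀ q₀ dq₀ z e x))
    (y := (y, linArg c₀ dc₀ q₀ dq₀ z e y)) ⟨hx, trivial⟩ ⟨hy, trivial⟩ ha hb hab

lemma Regular.continuousOn_linModel (hP : P.Regular) (c₀ : Vec l) (dc₀ : Vec d →L[ℝ] Vec l)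
    (q₀ : Fin l → Vec l) (dq₀ : Fin l → Vec d →L[ℝ] Vec l) (z : Vec d) :
    ContinuousOn (fun p : Vec l × Vec d => P.φ p.2 (linArg c₀ dc₀ q₀ dq₀ z p.1 p.2))
      (univ ×ˢ P.O) := by
  have h : Continuous fun p : Vec l × Vec d => (p.2, linArg c₀ dc₀ q₀ dq₀ z p.1 p.2) :=
    continuous_snd.prodMk (continuous_linArg c₀ dc₀ q₀ dq₀ z)
  exact hP.continuousOn_cost.comp h.continuousOn fun p hp => ⟨hp.2, trivial⟩

lemma Regular.abs_linModel_sub_le (hP : P.Regular) (c₀ : Vec l) (dc₀ : Vec d →L[ℝ] Vec l)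
    (q₀ : Fin l → Vec l) (dq₀ : Fin l → Vec d →L[ℝ] Vec l) (z : Vec d) (e : Vec l) {x y : Vec d}
    (hx : x ∈ P.O) (hy : y ∈ P.O) :
    |P.φ x (linArg c₀ dc₀ q₀ dq₀ z e x) - P.φ y (linArg c₀ dc₀ q₀ dq₀ z e y)|
      ≤ P.Lφ * (1 + ‖dc₀‖ + Real.sqrt (∑ j, ‖dq₀ j‖ ^ 2) * ‖e‖) * ‖x - y‖ := by
  refine (hP.abs_cost_sub_le hx hy _ _).trans ?_
  rw [mul_assoc, linArg_sub]
  gcongr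
  have h1 := norm_add_le (dc₀ (x - y)) (gradRows dq₀ e (x - y))
  have h2 := dc₀.le_opNorm (x - y)
  have h3 := norm_gradRows_le dq₀ e (x - y)
  linarith

/-! #### Moments of the noise -/

lemma Regular.integrable_norm_sq (hP : P.Regular) : Integrable (fun e => ‖e‖ ^ 2) P.noise :=
  hP.noise_memLp.integrable_norm_pow (by norm_num)

lemma Regular.integrable_id (hP : P.Regular) : Integrable (fun e => e) P.noise := by
  have := hP.noise_prob
  exact hP.noise_memLp.integrable (by norm_num)

/-- The second moment is the trace of the identity covariance. -/
lemma Regular.integral_norm_sq (hP : P.Regular) : ∫ e, ‖e‖ ^ 2 ∂P.noise = l := by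
  have h : ∀ e : Vec l, ‖e‖ ^ 2 = ∑ i, e i * e i := fun e => by
    rw [EuclideanSpace.norm_sq_eq]
    exact Finset.sum_congr rfl fun i _ => by rw [Real.norm_eq_abs, sq_abs, sq]
  simp_rw [h]
  rw [integral_finsetSum _ fun i _ => ?_]
  · simp [hP.noise_cov]
  · refine hP.integrable_norm_sq.mono' ?_ (ae_of_all _ fun e => ?_)
    · exact (by fun_prop : Measurable fun e : Vec l => e i * e i).aestronglyMeasurable
    · rw [← sq, Real.norm_eq_abs, abs_of_nonneg (sq_nonneg _), h e, sq]
      exact Finset.single_le_sum (f := fun i => e i * e i) (fun j _ => mul_self_nonneg _)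
        (Finset.mem_univ i)

/-- Jensen's inequality, in the form that the variance of `‖e‖` is nonnegative. -/
lemma Regular.integral_norm_le (hP : P.Regular) : ∫ e, ‖e‖ ∂P.noise ≤ Real.sqrt l := by
  have := hP.noise_prob
  apply Real.le_sqrt_of_sq_le
  rw [← hP.integral_norm_sq]
  have h := variance_eq_sub (μ := P.noise) hP.noise_memLp.norm
  have h' := variance_nonneg (fun e : Vec l => ‖e‖) P.noise
  simp only [Pi.pow_apply] at h
  linarith

/-- The Lipschitz constant of the conceptual model at the residual `e`. -/
def lipConst (P : Problem d l) (z : Vec d) (e : Vec l) : ℝ :=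
  P.Lφ * (1 + ‖fderiv ℝ P.c z‖ + Real.sqrt (∑ j, ‖fderiv ℝ (P.q j) z‖ ^ 2) * ‖e‖)

lemma Regular.bddAbove_lip (hP : P.Regular) :
    BddAbove ((fun x => ‖fderiv ℝ P.c x‖ +
      Real.sqrt l * Real.sqrt (∑ j, ‖fderiv ℝ (P.q j) x‖ ^ 2)) '' P.X) := by
  apply hP.compact_X.bddAbove_image
  have h1 := hP.lipschitz_dc.continuousOn.mono hP.X_subset
  have h2 := fun j => (hP.lipschitz_dq j).continuousOn.mono hP.X_subset
  fun_prop

lemma Regular.lip_le_L (hP : P.Regular) {z : Vec d} (hz : z ∈ P.X) :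
    P.Lφ * (1 + (‖fderiv ℝ P.c z‖ +
      Real.sqrt l * Real.sqrt (∑ j, ‖fderiv ℝ (P.q j) z‖ ^ 2))) ≤ P.L := by
  rw [L]
  gcongr
  exact le_csSup hP.bddAbove_lip ⟨z, hz, rfl⟩

/-- Serves in both directions: `L = 0` forces a constant cost, and `L_φ > 0` makes `L` positive. -/
lemma Lφ_le_L : (P.Lφ : ℝ) ≤ P.L := by
  rw [L]
  have : 0 ≤ sSup ((fun x => ‖fderiv ℝ P.c x‖ +
      Real.sqrt l * Real.sqrt (∑ j, ‖fderiv ℝ (P.q j) x‖ ^ 2)) '' P.X) := by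
    apply Real.sSup_nonneg
    rintro _ ⟨x, _, rfl⟩
    positivity
  nlinarith [P.Lφ.coe_nonneg]

lemma Regular.integrable_lipConst_sq (hP : P.Regular) (z : Vec d) :
    Integrable (fun e => P.lipConst z e ^ 2) P.noise := by
  have := hP.noise_prob
  refine (((integrable_const ((P.Lφ * (1 + ‖fderiv ℝ P.c z‖)) ^ 2)).add
    (hP.integrable_id.norm.const_mul (2 * (P.Lφ * (1 + ‖fderiv ℝ P.c z‖)) *
      (P.Lφ * Real.sqrt (∑ j, ‖fderiv ℝ (P.q j) z‖ ^ 2))))).add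
    (hP.integrable_norm_sq.const_mul
      ((P.Lφ * Real.sqrt (∑ j, ‖fderiv ℝ (P.q j) z‖ ^ 2)) ^ 2))).congr (ae_of_all _ fun e => ?_)
  simp only [Pi.add_apply, lipConst]
  ring

/-- The Lipschitz constant has the form `a + b ‖e‖`. Its second moment is at most `(a + b √ℓ)²`, as
`‖e‖` has first moment at most `√ℓ` and second moment `ℓ`. -/
lemma Regular.integral_lipConst_sq_le (hP : P.Regular) {z : Vec d} (hz : z ∈ P.X) :
    ∫ e, P.lipConst z e ^ 2 ∂P.noise ≤ P.L ^ 2 := by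
  have := hP.noise_prob
  set a := P.Lφ * (1 + ‖fderiv ℝ P.c z‖) with ha
  set b := P.Lφ * Real.sqrt (∑ j, ‖fderiv ℝ (P.q j) z‖ ^ 2) with hb
  have ha0 : 0 ≤ a := by positivity
  have hb0 : 0 ≤ b := by positivity
  have h1 : ∫ e, P.lipConst z e ^ 2 ∂P.noise = a ^ 2 + 2 * a * b * ∫ e, ‖e‖ ∂P.noise + b ^ 2 * l := by
    have e1 : ∀ e : Vec l, P.lipConst z e ^ 2 = a ^ 2 + 2 * a * b * ‖e‖ + b ^ 2 * ‖e‖ ^ 2 := by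
      intro e; rw [lipConst, ha, hb]; ring
    simp_rw [e1]
    rw [integral_add (by exact (integrable_const _).add (hP.integrable_id.norm.const_mul _))
      (hP.integrable_norm_sq.const_mul _),
      integral_add (integrable_const _) (hP.integrable_id.norm.const_mul _),
      integral_const_mul, integral_const_mul, hP.integral_norm_sq]
    simp
  have h2 := hP.integral_norm_le
  have h3 : a + b * Real.sqrt l ≤ P.L := by
    refine le_trans (le_of_eq ?_) (hP.lip_le_L hz)
    rw [ha, hb]; ring
  rw [h1]
  calc a ^ 2 + 2 * a * b * ∫ e, ‖e‖ ∂P.noise + b ^ 2 * l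
      ≤ a ^ 2 + 2 * a * b * Real.sqrt l + b ^ 2 * l := by gcongr
    _ = (a + b * Real.sqrt l) ^ 2 := by
      rw [add_sq, mul_pow b, Real.sq_sqrt (Nat.cast_nonneg l)]; ring
    _ ≤ _ := by gcongr

/-! #### The model of the objective -/

/-- The cost of the conceptual model without the proximal term. -/
def costModel (P : Problem d l) (z : Vec d) (e : Vec l) (x : Vec d) : ℝ :=
  P.φ x (linArg (P.c z) (fderiv ℝ P.c z) (fun j => P.q j z) (fun j => fderiv ℝ (P.q j) z) z e x)

/-- The expected conceptual model without the proximal term. -/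
def model (P : Problem d l) (z x : Vec d) : ℝ := ∫ e, P.costModel z e x ∂P.noise

lemma Regular.abs_costModel_sub_le (hP : P.Regular) (z : Vec d) (e : Vec l) {x y : Vec d}
    (hx : x ∈ P.O) (hy : y ∈ P.O) :
    |P.costModel z e x - P.costModel z e y| ≤ P.lipConst z e * ‖x - y‖ :=
  hP.abs_linModel_sub_le _ _ _ _ z e hx hy

lemma costModel_self (z : Vec d) (e : Vec l) :
    P.costModel z e z = P.φ z (P.c z + matOp (P.Q z) e) := by
  have h : gradRows (fun j => fderiv ℝ (P.q j) z) e (z - z) = 0 := by ext j; simp [gradRows]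
  rw [costModel, linArg, h]
  simp [Q]

lemma Regular.integrable_cost (hP : P.Regular) {x : Vec d} (hx : x ∈ P.O) {g : Vec l → Vec l}
    (hg : Continuous g) (a b : ℝ) (hab : ∀ e, ‖g e‖ ≤ a + b * ‖e‖) :
    Integrable (fun e => P.φ x (g e)) P.noise := by
  have := hP.noise_prob
  refine Integrable.mono' (g := fun e => |P.φ x 0| + P.Lφ * (a + b * ‖e‖)) ?_ ?_ ?_
  · exact (integrable_const _).add
      (((integrable_const _).add (hP.integrable_id.norm.const_mul _)).const_mul _)
  · exact ((hP.continuous_cost hx).comp hg).aestronglyMeasurable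
  · refine ae_of_all _ fun e => ?_
    have h1 := hP.abs_cost_sub_le hx hx (g e) 0
    have h2 : P.Lφ * (‖x - x‖ + ‖g e - 0‖) ≤ P.Lφ * (a + b * ‖e‖) := by
      simp only [sub_self, norm_zero, zero_add, sub_zero]
      gcongr
      exact hab e
    rw [Real.norm_eq_abs]
    have h3 := abs_sub_abs_le_abs_sub (P.φ x (g e)) (P.φ x 0)
    linarith

lemma Regular.integrable_objective (hP : P.Regular) {x : Vec d} (hx : x ∈ P.O) :
    Integrable (fun e => P.φ x (P.c x + matOp (P.Q x) e)) P.noise := by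
  refine hP.integrable_cost hx (by fun_prop) ‖P.c x‖ ‖matOp (P.Q x)‖ fun e => ?_
  exact (norm_add_le _ _).trans (by gcongr; exact (matOp (P.Q x)).le_opNorm e)

lemma norm_costArg_sub_le (z : Vec d) (e : Vec l) (x : Vec d) :
    ‖linArg (P.c z) (fderiv ℝ P.c z) (fun j => P.q j z) (fun j => fderiv ℝ (P.q j) z) z e x
      - (P.c x + matOp (P.Q x) e)‖
      ≤ ‖P.c x - P.c z - fderiv ℝ P.c z (x - z)‖
        + Real.sqrt (∑ j, ‖P.q j x - P.q j z - fderiv ℝ (P.q j) z (x - z)‖ ^ 2) * ‖e‖ := by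
  have h : linArg (P.c z) (fderiv ℝ P.c z) (fun j => P.q j z) (fun j => fderiv ℝ (P.q j) z) z e x
      - (P.c x + matOp (P.Q x) e)
      = -(P.c x - P.c z - fderiv ℝ P.c z (x - z))
        - rowsMul (fun j => P.q j x - P.q j z - fderiv ℝ (P.q j) z (x - z)) e := by
    have h1 : (fun j => P.q j x - P.q j z - fderiv ℝ (P.q j) z (x - z))
      = (fun j => P.q j x) - (fun j => P.q j z) - (fun j => fderiv ℝ (P.q j) z (x - z)) := rfl
    rw [h1, rowsMul_sub, rowsMul_sub, linArg, Q, gradRows_eq, matOp_rowMatrix, matOp_rowMatrix]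
    abel
  rw [h]
  refine (norm_sub_le _ _).trans ?_
  rw [norm_neg]
  gcongr
  exact norm_rowsMul_le _ _

/-- The model differs from the cost only by first-order Taylor remainders of `c` and of the `ℓ` rows
of `Q`; summing the squares of the latter produces `√ℓ`. -/
lemma Regular.abs_costModel_sub_cost_le (hP : P.Regular) {z x : Vec d} (hz : z ∈ P.O) (hx : x ∈ P.O)
    (e : Vec l) : |P.costModel z e x - P.φ x (P.c x + matOp (P.Q x) e)|
      ≤ P.Lφ * (P.Lc / 2 * ‖x - z‖ ^ 2 + Real.sqrt l * (P.Lq / 2 * ‖x - z‖ ^ 2) * ‖e‖) := by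
  refine (hP.abs_cost_sub_le hx hx _ _).trans ?_
  rw [sub_self, norm_zero, zero_add]
  gcongr
  refine (norm_costArg_sub_le z e x).trans ?_
  gcongr
  · exact norm_sub_fderiv_le hP.open_O hP.convex_O hP.smooth_c hP.lipschitz_dc hx hz
  · rw [← Real.sqrt_sq (by positivity : 0 ≤ P.Lq / 2 * ‖x - z‖ ^ 2),
      ← Real.sqrt_mul (by positivity)]
    apply Real.sqrt_le_sqrt
    have : ∀ j ∈ Finset.univ, ‖P.q j x - P.q j z - fderiv ℝ (P.q j) z (x - z)‖ ^ 2
        ≤ (P.Lq / 2 * ‖x - z‖ ^ 2) ^ 2 := fun j _ => by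
      gcongr
      exact norm_sub_fderiv_le hP.open_O hP.convex_O (hP.smooth_q j) (hP.lipschitz_dq j) hx hz
    simpa using Finset.sum_le_sum this

lemma Regular.integrable_costModel (hP : P.Regular) {z x : Vec d} (hz : z ∈ P.O) (hx : x ∈ P.O) :
    Integrable (fun e => P.costModel z e x) P.noise := by
  have := hP.noise_prob
  have h1 : Continuous fun e => P.costModel z e x := by
    have h : Continuous fun e : Vec l => (e, x) := by fun_prop
    exact (hP.continuousOn_linModel _ _ _ _ z).comp_continuous h fun e => ⟨trivial, hx⟩
  have h2 : Integrable (fun e => P.costModel z e x - P.φ x (P.c x + matOp (P.Q x) e)) P.noise := by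
    refine Integrable.mono' (g := fun e => P.Lφ * (P.Lc / 2 * ‖x - z‖ ^ 2
      + Real.sqrt l * (P.Lq / 2 * ‖x - z‖ ^ 2) * ‖e‖)) ?_ ?_
      (ae_of_all _ fun e => hP.abs_costModel_sub_cost_le hz hx e)
    · exact ((integrable_const _).add (hP.integrable_id.norm.const_mul _)).const_mul _
    · exact h1.aestronglyMeasurable.sub (hP.integrable_objective hx).1
  exact (h2.add (hP.integrable_objective hx)).congr (ae_of_all _ fun e => by simp)

lemma model_self (z : Vec d) : P.model z z = P.f z := by
  simp_rw [model, f, costModel_self]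

/-- The factor `ℓ` in `τ` is `√ℓ · √ℓ`: one root from the `ℓ` row remainders, the other from the
mean of `‖e‖`. -/
lemma Regular.abs_model_sub_le (hP : P.Regular) {z x : Vec d} (hz : z ∈ P.O) (hx : x ∈ P.O) :
    |P.model z x - P.f x| ≤ P.τ / 2 * ‖x - z‖ ^ 2 := by
  have := hP.noise_prob
  rw [model, f, ← integral_sub (hP.integrable_costModel hz hx) (hP.integrable_objective hx)]
  refine (abs_integral_le_integral_abs).trans ?_
  calc ∫ e, |P.costModel z e x - P.φ x (P.c x + matOp (P.Q x) e)| ∂P.noise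
      ≤ ∫ e, P.Lφ * (P.Lc / 2 * ‖x - z‖ ^ 2
        + Real.sqrt l * (P.Lq / 2 * ‖x - z‖ ^ 2) * ‖e‖) ∂P.noise := by
        refine integral_mono_of_nonneg (ae_of_all _ fun e => abs_nonneg _) ?_
          (ae_of_all _ fun e => hP.abs_costModel_sub_cost_le hz hx e)
        exact ((integrable_const _).add (hP.integrable_id.norm.const_mul _)).const_mul _
    _ = P.Lφ * (P.Lc / 2 * ‖x - z‖ ^ 2
        + Real.sqrt l * (P.Lq / 2 * ‖x - z‖ ^ 2) * ∫ e, ‖e‖ ∂P.noise) := by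
        rw [integral_const_mul, integral_add (integrable_const _)
          (hP.integrable_id.norm.const_mul _)]
        simp [integral_const_mul]
    _ ≤ P.Lφ * (P.Lc / 2 * ‖x - z‖ ^ 2
        + Real.sqrt l * (P.Lq / 2 * ‖x - z‖ ^ 2) * Real.sqrt l) := by
        gcongr
        exact hP.integral_norm_le
    _ = P.Lφ * (P.Lc / 2 * ‖x - z‖ ^ 2
        + (Real.sqrt l * Real.sqrt l) * (P.Lq / 2 * ‖x - z‖ ^ 2)) := by ring
    _ = _ := by
        rw [Real.mul_self_sqrt (Nat.cast_nonneg l), τ]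
        ring

lemma Regular.convexOn_model (hP : P.Regular) {z : Vec d} (hz : z ∈ P.O) :
    ConvexOn ℝ P.O (P.model z) := by
  refine ⟨hP.convex_O, fun x hx y hy a b ha hb hab => ?_⟩
  have hxy := hP.convex_O hx hy ha hb hab
  rw [model, model, model, smul_eq_mul, smul_eq_mul, ← integral_const_mul, ← integral_const_mul,
    ← integral_add ((hP.integrable_costModel hz hx).const_mul a)
      ((hP.integrable_costModel hz hy).const_mul b)]
  refine integral_mono (hP.integrable_costModel hz hxy)
    (((hP.integrable_costModel hz hx).const_mul a).add
      ((hP.integrable_costModel hz hy).const_mul b)) fun e => ?_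
  exact (hP.convexOn_linModel _ _ _ _ z e).2 hx hy ha hb hab

lemma τ_nonneg : 0 ≤ P.τ := by unfold τ; positivity

/-- Weak convexity of the objective. -/
lemma Regular.convexOn_f (hP : P.Regular) (w : Vec d) :
    ConvexOn ℝ P.O fun x => P.f x + P.τ / 2 * ‖x - w‖ ^ 2 := by
  refine ⟨hP.convex_O, fun x hx y hy a b ha hb hab => ?_⟩
  have hxy := hP.convex_O hx hy ha hb hab
  -- The model is taken at the convex combination itself. There it equals `f`, and it is convex, so
  -- only its error at the two endpoints has to be paid; these errors add up to exactly the defect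
  -- of the quadratic term.
  have h1 := (hP.convexOn_model hxy).2 hx hy ha hb hab
  rw [model_self] at h1
  have h2 := (abs_le.1 (hP.abs_model_sub_le hxy hx)).2
  have h3 := (abs_le.1 (hP.abs_model_sub_le hxy hy)).2
  obtain rfl : a = 1 - b := by linarith
  have e1 := norm_lineMap_sub_sq y x w b
  have e2 : ‖x - ((1 - b) • x + b • y)‖ = b * ‖y - x‖ := by
    have : x - ((1 - b) • x + b • y) = (-b) • (y - x) := by module
    rw [this, norm_smul, norm_neg, Real.norm_of_nonneg hb]
  have e3 : ‖y - ((1 - b) • x + b • y)‖ = (1 - b) * ‖y - x‖ := by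
    have : y - ((1 - b) • x + b • y) = (1 - b) • (y - x) := by module
    rw [this, norm_smul, Real.norm_of_nonneg ha]
  rw [e2, mul_pow] at h2
  rw [e3, mul_pow] at h3
  simp only [smul_eq_mul] at h1 ⊢
  rw [e1]
  nlinarith [mul_le_mul_of_nonneg_left h2 ha, mul_le_mul_of_nonneg_left h3 hb]

lemma Regular.continuousOn_f (hP : P.Regular) : ContinuousOn P.f P.O := by
  have h := (hP.convexOn_f 0).continuousOn hP.open_O
  have h2 : ContinuousOn (fun x : Vec d => P.τ / 2 * ‖x - 0‖ ^ 2) P.O := by fun_prop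
  exact (h.sub h2).congr fun x _ => by simp

lemma Regular.bddAbove_gap (hP : P.Regular) :
    BddAbove ((fun p : Vec d × Vec d => P.f p.1 - P.f p.2) '' (P.X ×ˢ P.X)) := by
  apply (hP.compact_X.prod hP.compact_X).bddAbove_image
  have h := hP.continuousOn_f.mono hP.X_subset
  exact (h.comp continuousOn_fst fun p hp => hp.1).sub (h.comp continuousOn_snd fun p hp => hp.2)

lemma Regular.sub_le_Δ₀ (hP : P.Regular) {x y : Vec d} (hx : x ∈ P.X) (hy : y ∈ P.X) :
    P.f x - P.f y ≤ P.Δ₀ :=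
  le_csSup hP.bddAbove_gap ⟨(x, y), ⟨hx, hy⟩, rfl⟩

lemma Regular.Δ₀_nonneg (hP : P.Regular) : 0 ≤ P.Δ₀ := by
  rcases P.X.eq_empty_or_nonempty with h | ⟨x, hx⟩
  · simp [Δ₀, h]
  · simpa using hP.sub_le_Δ₀ hx hx

/-- With `L_φ = 0` the cost is constant on `O`, hence so is the objective. -/
lemma Regular.Δ₀_eq_zero (hP : P.Regular) (hL : P.L = 0) : P.Δ₀ = 0 := by
  have hφ : (P.Lφ : ℝ) = 0 := le_antisymm (hL ▸ Lφ_le_L) P.Lφ.coe_nonneg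
  refine le_antisymm (Real.sSup_le ?_ le_rfl) hP.Δ₀_nonneg
  rintro _ ⟨⟨x, y⟩, ⟨hx, hy⟩, rfl⟩
  have : P.f x = P.f y := by
    refine integral_congr_ae (ae_of_all _ fun e => ?_)
    have := hP.abs_cost_sub_le (hP.X_subset hx) (hP.X_subset hy)
      (P.c x + matOp (P.Q x) e) (P.c y + matOp (P.Q y) e)
    rw [hφ, zero_mul] at this
    simpa [sub_eq_zero] using this
  simp [this]

/-! #### Proximal points and the Moreau envelope -/

lemma Regular.argminOn_prox (hP : P.Regular) (hne : P.X.Nonempty) {ρ : ℝ} (hρ : P.τ < ρ)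
    (x : Vec d) : argminOn (fun y => P.f y + 1 / (2 * (1 / ρ)) * ‖y - x‖ ^ 2) P.X
      = {prox P.f P.X (1 / ρ) x} := by
  have hρ0 : 0 < ρ := τ_nonneg.trans_lt hρ
  have e1 : (fun y => P.f y + 1 / (2 * (1 / ρ)) * ‖y - x‖ ^ 2)
      = fun y => (P.f y + P.τ / 2 * ‖y - x‖ ^ 2) + (ρ - P.τ) / 2 * ‖y - x‖ ^ 2 := by
    ext y
    have : 1 / (2 * (1 / ρ)) = ρ / 2 := by field_simp
    rw [this]; ring
  have hc : ContinuousOn (fun y => P.f y + P.τ / 2 * ‖y - x‖ ^ 2) P.X := by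
    have := hP.continuousOn_f.mono hP.X_subset
    fun_prop
  obtain ⟨y, hy⟩ := exists_argminOn_eq_singleton hP.compact_X hne
    ((hP.convexOn_f x).subset hP.X_subset hP.convex_X) hc (α := ρ - P.τ) (by linarith) x
  have hs : prox P.f P.X (1 / ρ) x
      ∈ argminOn (fun y => P.f y + 1 / (2 * (1 / ρ)) * ‖y - x‖ ^ 2) P.X :=
    Classical.epsilon_spec (p := fun y => y ∈ argminOn
      (fun y => P.f y + 1 / (2 * (1 / ρ)) * ‖y - x‖ ^ 2) P.X) ⟨y, by rw [e1, hy]; rfl⟩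
  rw [e1, hy] at hs ⊢
  rw [mem_singleton_iff.1 hs]

lemma Regular.prox_mem (hP : P.Regular) (hne : P.X.Nonempty) {ρ : ℝ} (hρ : P.τ < ρ)
    (x : Vec d) : prox P.f P.X (1 / ρ) x ∈ P.X := by
  have : prox P.f P.X (1 / ρ) x
      ∈ argminOn (fun y => P.f y + 1 / (2 * (1 / ρ)) * ‖y - x‖ ^ 2) P.X := by
    rw [hP.argminOn_prox hne hρ x]; rfl
  exact this.1

/-- Weak convexity consumes `τ` of the proximal parameter; the remaining `ρ - τ` is the modulus of
growth. -/
lemma Regular.prox_growth (hP : P.Regular) {ρ : ℝ} (hρ : P.τ < ρ)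
    (x : Vec d) {y : Vec d} (hy : y ∈ P.X) :
    P.f (prox P.f P.X (1 / ρ) x) + ρ / 2 * ‖prox P.f P.X (1 / ρ) x - x‖ ^ 2
      + (ρ - P.τ) / 2 * ‖y - prox P.f P.X (1 / ρ) x‖ ^ 2 ≤ P.f y + ρ / 2 * ‖y - x‖ ^ 2 := by
  have hρ0 : 0 < ρ := τ_nonneg.trans_lt hρ
  have h : prox P.f P.X (1 / ρ) x
      ∈ argminOn (fun y => P.f y + 1 / (2 * (1 / ρ)) * ‖y - x‖ ^ 2) P.X := by
    rw [hP.argminOn_prox ⟨y, hy⟩ hρ x]; rfl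
  have e1 : (fun y => P.f y + 1 / (2 * (1 / ρ)) * ‖y - x‖ ^ 2)
      = fun y => (P.f y + P.τ / 2 * ‖y - x‖ ^ 2) + (ρ - P.τ) / 2 * ‖y - x‖ ^ 2 := by
    ext y
    have : 1 / (2 * (1 / ρ)) = ρ / 2 := by field_simp
    rw [this]; ring
  rw [e1] at h
  have := argminOn_growth ((hP.convexOn_f x).subset hP.X_subset hP.convex_X) h hy
  linarith

/-- Adding the growth inequalities at two centers cancels `f` and leaves `(ρ - τ) ‖p - p'‖² ≤ ρ ⟪p -
p', x - x'⟫`, hence a Lipschitz constant `ρ / (ρ - τ)`. -/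
lemma Regular.continuous_prox (hP : P.Regular) (hne : P.X.Nonempty) {ρ : ℝ} (hρ : P.τ < ρ) :
    Continuous (prox P.f P.X (1 / ρ)) := by
  have hρ0 : 0 < ρ := τ_nonneg.trans_lt hρ
  have hρτ : 0 < ρ - P.τ := by linarith
  have : LipschitzWith (Real.toNNReal (ρ / (ρ - P.τ))) (prox P.f P.X (1 / ρ)) := by
    refine LipschitzWith.of_dist_le_mul fun x x' => ?_
    rw [Real.coe_toNNReal _ (by positivity), dist_eq_norm, dist_eq_norm]
    have h1 := hP.prox_growth hρ x (hP.prox_mem hne hρ x')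
    have h2 := hP.prox_growth hρ x' (hP.prox_mem hne hρ x)
    set p := prox P.f P.X (1 / ρ) x
    set p' := prox P.f P.X (1 / ρ) x'
    rw [norm_sub_rev p' p] at h1
    have h3 : ‖p' - x‖ ^ 2 - ‖p - x‖ ^ 2 + ‖p - x'‖ ^ 2 - ‖p' - x'‖ ^ 2
        = 2 * inner ℝ (p - p') (x - x') := by
      rw [norm_sub_sq_real, norm_sub_sq_real, norm_sub_sq_real, norm_sub_sq_real, inner_sub_left,
        inner_sub_right, inner_sub_right]
      ring
    have h4 := real_inner_le_norm (p - p') (x - x')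
    have h5 : (ρ - P.τ) * ‖p - p'‖ ^ 2 ≤ ρ * (‖p - p'‖ * ‖x - x'‖) := by nlinarith
    rw [div_mul_eq_mul_div, le_div_iff₀ hρτ]
    rcases (norm_nonneg (p - p')).eq_or_lt with h0 | h0
    · rw [← h0, zero_mul]; positivity
    · refine le_of_mul_le_mul_left ?_ h0
      nlinarith
  exact this.continuous

/-- The Moreau envelope of the objective on the feasible set. -/
def envelope (P : Problem d l) (ρ : ℝ) (x : Vec d) : ℝ :=
  P.f (prox P.f P.X (1 / ρ) x) + ρ / 2 * ‖prox P.f P.X (1 / ρ) x - x‖ ^ 2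

lemma Regular.continuous_envelope (hP : P.Regular) (hne : P.X.Nonempty) {ρ : ℝ} (hρ : P.τ < ρ) :
    Continuous (P.envelope ρ) := by
  have h1 := hP.continuous_prox hne hρ
  have h2 : Continuous fun x => P.f (prox P.f P.X (1 / ρ) x) :=
    (hP.continuousOn_f.mono hP.X_subset).comp_continuous h1 fun x => hP.prox_mem hne hρ x
  unfold envelope
  fun_prop

lemma Regular.envelope_le (hP : P.Regular) {ρ : ℝ} (hρ : P.τ < ρ) (x : Vec d) {y : Vec d}
    (hy : y ∈ P.X) : P.envelope ρ x ≤ P.f y + ρ / 2 * ‖y - x‖ ^ 2 := by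
  have h := hP.prox_growth hρ x hy
  have : 0 ≤ (ρ - P.τ) / 2 * ‖y - prox P.f P.X (1 / ρ) x‖ ^ 2 := by
    have : 0 < ρ - P.τ := by linarith
    positivity
  rw [envelope]
  linarith

end Problem

/-! ### Stationarity of proximal points -/

/-- Limits of gradients at points of differentiability that converge to `x`. -/
def limitGradients {d : ℕ} (f : Vec d → ℝ) (x : Vec d) : Set (Vec d) :=
  {g | ∃ y : ℕ → Vec d, (∀ k, DifferentiableAt ℝ f (y k)) ∧
    Tendsto y atTop (𝓝 x) ∧ Tendsto (fun k => gradient f (y k)) atTop (𝓝 g)}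

lemma add_fderiv_le_of_convexOn {E : Type*} [NormedAddCommGroup E] [NormedSpace ℝ E] {O : Set E}
    {h : E → ℝ} (hh : ConvexOn ℝ O h) {x y : E} (hx : x ∈ O) (hy : y ∈ O) {h' : E →L[ℝ] ℝ}
    (hd : HasFDerivAt h h' y) : h y + h' (x - y) ≤ h x := by
  have h1 : HasDerivAt (fun t : ℝ => y + t • (x - y)) (x - y) 0 := by
    simpa using ((hasDerivAt_id (0 : ℝ)).smul_const (x - y)).const_add y
  have h2 : HasDerivAt (fun t : ℝ => h (y + t • (x - y))) (h' (x - y)) 0 :=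
    HasFDerivAt.comp_hasDerivAt (0 : ℝ) (by simpa using hd) h1
  have h3 := h2.tendsto_slope_zero_right
  have : h' (x - y) ≤ h x - h y := by
    refine le_of_tendsto h3 ?_
    filter_upwards [Ioo_mem_nhdsGT (zero_lt_one : (0 : ℝ) < 1)] with t ht
    have h4 := hh.2 hy hx (by linarith [ht.2] : 0 ≤ 1 - t) ht.1.le (by ring)
    have h5 : (1 - t) • y + t • x = y + t • (x - y) := by module
    rw [h5] at h4
    simp only [smul_eq_mul] at h4
    simp only [zero_add, zero_smul, add_zero, smul_eq_mul]
    rw [inv_mul_le_iff₀ ht.1]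
    linarith
  linarith

namespace Problem

variable {d l : ℕ} {P : Problem d l}

/-- A convex function minus a smooth quadratic, both locally Lipschitz on an open set. -/
lemma Regular.exists_lipschitz_ball (hP : P.Regular) {p : Vec d} (hp : p ∈ P.O) :
    ∃ R > 0, ∃ K : ℝ≥0, Metric.ball p R ⊆ P.O ∧ LipschitzOnWith K P.f (Metric.ball p R) := by
  obtain ⟨K₁, s₁, hs₁, h₁⟩ := (hP.convexOn_f 0).locallyLipschitzOn hP.open_O hp
  have hq : ContDiff ℝ 1 fun x : Vec d => P.τ / 2 * ‖x - 0‖ ^ 2 := by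
    have : ContDiff ℝ 1 fun x : Vec d => ‖x‖ ^ 2 := contDiff_norm_sq ℝ
    simpa using contDiff_const.mul this
  obtain ⟨K₂, s₂, hs₂, h₂⟩ := hq.locallyLipschitz p
  rw [hP.open_O.nhdsWithin_eq hp] at hs₁
  obtain ⟨R, hR, hball⟩ := Metric.mem_nhds_iff.1
    (inter_mem (inter_mem hs₁ hs₂) (hP.open_O.mem_nhds hp))
  refine ⟨R, hR, K₁ + K₂, fun x hx => (hball hx).2, ?_⟩
  have := (h₁.mono fun x hx => (hball hx).1.1).sub (h₂.mono fun x hx => (hball hx).1.2)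
  simpa using this

/-- Rademacher's theorem on a ball where `f` is Lipschitz; sets of full measure are dense. -/
lemma Regular.exists_differentiableAt (hP : P.Regular) {y : Vec d} (hy : y ∈ P.O) {ε : ℝ}
    (hε : 0 < ε) : ∃ y', ‖y' - y‖ < ε ∧ DifferentiableAt ℝ P.f y' := by
  obtain ⟨R, hR, K, hRO, hK⟩ := hP.exists_lipschitz_ball hy
  have h1 := hK.ae_differentiableWithinAt_of_mem (μ := (volume : Measure (Vec d)))
  obtain ⟨y', hy', hd⟩ := (dense_iff_inter_open.1 (Measure.dense_of_ae h1)) _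
    (Metric.isOpen_ball (x := y) (ε := min R ε)) ⟨y, by simp [hR, hε]⟩
  have hy1 : y' ∈ Metric.ball y R := Metric.ball_subset_ball (min_le_left _ _) hy'
  have hy2 : y' ∈ Metric.ball y ε := Metric.ball_subset_ball (min_le_right _ _) hy'
  exact ⟨y', mem_ball_iff_norm.1 hy2, (hd hy1).differentiableAt (Metric.isOpen_ball.mem_nhds hy1)⟩

/-- The gradient inequality for the convex function `f + τ/2 ‖· - y‖²`, which has the same gradient
at `y`, evaluated at `y - t a`: the backward difference quotient bounds the directional derivative
from below. -/
lemma Regular.le_inner_gradient (hP : P.Regular) {y a : Vec d} {t : ℝ} (ht : 0 < t)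
    (hy : y ∈ P.O) (hya : y - t • a ∈ P.O) (hd : DifferentiableAt ℝ P.f y) :
    (P.f y - P.f (y - t • a)) / t - P.τ / 2 * t * ‖a‖ ^ 2 ≤ inner ℝ (gradient P.f y) a := by
  have h1 : HasFDerivAt (fun x : Vec d => P.f x + P.τ / 2 * ‖x - y‖ ^ 2) (fderiv ℝ P.f y) y := by
    have h2 : HasFDerivAt (fun x : Vec d => ‖x - y‖ ^ 2) (0 : Vec d →L[ℝ] ℝ) y := by
      have := ((hasFDerivAt_id y).sub_const y).norm_sq
      simpa using this
    have h3 := hd.hasFDerivAt.add (h2.const_mul (P.τ / 2))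
    rw [smul_zero, add_zero] at h3
    exact h3
  have h3 := add_fderiv_le_of_convexOn (hP.convexOn_f y) hya hy h1
  have h4 : y - t • a - y = -(t • a) := by abel
  rw [h4, map_neg, map_smul, norm_neg, norm_smul, Real.norm_of_nonneg ht.le, sub_self, norm_zero]
    at h3
  have h5 : inner ℝ (gradient P.f y) a = fderiv ℝ P.f y a := by
    rw [gradient, InnerProductSpace.toDual_symm_apply]
  rw [h5, div_sub' ht.ne', div_le_iff₀ ht]
  simp only [smul_eq_mul] at h3
  nlinarith

lemma Regular.norm_gradient_le (_hP : P.Regular) {p : Vec d} {R : ℝ} {K : ℝ≥0}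
    (hK : LipschitzOnWith K P.f (Metric.ball p R)) {y : Vec d} (hy : y ∈ Metric.ball p R) :
    ‖gradient P.f y‖ ≤ K := by
  rw [gradient, LinearIsometryEquiv.norm_map]
  exact norm_fderiv_le_of_lipschitzOn ℝ (Metric.isOpen_ball.mem_nhds hy) hK

/-- Limiting gradients at a proximal point dominate the proximal direction along every feasible
direction. -/
lemma Regular.exists_limitGradient (hP : P.Regular) {ρ : ℝ} (hρ : P.τ < ρ)
    (z : Vec d) {x : Vec d} (hx : x ∈ P.X) :
    ∃ g ∈ limitGradients P.f (prox P.f P.X (1 / ρ) z),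
      inner ℝ (ρ • (z - prox P.f P.X (1 / ρ) z)) (x - prox P.f P.X (1 / ρ) z)
        ≤ inner ℝ g (x - prox P.f P.X (1 / ρ) z) := by
  have hpX := hP.prox_mem ⟨x, hx⟩ hρ z
  have hmin : ∀ y ∈ P.X, P.f (prox P.f P.X (1 / ρ) z) + ρ / 2 * ‖prox P.f P.X (1 / ρ) z - z‖ ^ 2
      ≤ P.f y + ρ / 2 * ‖y - z‖ ^ 2 := fun y hy => hP.envelope_le hρ z hy
  set p := prox P.f P.X (1 / ρ) z
  set a := x - p with ha
  obtain ⟨R, hR, K, hRO, hK⟩ := hP.exists_lipschitz_ball (hP.X_subset hpX)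
  -- step sizes for which the points stay in the ball
  have hex : ∀ t : ℝ, 0 < t → t ≤ 1 → t * (‖a‖ + 1) < R → ∃ y, ‖y - p‖ < t * (‖a‖ + 1) ∧
      DifferentiableAt ℝ P.f y ∧ inner ℝ (ρ • (z - p)) a
        - t * (ρ / 2 * ‖a‖ ^ 2 + 2 * K + P.τ / 2 * ‖a‖ ^ 2) ≤ inner ℝ (gradient P.f y) a := by
    intro t ht ht1 htR
    have hta : p + t • a ∈ P.X := by
      have : p + t • a = (1 - t) • p + t • x := by rw [ha]; module
      rw [this]
      exact hP.convex_X hpX hx (by linarith) ht.le (by ring)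
    -- A point of differentiability within `t²` of `p + t a`. The displacement costs `2 K t²` in the
    -- difference of values, thus only `O(t)` after division by `t`. Then `y - t a` is close to `p`,
    -- and minimality of `p` bounds the backward quotient from below.
    obtain ⟨y, hy, hyd⟩ := hP.exists_differentiableAt (hP.X_subset hta) (pow_pos ht 2)
    have hyp : ‖y - p‖ < t * (‖a‖ + 1) := by
      have h1 : y - p = (y - (p + t • a)) + t • a := by abel
      have h2 := norm_add_le (y - (p + t • a)) (t • a)
      rw [← h1, norm_smul, Real.norm_of_nonneg ht.le] at h2
      nlinarith
    have hyb : y ∈ Metric.ball p R := mem_ball_iff_norm.2 (hyp.trans htR)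
    have htab : p + t • a ∈ Metric.ball p R := by
      rw [mem_ball_iff_norm, add_sub_cancel_left, norm_smul, Real.norm_of_nonneg ht.le]
      nlinarith
    have hyab : y - t • a ∈ Metric.ball p R := by
      rw [mem_ball_iff_norm]
      have h1 : y - t • a - p = y - (p + t • a) := by abel
      rw [h1]
      nlinarith [mul_nonneg ht.le (norm_nonneg a)]
    have hpb : p ∈ Metric.ball p R := Metric.mem_ball_self hR
    refine ⟨y, hyp, hyd, le_trans ?_ (hP.le_inner_gradient ht (hRO hyb) (hRO hyab) hyd)⟩
    have h1 := hK.norm_sub_le hyb htab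
    have h2 := hK.norm_sub_le hyab hpb
    have h3 : y - t • a - p = y - (p + t • a) := by abel
    rw [h3] at h2
    rw [Real.norm_eq_abs] at h1 h2
    have h4 : (K : ℝ) * ‖y - (p + t • a)‖ ≤ K * t ^ 2 := by gcongr
    have h5 := (abs_le.1 (h1.trans h4)).1
    have h6 := (abs_le.1 (h2.trans h4)).2
    have h7 := hmin _ hta
    have h8 : ‖p + t • a - z‖ ^ 2 = ‖p - z‖ ^ 2 + 2 * t * inner ℝ (p - z) a + t ^ 2 * ‖a‖ ^ 2 := by
      have : p + t • a - z = (p - z) + t • a := by abel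
      rw [this, norm_add_sq_real, inner_smul_right, norm_smul, mul_pow, Real.norm_of_nonneg ht.le]
      ring
    rw [h8] at h7
    have h9 : inner ℝ (ρ • (z - p)) a = -(ρ * inner ℝ (p - z) a) := by
      rw [inner_smul_left, ← neg_sub p z, inner_neg_left]
      simp
    rw [h9, le_sub_iff_add_le, le_div_iff₀ ht]
    nlinarith
  -- a sequence of such points
  have hsm : ∀ᶠ k : ℕ in atTop, (1 / ((k : ℝ) + 1)) * (‖a‖ + 1) < R := by
    have h := (tendsto_one_div_add_atTop_nhds_zero_nat (𝕜 := ℝ)).mul_const (‖a‖ + 1)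
    rw [zero_mul] at h
    exact h.eventually (gt_mem_nhds hR)
  obtain ⟨k₀, hk₀⟩ := eventually_atTop.1 hsm
  have hpos : ∀ k : ℕ, 0 < 1 / (((k + k₀ : ℕ) : ℝ) + 1) := fun k => by positivity
  have hle1 : ∀ k : ℕ, 1 / (((k + k₀ : ℕ) : ℝ) + 1) ≤ 1 := fun k => by
    rw [div_le_one (by positivity)]
    linarith [(Nat.cast_nonneg (k + k₀) : (0 : ℝ) ≤ ((k + k₀ : ℕ) : ℝ))]
  choose y hy1 hy2 hy3 using fun k : ℕ => hex _ (hpos k) (hle1 k) (hk₀ (k + k₀) (by omega))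
  have hlim0 : Tendsto (fun k : ℕ => 1 / (((k + k₀ : ℕ) : ℝ) + 1)) atTop (𝓝 0) :=
    (tendsto_one_div_add_atTop_nhds_zero_nat (𝕜 := ℝ)).comp (tendsto_add_atTop_nat k₀)
  have hylim : Tendsto y atTop (𝓝 p) := by
    rw [tendsto_iff_norm_sub_tendsto_zero]
    have h := hlim0.mul_const (‖a‖ + 1)
    rw [zero_mul] at h
    exact squeeze_zero (fun _ => norm_nonneg _) (fun k => (hy1 k).le) h
  have hgb : ∀ k, gradient P.f (y k) ∈ Metric.closedBall (0 : Vec d) K := fun k => by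
    rw [mem_closedBall_zero_iff]
    exact hP.norm_gradient_le hK (mem_ball_iff_norm.2 ((hy1 k).trans (hk₀ (k + k₀) (by omega))))
  -- The gradients are bounded by the local Lipschitz constant, so a subsequence converges, and the
  -- `O(t)` error vanishes in the limit.
  obtain ⟨g, -, φ, hφ, hg⟩ := tendsto_subseq_of_bounded Metric.isBounded_closedBall hgb
  refine ⟨g, ⟨y ∘ φ, fun k => hy2 _, hylim.comp hφ.tendsto_atTop, hg⟩, ?_⟩
  have hr : Tendsto (fun k => inner ℝ (gradient P.f (y (φ k))) a) atTop (𝓝 (inner ℝ g a)) :=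
    hg.inner tendsto_const_nhds
  have hl : Tendsto (fun k => inner ℝ (ρ • (z - p)) a - 1 / (((φ k + k₀ : ℕ) : ℝ) + 1)
      * (ρ / 2 * ‖a‖ ^ 2 + 2 * K + P.τ / 2 * ‖a‖ ^ 2)) atTop (𝓝 (inner ℝ (ρ • (z - p)) a - 0
      * (ρ / 2 * ‖a‖ ^ 2 + 2 * K + P.τ / 2 * ‖a‖ ^ 2))) :=
    ((hlim0.comp hφ.tendsto_atTop).mul_const _).const_sub _
  rw [zero_mul, sub_zero] at hl
  exact le_of_tendsto_of_tendsto' hl hr fun k => hy3 (φ k)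

lemma Regular.exists_norm_limitGradient_le (hP : P.Regular) {p : Vec d} (hp : p ∈ P.O) :
    ∃ K : ℝ, limitGradients P.f p ⊆ Metric.closedBall 0 K := by
  obtain ⟨R, hR, K, hRO, hK⟩ := hP.exists_lipschitz_ball hp
  refine ⟨K, ?_⟩
  rintro g ⟨y, -, hy, hg⟩
  refine Metric.isClosed_closedBall.mem_of_tendsto hg ?_
  filter_upwards [hy.eventually (Metric.ball_mem_nhds p hR)] with k hk
  rw [mem_closedBall_zero_iff]
  exact hP.norm_gradient_le hK hk

/-- The distance from stationarity at a proximal point. -/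
theorem Regular.infEDist_prox_le (hP : P.Regular) (hne : P.X.Nonempty) {ρ : ℝ} (hρ : P.τ < ρ)
    (z : Vec d) :
    Metric.infEDist 0 (clarkeSubdiff P.f (prox P.f P.X (1 / ρ) z)
      + normalCone P.X (prox P.f P.X (1 / ρ) z)) ≤ ‖ρ • (z - prox P.f P.X (1 / ρ) z)‖ₑ := by
  have hpX := hP.prox_mem hne hρ z
  have hlg := fun x hx => hP.exists_limitGradient hρ z (x := x) hx
  set p := prox P.f P.X (1 / ρ) z
  set v := ρ • (z - p)
  have hcl : clarkeSubdiff P.f p = convexHull ℝ (limitGradients P.f p) := rfl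
  obtain ⟨K, hK⟩ := hP.exists_norm_limitGradient_le (hP.X_subset hpX)
  set Y := closure (clarkeSubdiff P.f p) with hY
  have hYc : Convex ℝ Y := (convex_convexHull ℝ _).closure
  have hsub : limitGradients P.f p ⊆ Y := (subset_convexHull ℝ _).trans subset_closure
  have hYk : IsCompact Y := by
    refine Metric.isCompact_of_isClosed_isBounded isClosed_closure ?_
    refine Metric.isBounded_closedBall.subset
      (closure_minimal (convexHull_min hK (convex_closedBall 0 K)) Metric.isClosed_closedBall)
  have hYne : Y.Nonempty := by
    obtain ⟨g, hg, -⟩ := hlg p hpX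
    exact ⟨g, hsub hg⟩
  -- For each `x` some limiting gradient makes the pairing with `x - p` nonpositive, but it depends
  -- on `x`. A saddle point over the compact convex closure `Y` and `X` gives a single `k` that
  -- works for all `x`, that is, `v - k` is normal to `X` at `p`.
  obtain ⟨k, hk, x₀, hx₀, hsad⟩ := Sion.exists_isSaddlePointOn
    (f := fun k x : Vec d => inner ℝ (v - k) (x - p)) hYne hYc hYk
    (fun x _ => (by fun_prop : Continuous fun k : Vec d =>
      inner ℝ (v - k) (x - p)).continuousOn.lowerSemicontinuousOn)
    (fun x _ => by
      refine ConvexOn.quasiconvexOn ⟨hYc, fun k _ k' _ a b _ _ hab => le_of_eq ?_⟩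
      obtain rfl : a = 1 - b := by linarith
      simp only [inner_sub_left, inner_add_left, inner_smul_left, smul_eq_mul, conj_trivial]
      ring)
    hP.convex_X hne hP.compact_X
    (fun k _ => (by fun_prop : Continuous fun x : Vec d =>
      inner ℝ (v - k) (x - p)).continuousOn.upperSemicontinuousOn)
    (fun k _ => by
      refine ConcaveOn.quasiconcaveOn ⟨hP.convex_X, fun x _ x' _ a b _ _ hab => le_of_eq ?_⟩
      obtain rfl : a = 1 - b := by linarith
      simp only [inner_sub_right, inner_add_right, inner_smul_right, smul_eq_mul]
      ring)
  obtain ⟨g, hg, hgi⟩ := hlg x₀ hx₀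
  have hnc : v - k ∈ normalCone P.X p := fun x hx => by
    have h1 := hsad g (hsub hg) x hx
    simp only at h1
    have h2 : inner ℝ (v - g) (x₀ - p) ≤ (0 : ℝ) := by
      rw [inner_sub_left]; linarith
    exact h1.trans h2
  -- The saddle point `k` is only known to lie in the closure of the subdifferential, so it is
  -- approximated from within; a distance tolerates this.
  refine ENNReal.le_of_forall_pos_le_add fun ε hε _ => ?_
  obtain ⟨k', hk', hkk⟩ := EMetric.mem_closure_iff.1 hk ε (by exact_mod_cast hε)
  refine (Metric.infEDist_le_edist_of_mem (add_mem_add hk' hnc)).trans ?_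
  rw [edist_comm, edist_zero_right]
  have h1 : k' + (v - k) = v + (k' - k) := by abel
  rw [h1]
  refine (enorm_add_le _ _).trans ?_
  gcongr
  rw [← edist_eq_enorm_sub, edist_comm]
  exact hkk.le

end Problem

/-! ### Stability of sample average minimization -/

lemma integral_comp_measurePreserving {α β : Type*} [MeasurableSpace α] [MeasurableSpace β]
    {μ : Measure α} {ν : Measure β} {f : α → β} (hf : MeasurePreserving f μ ν) {g : β → ℝ}
    (hg : AEStronglyMeasurable g ν) : ∫ x, g (f x) ∂μ = ∫ y, g y ∂ν := by
  rw [← hf.map_eq, integral_map hf.measurable.aemeasurable (by rwa [hf.map_eq])]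

lemma convexOn_average {E : Type*} [AddCommGroup E] [Module ℝ E] {X : Set E} {m : ℕ}
    {g : Fin m → E → ℝ} (hX : Convex ℝ X) (hg : ∀ i, ConvexOn ℝ X (g i)) :
    ConvexOn ℝ X fun x => 1 / (m : ℝ) * ∑ i, g i x := by
  refine ⟨hX, fun x hx y hy a b ha hb hab => ?_⟩
  have h := Finset.sum_le_sum fun i (_ : i ∈ Finset.univ) => (hg i).2 hx hy ha hb hab
  simp only [smul_eq_mul, Finset.sum_add_distrib, ← Finset.mul_sum] at h ⊢
  calc _ ≤ 1 / (m : ℝ) * (a * ∑ i, g i x + b * ∑ i, g i y) := by gcongr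
    _ = _ := by ring

/-- Exchange of the two halves of the `i`-th coordinate. -/
def swapAt {W : Type*} {m : ℕ} (i : Fin m) (v : Fin m → W × W) : Fin m → W × W :=
  fun j => (if j = i then Prod.swap else id) (v j)

lemma measurePreserving_swapAt {W : Type*} [MeasurableSpace W] (ν : Measure W)
    [IsProbabilityMeasure ν] {m : ℕ} (i : Fin m) :
    MeasurePreserving (swapAt i) (Measure.pi fun _ : Fin m => ν.prod ν)
      (Measure.pi fun _ : Fin m => ν.prod ν) := by
  refine measurePreserving_pi _ _ (f := fun j => if j = i then Prod.swap else id) fun j => ?_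
  split_ifs
  · exact Measure.measurePreserving_swap
  · exact MeasurePreserving.id _

/-- The first halves with the `i`-th second half form a sample and one independent fresh draw; this
expresses the population value over the doubled sample. -/
lemma measurePreserving_fst_ghost {W : Type*} [MeasurableSpace W] (ν : Measure W)
    [IsProbabilityMeasure ν] {m : ℕ} (i : Fin m) :
    MeasurePreserving (fun v : Fin m → W × W => ((fun j => (v j).1), (v i).2))
      (Measure.pi fun _ : Fin m => ν.prod ν) ((Measure.pi fun _ : Fin m => ν).prod ν) :=
  ((MeasurePreserving.id _).prod (measurePreserving_eval (fun _ : Fin m => ν) i)).comp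
    (measurePreserving_arrowProdEquivProdArrow W W (Fin m) (fun _ => ν) (fun _ => ν))

/-- Sensitivity of the minimizer of a sample average to the exchange of one sample, for a sample
function `h` that differs from the one that is minimized by at most `e`. -/
lemma exchange_le {d : ℕ} {X : Set (Vec d)} {F F' g g' h h' : Vec d → ℝ} {α ℓ ℓ' e e' : ℝ}
    {m : ℕ} (hm : 0 < m) (hα : 0 < α) (z : Vec d)
    (hF : ConvexOn ℝ X F) (hF' : ConvexOn ℝ X F')
    (hdiff : ∀ x ∈ X, F x - F' x = 1 / (m : ℝ) * (g x - g' x))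
    (hl : ∀ x ∈ X, ∀ y ∈ X, |h x - h y| ≤ ℓ * ‖x - y‖)
    (hl' : ∀ x ∈ X, ∀ y ∈ X, |h' x - h' y| ≤ ℓ' * ‖x - y‖)
    (he : ∀ x ∈ X, |g x - h x| ≤ e) (he' : ∀ x ∈ X, |g' x - h' x| ≤ e')
    {a a' : Vec d} (ha : a ∈ argminOn (fun x => F x + α / 2 * ‖x - z‖ ^ 2) X)
    (ha' : a' ∈ argminOn (fun x => F' x + α / 2 * ‖x - z‖ ^ 2) X) :
    h a' - h a + (h' a - h' a') ≤ 2 * (ℓ ^ 2 + ℓ' ^ 2) / (m * α) + 2 * e + 2 * e' := by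
  have hm' : (0 : ℝ) < m := by exact_mod_cast hm
  have h1 := argminOn_growth hF ha ha'.1
  have h2 := argminOn_growth hF' ha' ha.1
  have h3 := hdiff a ha.1
  have h4 := hdiff a' ha'.1
  rw [norm_sub_rev a' a] at h1
  set u := ‖a - a'‖ with hu
  -- Adding both growth inequalities cancels the proximal terms and leaves the difference `F - F'`
  -- at the two minimizers, which only involves the exchanged sample and carries the factor `1/m`.
  have h5 : m * α * u ^ 2 ≤ g a' - g a + (g' a - g' a') := by
    have : α * u ^ 2 ≤ 1 / (m : ℝ) * (g a' - g a + (g' a - g' a')) := by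
      have e1 : 1 / (m : ℝ) * (g a' - g a + (g' a - g' a'))
        = 1 / (m : ℝ) * (g a' - g' a') - 1 / (m : ℝ) * (g a - g' a) := by ring
      rw [e1]
      linarith
    rw [one_div, inv_mul_eq_div, le_div_iff₀ hm'] at this
    linarith
  have b1 := abs_le.1 (he a ha.1)
  have b2 := abs_le.1 (he a' ha'.1)
  have b3 := abs_le.1 (he' a ha.1)
  have b4 := abs_le.1 (he' a' ha'.1)
  have b5 := abs_le.1 (hl a ha.1 a' ha'.1)
  have b6 := abs_le.1 (hl' a ha.1 a' ha'.1)
  set s := h a' - h a + (h' a - h' a') with hs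
  have h6 : s ≤ (ℓ + ℓ') * u := by linarith [b5.1, b6.2]
  have h7 : m * α * u ^ 2 ≤ s + 2 * e + 2 * e' := by
    linarith [b1.1, b2.2, b3.2, b4.1]
  have hk : (0 : ℝ) < m * α := by positivity
  set k := (m : ℝ) * α
  -- Young's inequality with weight `k = m α`: half of `k u²` is reabsorbed through `h7`, whose
  -- right side contains `s` itself, so `s` is at most `(ℓ + ℓ')² / k + 2 e + 2 e'`.
  have h8 : (ℓ + ℓ') * u ≤ (ℓ + ℓ') ^ 2 / (2 * k) + k * u ^ 2 / 2 := by
    have : (ℓ + ℓ') ^ 2 / (2 * k) + k * u ^ 2 / 2 - (ℓ + ℓ') * u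
        = ((ℓ + ℓ') - k * u) ^ 2 / (2 * k) := by field_simp; ring
    have h9 : 0 ≤ ((ℓ + ℓ') - k * u) ^ 2 / (2 * k) := by positivity
    linarith
  have h9 : (ℓ + ℓ') ^ 2 / (2 * k) ≤ (ℓ ^ 2 + ℓ' ^ 2) / k := by
    rw [div_le_div_iff₀ (by positivity) hk]
    nlinarith [sq_nonneg (ℓ - ℓ')]
  have h10 : 2 * (ℓ ^ 2 + ℓ' ^ 2) / k = 2 * ((ℓ ^ 2 + ℓ' ^ 2) / k) := by ring
  rw [h10]
  linarith

/-- The expected excess of the minimizer of a sample average of convex functions plus a proximal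
term, evaluated by the mean of Lipschitz functions that approximate the sample functions. -/
theorem integral_excess_le {d m : ℕ} {W : Type*} [MeasurableSpace W] (ν : Measure W)
    [IsProbabilityMeasure ν] {X : Set (Vec d)} (hX : IsCompact X) {g h : W → Vec d → ℝ}
    (hg : ∀ w, ConvexOn ℝ X (g w)) (hh : Measurable fun p : W × X => h p.1 p.2)
    (hhi : ∀ x ∈ X, Integrable (fun w => h w x) ν) {ℓ e : W → ℝ}
    (hl : ∀ w, ∀ x ∈ X, ∀ y ∈ X, |h w x - h w y| ≤ ℓ w * ‖x - y‖) (hℓ : MemLp ℓ 2 ν)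
    (he : ∀ᵐ w ∂ν, ∀ x ∈ X, |g w x - h w x| ≤ e w) (hei : Integrable e ν)
    (hm : 0 < m) {α : ℝ} (hα : 0 < α) (z : Vec d)
    {A : (Fin m → W) → Vec d} (hA : Measurable A)
    (hmin : ∀ w, A w ∈ argminOn
      (fun x => 1 / (m : ℝ) * ∑ i, g (w i) x + α / 2 * ‖x - z‖ ^ 2) X)
    {y : Vec d} (hy : y ∈ X) :
    Integrable (fun w => ∫ w', h w' (A w) ∂ν) (Measure.pi fun _ : Fin m => ν) ∧
    ∫ w, ((∫ w', h w' (A w) ∂ν) + α / 2 * ‖A w - z‖ ^ 2 + α / 2 * ‖y - A w‖ ^ 2)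
        ∂(Measure.pi fun _ : Fin m => ν)
      ≤ (∫ w', h w' y ∂ν) + α / 2 * ‖y - z‖ ^ 2
        + 2 * (∫ w, ℓ w ^ 2 ∂ν) / (m * α) + 4 * ∫ w, e w ∂ν := by
  set π := Measure.pi fun _ : Fin m => ν with hπ
  set Θ := Measure.pi fun _ : Fin m => ν.prod ν with hΘ
  have hm' : (0 : ℝ) < m := by exact_mod_cast hm
  have hAX : ∀ w, A w ∈ X := fun w => (hmin w).1
  have hA' : Measurable fun w => (⟨A w, hAX w⟩ : X) := hA.subtype_mk
  obtain ⟨D, hD⟩ := (Metric.isBounded_iff.1 hX.isBounded)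
  have hD' : ∀ x ∈ X, ∀ y ∈ X, ‖x - y‖ ≤ D := fun x hx y hy => by
    rw [← dist_eq_norm]; exact hD hx hy
  have hℓ0 : ∀ w, ∀ x ∈ X, ∀ y ∈ X, ℓ w * ‖x - y‖ ≤ |ℓ w| * D := fun w x hx y hy =>
    mul_le_mul (le_abs_self _) (hD' x hx y hy) (norm_nonneg _) (abs_nonneg _)
  have hℓi : Integrable ℓ ν := hℓ.integrable (by norm_num)
  have hℓ2 : Integrable (fun w => ℓ w ^ 2) ν := hℓ.integrable_sq
  -- integrability of the sample functions at a random point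
  have hdom : ∀ w, ∀ x ∈ X, |h w x| ≤ |h w y| + |ℓ w| * D := fun w x hx => by
    have h1 := (hl w x hx y hy).trans (hℓ0 w x hx y hy)
    have h2 := abs_sub_abs_le_abs_sub (h w x) (h w y)
    linarith
  have hdomi : Integrable (fun w => |h w y| + |ℓ w| * D) ν :=
    (hhi y hy).abs.add (hℓi.abs.mul_const D)
  have hint : ∀ {V : Type _} [MeasurableSpace V] (μ : Measure V) (p : V → W) (x : V → X),
      Measurable x → MeasurePreserving p μ ν → Integrable (fun v => h (p v) (x v)) μ := by
    intro V _ μ p x hx hp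
    refine Integrable.mono' (hp.integrable_comp_of_integrable hdomi) ?_
      (ae_of_all _ fun v => hdom _ _ (x v).2)
    exact (hh.comp (hp.measurable.prodMk hx)).aestronglyMeasurable
  have heval : ∀ i : Fin m, MeasurePreserving (fun w : Fin m → W => w i) π ν := fun i =>
    measurePreserving_eval (fun _ : Fin m => ν) i
  have hfst : MeasurePreserving (fun v : Fin m → W × W => fun j => (v j).1) Θ π :=
    measurePreserving_pi _ _ fun _ => measurePreserving_fst
  have hev1 : ∀ i : Fin m, MeasurePreserving (fun v : Fin m → W × W => (v i).1) Θ ν := fun i =>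
    measurePreserving_fst.comp (measurePreserving_eval (fun _ : Fin m => ν.prod ν) i)
  have hev2 : ∀ i : Fin m, MeasurePreserving (fun v : Fin m → W × W => (v i).2) Θ ν := fun i =>
    measurePreserving_snd.comp (measurePreserving_eval (fun _ : Fin m => ν.prod ν) i)
  have hprod : Integrable (fun p : (Fin m → W) × W => h p.2 (A p.1)) (π.prod ν) :=
    hint (π.prod ν) Prod.snd (fun p => ⟨A p.1, hAX p.1⟩) (hA'.comp measurable_fst)
      measurePreserving_snd
  have hHi : Integrable (fun w => ∫ w', h w' (A w) ∂ν) π := hprod.integral_prod_left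
  refine ⟨hHi, ?_⟩
  have hF : ∀ w : Fin m → W, ConvexOn ℝ X fun x => 1 / (m : ℝ) * ∑ i, g (w i) x := fun w =>
    convexOn_average (hg (w ⟨0, hm⟩)).1 fun i => hg (w i)
  -- generalization gap of one sample
  have hgap : ∀ i : Fin m, (∫ w, (∫ w', h w' (A w) ∂ν) ∂π) - ∫ w, h (w i) (A w) ∂π
      ≤ 2 * (∫ w, ℓ w ^ 2 ∂ν) / (m * α) + 2 * ∫ w, e w ∂ν := by
    intro i
    have hsw : MeasurePreserving (swapAt i) Θ Θ := measurePreserving_swapAt ν i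
    -- `A₁` is the minimizer for the original sample and `A₂` the one after exchanging the `i`-th
    -- draw with its ghost.
    set A₁ : (Fin m → W × W) → X := fun v => ⟨A fun j => (v j).1, hAX _⟩ with hA₁
    have hA₁m : Measurable A₁ := hA'.comp hfst.measurable
    set A₂ : (Fin m → W × W) → X := fun v => A₁ (swapAt i v) with hA₂
    have hA₂m : Measurable A₂ := hA₁m.comp hsw.measurable
    have i11 := hint Θ (fun v => (v i).1) A₁ hA₁m (hev1 i)
    have i12 := hint Θ (fun v => (v i).1) A₂ hA₂m (hev1 i)
    have i21 := hint Θ (fun v => (v i).2) A₁ hA₁m (hev2 i)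
    have i22 := hint Θ (fun v => (v i).2) A₂ hA₂m (hev2 i)
    have s1 : ∀ v : Fin m → W × W, (swapAt i v i).1 = (v i).2 := fun v => by simp [swapAt]
    have s2 : ∀ v : Fin m → W × W, (swapAt i v i).2 = (v i).1 := fun v => by simp [swapAt]
    have E1 : ∫ w, h (w i) (A w) ∂π = ∫ v, h (v i).1 (A₁ v) ∂Θ :=
      (integral_comp_measurePreserving hfst (hint π (fun w => w i)
        (fun w => ⟨A w, hAX w⟩) hA' (heval i)).aestronglyMeasurable).symm
    have E2 : ∫ w, (∫ w', h w' (A w) ∂ν) ∂π = ∫ v, h (v i).2 (A₁ v) ∂Θ := by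
      rw [← integral_prod (fun p : (Fin m → W) × W => h p.2 (A p.1)) hprod]
      exact (integral_comp_measurePreserving (measurePreserving_fst_ghost ν i)
        hprod.aestronglyMeasurable).symm
    -- The exchange preserves the joint law, so each of the in-sample and the population value
    -- occurs twice in the integrated exchange inequality. That inequality therefore bounds twice
    -- the generalization gap.
    have E3 : ∫ v, h (v i).1 (A₁ v) ∂Θ = ∫ v, h (v i).2 (A₂ v) ∂Θ := by
      rw [← integral_comp_measurePreserving hsw i11.aestronglyMeasurable]
      simp only [s1, hA₂]
    have E4 : ∫ v, h (v i).2 (A₁ v) ∂Θ = ∫ v, h (v i).1 (A₂ v) ∂Θ := by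
      rw [← integral_comp_measurePreserving hsw i21.aestronglyMeasurable]
      simp only [s2, hA₂]
    have j1 := (hev1 i).integrable_comp_of_integrable hℓ2
    have j2 := (hev2 i).integrable_comp_of_integrable hℓ2
    have j3 := (hev1 i).integrable_comp_of_integrable hei
    have j4 := (hev2 i).integrable_comp_of_integrable hei
    have E5 : ∫ v, (h (v i).1 (A₂ v) - h (v i).1 (A₁ v)
          + (h (v i).2 (A₁ v) - h (v i).2 (A₂ v))) ∂Θ
        ≤ ∫ v, (2 * (ℓ (v i).1 ^ 2 + ℓ (v i).2 ^ 2) / (m * α) + 2 * e (v i).1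
          + 2 * e (v i).2) ∂Θ := by
      refine integral_mono_ae ((i12.sub i11).add (i21.sub i22))
        (((((j1.add j2).const_mul 2).div_const (m * α)).add (j3.const_mul 2)).add
          (j4.const_mul 2)) ?_
      filter_upwards [(hev1 i).quasiMeasurePreserving.ae he,
        (hev2 i).quasiMeasurePreserving.ae he] with v hv1 hv2
      refine exchange_le hm hα z (hF fun j => (v j).1) (hF fun j => (swapAt i v j).1) ?_
        (hl (v i).1) (hl (v i).2) hv1 hv2 (hmin fun j => (v j).1) (hmin fun j => (swapAt i v j).1)
      intro x _
      rw [← mul_sub, ← Finset.sum_sub_distrib, Finset.sum_eq_single i]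
      · rw [s1]
      · intro j _ hj
        simp [swapAt, hj]
      · simp
    have I1 : ∫ v, ℓ (v i).1 ^ 2 ∂Θ = ∫ w, ℓ w ^ 2 ∂ν :=
      integral_comp_measurePreserving (hev1 i) hℓ2.aestronglyMeasurable
    have I2 : ∫ v, ℓ (v i).2 ^ 2 ∂Θ = ∫ w, ℓ w ^ 2 ∂ν :=
      integral_comp_measurePreserving (hev2 i) hℓ2.aestronglyMeasurable
    have I3 : ∫ v, e (v i).1 ∂Θ = ∫ w, e w ∂ν :=
      integral_comp_measurePreserving (hev1 i) hei.aestronglyMeasurable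
    have I4 : ∫ v, e (v i).2 ∂Θ = ∫ w, e w ∂ν :=
      integral_comp_measurePreserving (hev2 i) hei.aestronglyMeasurable
    have R1 : ∫ v, (2 * (ℓ (v i).1 ^ 2 + ℓ (v i).2 ^ 2) / (m * α) + 2 * e (v i).1
          + 2 * e (v i).2) ∂Θ = 4 * (∫ w, ℓ w ^ 2 ∂ν) / (m * α) + 4 * ∫ w, e w ∂ν := by
      have q1 : Integrable (fun v : Fin m → W × W =>
          2 * (ℓ (v i).1 ^ 2 + ℓ (v i).2 ^ 2) / (m * α)) Θ :=
        ((j1.add j2).const_mul 2).div_const (m * α)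
      have q2 : Integrable (fun v : Fin m → W × W => 2 * e (v i).1) Θ := j3.const_mul 2
      have q3 : Integrable (fun v : Fin m → W × W => 2 * e (v i).2) Θ := j4.const_mul 2
      have q12 : Integrable (fun v : Fin m → W × W =>
          2 * (ℓ (v i).1 ^ 2 + ℓ (v i).2 ^ 2) / (m * α) + 2 * e (v i).1) Θ := q1.add q2
      rw [integral_add q12 q3, integral_add q1 q2, integral_div, integral_const_mul,
        integral_const_mul,
        integral_const_mul, integral_add (by exact j1) (by exact j2), I1, I2, I3, I4]
      ring
    have L1 : ∫ v, (h (v i).1 (A₂ v) - h (v i).1 (A₁ v)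
          + (h (v i).2 (A₁ v) - h (v i).2 (A₂ v))) ∂Θ
        = (∫ v, h (v i).1 (A₂ v) ∂Θ) - (∫ v, h (v i).1 (A₁ v) ∂Θ)
          + ((∫ v, h (v i).2 (A₁ v) ∂Θ) - ∫ v, h (v i).2 (A₂ v) ∂Θ) := by
      rw [integral_add (by exact i12.sub i11) (by exact i21.sub i22), integral_sub i12 i11,
        integral_sub i21 i22]
    rw [R1, L1, ← E4, ← E3, ← E2, ← E1] at E5
    have e1 : 4 * (∫ w, ℓ w ^ 2 ∂ν) / (m * α) = 2 * (2 * (∫ w, ℓ w ^ 2 ∂ν) / (m * α)) := by ring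
    rw [e1] at E5
    linarith
  -- comparison with the fixed point
  have hq : Integrable (fun w => α / 2 * ‖A w - z‖ ^ 2 + α / 2 * ‖y - A w‖ ^ 2) π := by
    obtain ⟨B, hB⟩ := hX.exists_bound_of_continuousOn (f := fun x : Vec d =>
      α / 2 * ‖x - z‖ ^ 2 + α / 2 * ‖y - x‖ ^ 2) (by fun_prop)
    refine Integrable.of_bound ?_ B (ae_of_all _ fun w => hB _ (hAX w))
    exact (by fun_prop : Measurable fun w =>
      α / 2 * ‖A w - z‖ ^ 2 + α / 2 * ‖y - A w‖ ^ 2).aestronglyMeasurable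
  have k1 : ∀ i, Integrable (fun w : Fin m → W => h (w i) (A w)) π := fun i =>
    hint π (fun w => w i) (fun w => ⟨A w, hAX w⟩) hA' (heval i)
  have k2 : ∀ i, Integrable (fun w : Fin m → W => h (w i) y) π := fun i =>
    (heval i).integrable_comp_of_integrable (hhi y hy)
  have k3 : ∀ i, Integrable (fun w : Fin m → W => e (w i)) π := fun i =>
    (heval i).integrable_comp_of_integrable hei
  have K2 : ∀ i, ∫ w, h (w i) y ∂π = ∫ w', h w' y ∂ν := fun i =>
    integral_comp_measurePreserving (heval i) (hhi y hy).aestronglyMeasurable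
  have K3 : ∀ i, ∫ w, e (w i) ∂π = ∫ w', e w' ∂ν := fun i =>
    integral_comp_measurePreserving (heval i) hei.aestronglyMeasurable
  have M1 : ∫ w, (1 / (m : ℝ) * ∑ i, h (w i) (A w)
        + (α / 2 * ‖A w - z‖ ^ 2 + α / 2 * ‖y - A w‖ ^ 2)) ∂π
      ≤ ∫ w, (1 / (m : ℝ) * ∑ i, (h (w i) y + 2 * e (w i)) + α / 2 * ‖y - z‖ ^ 2) ∂π := by
    refine integral_mono_ae (((integrable_finsetSum _ fun i _ => k1 i).const_mul _).add hq)
      (((integrable_finsetSum _ fun i _ => (k2 i).add ((k3 i).const_mul 2)).const_mul _).add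
        (integrable_const _)) ?_
    have hall : ∀ᵐ w ∂π, ∀ i, ∀ x ∈ X, |g (w i) x - h (w i) x| ≤ e (w i) :=
      ae_all_iff.2 fun i => (heval i).quasiMeasurePreserving.ae he
    filter_upwards [hall] with w hw
    -- The approximation error is paid once at the minimizer and once at `y`, giving `2 e`; with the
    -- `2 e` of the generalization gap this makes the factor `4`.
    have h1 := argminOn_growth (hF w) (hmin w) hy
    have h2 : 1 / (m : ℝ) * ∑ i, h (w i) (A w) ≤ 1 / (m : ℝ) * ∑ i, (g (w i) (A w) + e (w i)) := by
      gcongr with i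
      linarith [(abs_le.1 (hw i _ (hAX w))).1]
    have h3 : 1 / (m : ℝ) * ∑ i, g (w i) y ≤ 1 / (m : ℝ) * ∑ i, (h (w i) y + e (w i)) := by
      gcongr with i
      linarith [(abs_le.1 (hw i _ hy)).2]
    simp only [Finset.sum_add_distrib, mul_add, ← Finset.mul_sum] at h2 h3 ⊢
    linarith
  have M2 : ∫ w, (1 / (m : ℝ) * ∑ i, (h (w i) y + 2 * e (w i)) + α / 2 * ‖y - z‖ ^ 2) ∂π
      = (∫ w', h w' y ∂ν) + 2 * (∫ w, e w ∂ν) + α / 2 * ‖y - z‖ ^ 2 := by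
    have k4 : ∀ i, Integrable (fun w : Fin m → W => h (w i) y + 2 * e (w i)) π := fun i =>
      (k2 i).add ((k3 i).const_mul 2)
    rw [integral_add ((integrable_finsetSum _ fun i _ => k4 i).const_mul _) (integrable_const _),
      integral_const_mul, integral_finsetSum _ fun i _ => k4 i]
    have : ∀ i : Fin m, ∫ w, (h (w i) y + 2 * e (w i)) ∂π
        = (∫ w', h w' y ∂ν) + 2 * ∫ w, e w ∂ν := fun i => by
      rw [integral_add (k2 i) ((k3 i).const_mul 2), integral_const_mul, K2, K3]
    simp_rw [this]
    simp only [Finset.sum_const, Finset.card_univ, Fintype.card_fin, nsmul_eq_mul, integral_const,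
      probReal_univ, one_smul]
    field_simp
  have M3 : ∫ w, (1 / (m : ℝ) * ∑ i, h (w i) (A w)
        + (α / 2 * ‖A w - z‖ ^ 2 + α / 2 * ‖y - A w‖ ^ 2)) ∂π
      = 1 / (m : ℝ) * ∑ i, (∫ w, h (w i) (A w) ∂π)
        + ∫ w, (α / 2 * ‖A w - z‖ ^ 2 + α / 2 * ‖y - A w‖ ^ 2) ∂π := by
    rw [integral_add ((integrable_finsetSum _ fun i _ => k1 i).const_mul _) hq, integral_const_mul,
      integral_finsetSum _ fun i _ => k1 i]
  have M4 : (∫ w, (∫ w', h w' (A w) ∂ν) ∂π) ≤ 1 / (m : ℝ) * ∑ i, (∫ w, h (w i) (A w) ∂π)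
      + (2 * (∫ w, ℓ w ^ 2 ∂ν) / (m * α) + 2 * ∫ w, e w ∂ν) := by
    have h1 := Finset.sum_le_sum fun i (_ : i ∈ Finset.univ) => hgap i
    simp only [Finset.sum_sub_distrib, Finset.sum_const, Finset.card_univ, Fintype.card_fin,
      nsmul_eq_mul] at h1
    have h2 := mul_le_mul_of_nonneg_left h1 (by positivity : 0 ≤ 1 / (m : ℝ))
    rw [mul_sub, ← mul_assoc, ← mul_assoc, one_div_mul_cancel hm'.ne', one_mul, one_mul] at h2
    linarith
  have M5 : ∫ w, ((∫ w', h w' (A w) ∂ν) + α / 2 * ‖A w - z‖ ^ 2 + α / 2 * ‖y - A w‖ ^ 2) ∂π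
      = (∫ w, (∫ w', h w' (A w) ∂ν) ∂π)
        + ∫ w, (α / 2 * ‖A w - z‖ ^ 2 + α / 2 * ‖y - A w‖ ^ 2) ∂π := by
    rw [← integral_add hHi hq]
    simp only [add_assoc]
  rw [M5]
  rw [M3, M2] at M1
  linarith

/-! ### Measurability of matrix operations -/

section MatrixMeasurable

variable {l : ℕ} {Ω : Type*} [MeasurableSpace Ω]

lemma measurable_rowsMul {r : Ω → Fin l → Vec l} {e : Ω → Vec l}
    (hr : ∀ j, Measurable fun ω => r ω j) (he : Measurable e) :
    Measurable fun ω => rowsMul (r ω) (e ω) := by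
  unfold rowsMul
  refine (WithLp.measurable_toLp 2 _).comp (measurable_pi_lambda _ fun j => ?_)
  exact he.inner (hr j)

lemma measurable_det {k : Type*} [Fintype k] [DecidableEq k] {A : Ω → Matrix k k ℝ}
    (hA : ∀ i j, Measurable fun ω => A ω i j) : Measurable fun ω => (A ω).det := by
  simp_rw [Matrix.det_apply]
  refine Finset.measurable_fun_sum _ fun σ _ => ?_
  refine Measurable.const_smul ?_ _
  exact Finset.measurable_fun_prod _ fun i _ => hA _ _

/-- Inverse determinant times adjugate, both measurable in the entries; for singular matrices the
formula gives zero. -/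
lemma measurable_matrix_inv {A : Ω → Matrix (Fin l) (Fin l) ℝ}
    (hA : ∀ i j, Measurable fun ω => A ω i j) (i j : Fin l) :
    Measurable fun ω => (A ω)⁻¹ i j := by
  simp_rw [Matrix.inv_def, Matrix.smul_apply, Matrix.adjugate_apply, smul_eq_mul,
    Ring.inverse_eq_inv']
  refine (measurable_det hA).inv.mul (measurable_det fun a b => ?_)
  by_cases h : a = j
  · subst h; simp
  · simpa [Matrix.updateRow_ne h] using hA a b

lemma measurable_matOp_apply {A : Ω → Matrix (Fin l) (Fin l) ℝ} {e : Ω → Vec l}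
    (hA : ∀ i j, Measurable fun ω => A ω i j) (he : Measurable e) :
    Measurable fun ω => matOp (A ω) (e ω) := by
  have h : ∀ ω, matOp (A ω) (e ω) = rowsMul (fun j => WithLp.toLp 2 (A ω j)) (e ω) := fun ω => by
    rw [← matOp_rowMatrix]; rfl
  simp_rw [h]
  exact measurable_rowsMul (fun j => (WithLp.measurable_toLp 2 _).comp
    (measurable_pi_lambda _ fun k => hA j k)) he

lemma measurable_rowMatrix {q : Ω → Fin l → Vec l} (hq : ∀ j, Measurable fun ω => q ω j)
    (i j : Fin l) : Measurable fun ω => rowMatrix (q ω) i j :=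
  (by fun_prop : Measurable fun v : Vec l => v j).comp (hq i)

lemma measurable_clm_apply {d : ℕ} {f : Ω → Vec d →L[ℝ] Vec l} {v : Ω → Vec d}
    (hf : Measurable f) (hv : Measurable v) : Measurable fun ω => f ω (v ω) := by
  have h : Continuous fun p : (Vec d →L[ℝ] Vec l) × Vec d => p.1 p.2 :=
    isBoundedBilinearMap_apply.continuous
  exact h.measurable.comp (hf.prodMk hv)

end MatrixMeasurable

/-! ### Laws of the samples -/

namespace Problem

variable {d l : ℕ} {P : Problem d l}

/-- The problem with `c` and `q` set to zero where they are not assumed to be continuous. -/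
def extend (P : Problem d l) : Problem d l :=
  { P with c := P.O.indicator P.c, q := fun j => P.O.indicator (P.q j) }

lemma measurable_indicator_of_continuousOn {E F : Type*} [TopologicalSpace E] [MeasurableSpace E]
    [OpensMeasurableSpace E] [TopologicalSpace F] [MeasurableSpace F] [BorelSpace F] [Zero F]
    {O : Set E} (hO : IsOpen O) {c : E → F} (hc : ContinuousOn c O) :
    Measurable (O.indicator c) := by
  classical
  rw [← piecewise_eq_indicator]
  exact hc.measurable_piecewise continuousOn_const hO.measurableSet

lemma Regular.measurable_extend_c (hP : P.Regular) : Measurable P.extend.c :=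
  measurable_indicator_of_continuousOn hP.open_O hP.smooth_c.continuousOn

lemma Regular.measurable_extend_q (hP : P.Regular) (j : Fin l) : Measurable (P.extend.q j) :=
  measurable_indicator_of_continuousOn hP.open_O (hP.smooth_q j).continuousOn

lemma extend_c {x : Vec d} (hx : x ∈ P.O) : P.extend.c x = P.c x := indicator_of_mem hx _

lemma extend_Q {x : Vec d} (hx : x ∈ P.O) : P.extend.Q x = P.Q x := by
  have : (fun j => P.extend.q j x) = fun j => P.q j x := funext fun j => indicator_of_mem hx _
  rw [Q, Q, this]

/-- The map that produces an observation from a predictor and a noise vector. -/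
def obsMap (P : Problem d l) (p : Vec d × Vec l) : Vec d × Vec l :=
  (p.1, P.c p.1 + matOp (P.Q p.1) p.2)

lemma Regular.measurable_obsMap_extend (hP : P.Regular) : Measurable P.extend.obsMap := by
  refine measurable_fst.prodMk ((hP.measurable_extend_c.comp measurable_fst).add ?_)
  exact measurable_matOp_apply
    (measurable_rowMatrix fun j => (hP.measurable_extend_q j).comp measurable_fst) measurable_snd

lemma Regular.measurable_trueResid_extend (hP : P.Regular) :
    Measurable (trueResid P.extend) := by
  unfold trueResid
  refine measurable_matOp_apply (measurable_matrix_inv (measurable_rowMatrix fun j =>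
    (hP.measurable_extend_q j).comp measurable_fst)) ?_
  exact measurable_snd.sub (hP.measurable_extend_c.comp measurable_fst)

variable {κ : Measure (Vec d)}

lemma Regular.obsMap_extend_ae (hP : P.Regular) (hκ : κ P.Oᶜ = 0) :
    P.extend.obsMap =ᵐ[κ.prod P.noise] P.obsMap := by
  have := hP.noise_prob
  have h : ∀ᵐ x ∂κ, x ∈ P.O := hκ
  filter_upwards [Measure.quasiMeasurePreserving_fst.ae h] with p hp
  rw [obsMap, obsMap, extend_c hp, extend_Q hp]

/-- A predictor law that charges only `O` cannot detect values outside, so the everywhere measurable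
extension may replace the original data. -/
lemma Regular.obsLaw_extend (hP : P.Regular) (hκ : κ P.Oᶜ = 0) :
    P.extend.obsLaw κ = P.obsLaw κ :=
  Measure.map_congr (hP.obsMap_extend_ae hκ)

lemma Regular.isProbabilityMeasure_obsLaw_extend (hP : P.Regular) [IsProbabilityMeasure κ] :
    IsProbabilityMeasure (P.extend.obsLaw κ) := by
  have : IsProbabilityMeasure P.extend.noise := hP.noise_prob
  exact Measure.isProbabilityMeasure_map hP.measurable_obsMap_extend.aemeasurable

lemma Regular.aemeasurable_obsMap (hP : P.Regular) (hκ : κ P.Oᶜ = 0) :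
    AEMeasurable P.obsMap (κ.prod P.noise) :=
  hP.measurable_obsMap_extend.aemeasurable.congr (hP.obsMap_extend_ae hκ)

lemma Regular.trueResid_obsMap (hP : P.Regular) {p : Vec d × Vec l} (hp : p.1 ∈ P.O) :
    trueResid P (P.obsMap p) = p.2 := by
  rw [trueResid, obsMap]
  simp only [add_sub_cancel_left]
  have h : IsUnit (P.Q p.1).det := (hP.posDef_Q _ hp).isUnit.map Matrix.detMonoidHom
  have h2 : matOp (P.Q p.1)⁻¹ * matOp (P.Q p.1) = 1 := by
    rw [matOp, matOp, ← map_mul, Matrix.nonsing_inv_mul _ h, map_one]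
  exact congrArg (fun L : Vec l →L[ℝ] Vec l => L p.2) h2

lemma Regular.trueResid_extend_ae (hP : P.Regular) (hκ : κ P.Oᶜ = 0) :
    trueResid P =ᵐ[P.obsLaw κ] trueResid P.extend := by
  have h : ∀ᵐ w ∂P.obsLaw κ, w.1 ∈ P.O := by
    have := hP.noise_prob
    refine (ae_map_iff (hP.aemeasurable_obsMap hκ)
      (hP.open_O.measurableSet.preimage measurable_fst)).2 ?_
    have h : ∀ᵐ x ∂κ, x ∈ P.O := hκ
    exact Measure.quasiMeasurePreserving_fst.ae h
  filter_upwards [h] with w hw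
  rw [trueResid, trueResid, extend_c hw, extend_Q hw]

lemma Regular.aemeasurable_trueResid (hP : P.Regular) (hκ : κ P.Oᶜ = 0) :
    AEMeasurable (trueResid P) (P.obsLaw κ) :=
  ⟨trueResid P.extend, hP.measurable_trueResid_extend, hP.trueResid_extend_ae hκ⟩

/-- Invertibility of `Q` on `O` makes a true residual recover the noise exactly, whatever the law of
the predictor. Hence the conceptual batch is an i.i.d. sample of the model even if its residuals
come from points other than `z`. -/
lemma Regular.map_trueResid (hP : P.Regular) [IsProbabilityMeasure κ] (hκ : κ P.Oᶜ = 0) :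
    (P.obsLaw κ).map (trueResid P) = P.noise := by
  have := hP.noise_prob
  have h1 : AEMeasurable (trueResid P) ((κ.prod P.noise).map P.obsMap) :=
    hP.aemeasurable_trueResid hκ
  change ((κ.prod P.noise).map P.obsMap).map (trueResid P) = _
  rw [AEMeasurable.map_map_of_aemeasurable h1 (hP.aemeasurable_obsMap hκ)]
  have h2 : trueResid P ∘ P.obsMap =ᵐ[κ.prod P.noise] Prod.snd := by
    have h : ∀ᵐ x ∂κ, x ∈ P.O := hκ
    filter_upwards [Measure.quasiMeasurePreserving_fst.ae h] with p hp
    exact hP.trueResid_obsMap hp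
  rw [Measure.map_congr h2]
  exact measurePreserving_snd.map_eq

end Problem

/-- Measurability is checked on boxes, a generating π-system, where the measure is a finite product.
-/
lemma measurable_measure_pi {ι α β : Type*} [Fintype ι] [MeasurableSpace α] [MeasurableSpace β]
    {κ : α → Measure β} (hκ : Measurable κ) [∀ a, IsProbabilityMeasure (κ a)] :
    Measurable fun a => Measure.pi fun _ : ι => κ a := by
  refine Measurable.measure_of_isPiSystem_of_isProbabilityMeasure generateFrom_pi.symm
    isPiSystem_pi ?_
  rintro _ ⟨s, hs, rfl⟩
  simp_rw [Measure.pi_pi]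
  exact Finset.measurable_fun_prod _ fun i _ =>
    (Measure.measurable_coe (hs i (mem_univ i))).comp hκ

lemma measurable_measure_prod {α β γ : Type*} [MeasurableSpace α] [MeasurableSpace β]
    [MeasurableSpace γ] {κ : α → Measure β} {η : α → Measure γ} (hκ : Measurable κ)
    (hη : Measurable η) [∀ a, IsProbabilityMeasure (κ a)] [∀ a, IsProbabilityMeasure (η a)] :
    Measurable fun a => (κ a).prod (η a) := by
  let κ' : Kernel α β := ⟨κ, hκ⟩
  let η' : Kernel α γ := ⟨η, hη⟩
  have : IsMarkovKernel κ' := ⟨fun a => (inferInstance : IsProbabilityMeasure (κ a))⟩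
  have : IsMarkovKernel η' := ⟨fun a => (inferInstance : IsProbabilityMeasure (η a))⟩
  have h : (fun a => (κ a).prod (η a)) = fun a => (κ' ×ₖ η') a := by
    ext1 a
    rw [Kernel.prod_apply]
    rfl
  rw [h]
  exact Kernel.measurable _

namespace Oracle

variable {d l : ℕ} {P : Problem d l} {S : Oracle d}

/-- The distribution of the predictors for the residuals. -/
def residMarginal (S : Oracle d) (z : Vec d) : Measure (Vec d) :=
  match S with
  | static κ => κ
  | adaptive _ => Measure.dirac z

/-- The distribution of the predictors for the estimates. -/
def learnMarginal (S : Oracle d) (n : ℕ) (z : Vec d) : Measure (Vec d) :=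
  match S with
  | static κ => κ
  | adaptive M => M n z

lemma learnLaw_eq (n : ℕ) (z : Vec d) : S.learnLaw P n z = P.obsLaw (S.learnMarginal n z) := by
  cases S <;> rfl

lemma residLaw_eq (z : Vec d) : S.residLaw P z = P.obsLaw (S.residMarginal z) := by
  cases S <;> rfl

lemma Valid.prob_learn (hS : S.Valid P) (n : ℕ) (z : Vec d) :
    IsProbabilityMeasure (S.learnMarginal n z) := by
  cases S with
  | static κ => exact hS.1
  | adaptive M => exact (hS n).1.isProbabilityMeasure z

lemma Valid.prob_resid (hS : S.Valid P) (z : Vec d) :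
    IsProbabilityMeasure (S.residMarginal z) := by
  cases S with
  | static κ => exact hS.1
  | adaptive M => exact Measure.dirac.isProbabilityMeasure

lemma Valid.learn_compl (hS : S.Valid P) (hP : P.Regular) (n : ℕ) {z : Vec d} (hz : z ∈ P.X) :
    S.learnMarginal n z P.Oᶜ = 0 := by
  cases S with
  | static κ => exact measure_mono_null (compl_subset_compl.2 hP.X_subset) hS.2
  | adaptive M => exact (hS n).2 z hz

lemma Valid.resid_compl_X (hS : S.Valid P) {z : Vec d} (hz : z ∈ P.X) :
    S.residMarginal z P.Xᶜ = 0 := by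
  cases S with
  | static κ => exact hS.2
  | adaptive M =>
    have h : ∀ᵐ x ∂(Measure.dirac z), x ∈ P.X := by simpa using hz
    exact h

lemma Valid.resid_compl (hS : S.Valid P) (hP : P.Regular) {z : Vec d} (hz : z ∈ P.X) :
    S.residMarginal z P.Oᶜ = 0 :=
  measure_mono_null (compl_subset_compl.2 hP.X_subset) (hS.resid_compl_X hz)

lemma Valid.batchLaw_extend (hS : S.Valid P) (hP : P.Regular) (n m : ℕ) {z : Vec d}
    (hz : z ∈ P.X) : S.batchLaw P.extend n m z = S.batchLaw P n m z := by
  rw [batchLaw, batchLaw, dataLaw, dataLaw, learnLaw_eq, learnLaw_eq, residLaw_eq, residLaw_eq,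
    hP.obsLaw_extend (hS.learn_compl hP n hz), hP.obsLaw_extend (hS.resid_compl hP hz)]

lemma Valid.measurable_marginals (hS : S.Valid P) (n : ℕ) :
    Measurable (S.learnMarginal n) ∧ Measurable S.residMarginal := by
  cases S with
  | static κ => exact ⟨measurable_const, measurable_const⟩
  | adaptive M => exact ⟨(M n).measurable, Measure.measurable_dirac⟩

lemma Valid.isProbabilityMeasure_extend (hS : S.Valid P) (hP : P.Regular) (n : ℕ) (z : Vec d) :
    IsProbabilityMeasure (S.learnLaw P.extend n z) ∧
      IsProbabilityMeasure (S.residLaw P.extend z) := by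
  have := hS.prob_learn n z
  have := hS.prob_resid z
  rw [learnLaw_eq, residLaw_eq]
  exact ⟨hP.isProbabilityMeasure_obsLaw_extend, hP.isProbabilityMeasure_obsLaw_extend⟩

lemma Valid.isProbabilityMeasure (hS : S.Valid P) (hP : P.Regular) (n : ℕ) {z : Vec d}
    (hz : z ∈ P.X) : IsProbabilityMeasure (S.learnLaw P n z) ∧
      IsProbabilityMeasure (S.residLaw P z) := by
  have h := hS.isProbabilityMeasure_extend hP n z
  rw [learnLaw_eq, residLaw_eq, hP.obsLaw_extend (hS.learn_compl hP n hz),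
    hP.obsLaw_extend (hS.resid_compl hP hz)] at h
  rwa [learnLaw_eq, residLaw_eq]

/-- For the extended problem the sampling law depends measurably on every reference point, so it is
a Markov kernel; on `X` it agrees with the true law. -/
lemma Valid.measurable_batchLaw_extend (hS : S.Valid P) (hP : P.Regular) (n m : ℕ) :
    Measurable (S.batchLaw P.extend n m) := by
  have hobs : ∀ κ : Vec d → Measure (Vec d), Measurable κ → (∀ z, IsProbabilityMeasure (κ z)) →
      Measurable fun z => P.extend.obsLaw (κ z) := by
    intro κ hκ _
    have : IsProbabilityMeasure P.extend.noise := hP.noise_prob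
    exact (Measure.measurable_map _ hP.measurable_obsMap_extend).comp
      (measurable_measure_prod hκ measurable_const)
  have h1 : Measurable (S.learnLaw P.extend n) := by
    have h : S.learnLaw P.extend n = fun z => P.extend.obsLaw (S.learnMarginal n z) :=
      funext fun z => learnLaw_eq n z
    rw [h]
    exact hobs _ (hS.measurable_marginals n).1 (hS.prob_learn n)
  have h2 : Measurable (S.residLaw P.extend) := by
    have h : S.residLaw P.extend = fun z => P.extend.obsLaw (S.residMarginal z) :=
      funext fun z => residLaw_eq z
    rw [h]
    exact hobs _ (hS.measurable_marginals n).2 hS.prob_resid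
  have := fun z => (hS.isProbabilityMeasure_extend hP n z).1
  have := fun z => (hS.isProbabilityMeasure_extend hP n z).2
  have : ∀ z, IsProbabilityMeasure (S.dataLaw P.extend n z) := fun z => by
    unfold dataLaw; infer_instance
  exact measurable_measure_prod (κ := S.dataLaw P.extend n) (measurable_measure_pi h1)
    (measurable_measure_pi h2)

end Oracle

/-! ### One iteration of the algorithm -/

section Surrogate

variable {d l n m : ℕ} {P : Problem d l} {S : Oracle d} {est : Estimators d l}

/-- The learning-based surrogate without the proximal term. -/
def learnedCost (P : Problem d l) (est : Estimators d l) (s : Dataset d l n) (z : Vec d)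
    (e : Vec l) (x : Vec d) : ℝ :=
  P.φ x (linArg (est.c n s z) (est.dc n s z) (fun j => est.q n s j z) (fun j => est.dq n s j z)
    z e x)

lemma average_add_const (hm : 0 < m) (g : Fin m → ℝ) (a : ℝ) :
    1 / (m : ℝ) * ∑ i, (g i + a) = 1 / (m : ℝ) * ∑ i, g i + a := by
  rw [Finset.sum_add_distrib, mul_add]
  simp only [Finset.sum_const, Finset.card_univ, Fintype.card_fin, nsmul_eq_mul]
  rw [← mul_assoc, one_div_mul_cancel (by positivity), one_mul]

lemma learnedBatch_eq (hm : 0 < m) (s : Dataset d l n) (w : Dataset d l m) (α : ℝ) (z x : Vec d) :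
    learnedBatch P est s w α z x
      = 1 / (m : ℝ) * ∑ i, learnedCost P est s z (empResid est s (w i)) x
        + α / 2 * ‖x - z‖ ^ 2 :=
  average_add_const hm (fun i => learnedCost P est s z (empResid est s (w i)) x) _

lemma conceptBatch_eq (hm : 0 < m) (w : Dataset d l m) (α : ℝ) (z x : Vec d) :
    conceptBatch P w α z x
      = 1 / (m : ℝ) * ∑ i, P.costModel z (trueResid P (w i)) x + α / 2 * ‖x - z‖ ^ 2 :=
  average_add_const hm (fun i => P.costModel z (trueResid P (w i)) x) _

lemma Problem.Regular.convexOn_learnedCost (hP : P.Regular) (s : Dataset d l n) (z : Vec d)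
    (e : Vec l) : ConvexOn ℝ P.X (learnedCost P est s z e) :=
  (hP.convexOn_linModel _ _ _ _ z e).subset hP.X_subset hP.convex_X

lemma Problem.Regular.continuousOn_learnedCost (hP : P.Regular) (s : Dataset d l n) (z : Vec d)
    (e : Vec l) : ContinuousOn (learnedCost P est s z e) P.X :=
  (hP.continuousOn_linModel _ _ _ _ z).comp (f := fun x : Vec d => (e, x)) (by fun_prop)
    fun _ hx => ⟨trivial, hP.X_subset hx⟩

lemma Problem.Regular.continuousOn_costModel (hP : P.Regular) (z : Vec d) (e : Vec l) :
    ContinuousOn (P.costModel z e) P.X :=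
  (hP.continuousOn_linModel _ _ _ _ z).comp (f := fun x : Vec d => (e, x)) (by fun_prop)
    fun _ hx => ⟨trivial, hP.X_subset hx⟩

/-- The minimizer of the learning-based mini-batch surrogate. -/
def nextPt (P : Problem d l) (est : Estimators d l) (α : ℝ) (z : Vec d)
    (D : Dataset d l n × Dataset d l m) : Vec d :=
  Classical.epsilon fun y => y ∈ argminOn (learnedBatch P est D.1 D.2 α z) P.X

lemma Problem.Regular.argminOn_learnedBatch (hP : P.Regular) (hne : P.X.Nonempty) (hm : 0 < m)
    {α : ℝ} (hα : 0 < α) (z : Vec d) (D : Dataset d l n × Dataset d l m) :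
    argminOn (learnedBatch P est D.1 D.2 α z) P.X = {nextPt P est α z D} := by
  have h : learnedBatch P est D.1 D.2 α z = fun x =>
      (1 / (m : ℝ) * ∑ i, learnedCost P est D.1 z (empResid est D.1 (D.2 i)) x)
        + α / 2 * ‖x - z‖ ^ 2 := funext fun x => learnedBatch_eq hm _ _ _ _ _
  obtain ⟨y, hy⟩ := exists_argminOn_eq_singleton hP.compact_X hne
    (convexOn_average hP.convex_X fun i => hP.convexOn_learnedCost (est := est) D.1 z
      (empResid est D.1 (D.2 i)))
    (continuousOn_const.mul (continuousOn_finsetSum _ fun i _ =>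
      hP.continuousOn_learnedCost D.1 z _)) hα z
  rw [← h] at hy
  have h2 : nextPt P est α z D ∈ argminOn (learnedBatch P est D.1 D.2 α z) P.X :=
    Classical.epsilon_spec (p := fun y => y ∈ argminOn (learnedBatch P est D.1 D.2 α z) P.X)
      ⟨y, hy ▸ rfl⟩
  rw [hy] at h2 ⊢
  rw [mem_singleton_iff.1 h2]

lemma Problem.Regular.nextPt_mem (hP : P.Regular) (hne : P.X.Nonempty) (hm : 0 < m)
    {α : ℝ} (hα : 0 < α) (z : Vec d) (D : Dataset d l n × Dataset d l m) :
    nextPt P est α z D ∈ argminOn (learnedBatch P est D.1 D.2 α z) P.X := by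
  rw [hP.argminOn_learnedBatch hne hm hα]; rfl

lemma Estimators.Valid.measurable_empResid (hest : est.Valid P S) :
    Measurable fun p : Dataset d l n × (Vec d × Vec l) => empResid est p.1 p.2 := by
  have h : Measurable fun p : Dataset d l n × (Vec d × Vec l) => (p.1, p.2.1) := by fun_prop
  refine measurable_matOp_apply (measurable_matrix_inv (measurable_rowMatrix fun j =>
    (hest.meas_q n j).comp h)) ?_
  exact (by fun_prop : Measurable fun p : Dataset d l n × (Vec d × Vec l) => p.2.2).sub
    ((hest.meas_c n).comp h)

lemma Estimators.Valid.measurable_learnedCost (hest : est.Valid P S) (hP : P.Regular)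
    {x : Vec d} (hx : x ∈ P.X) {Ω : Type*} [MeasurableSpace Ω] {s : Ω → Dataset d l n}
    {z : Ω → Vec d} {e : Ω → Vec l} (hs : Measurable s) (hz : Measurable z) (he : Measurable e) :
    Measurable fun ω => learnedCost P est (s ω) (z ω) (e ω) x := by
  have hp : Measurable fun ω => (s ω, z ω) := hs.prodMk hz
  refine (hP.continuous_cost (hP.X_subset hx)).measurable.comp ?_
  simp only [linArg, gradRows_eq, matOp_rowMatrix]
  have hv : Measurable fun ω => x - z ω := measurable_const.sub hz
  have hc : Measurable fun ω => est.c n (s ω) (z ω) := (hest.meas_c n).comp hp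
  have hdc : Measurable fun ω => est.dc n (s ω) (z ω) := (hest.meas_dc n).comp hp
  have hq : ∀ j, Measurable fun ω => est.q n (s ω) j (z ω) := fun j => (hest.meas_q n j).comp hp
  have hdq : ∀ j, Measurable fun ω => est.dq n (s ω) j (z ω) := fun j => (hest.meas_dq n j).comp hp
  have h1 : Measurable fun ω => est.dc n (s ω) (z ω) (x - z ω) := measurable_clm_apply hdc hv
  have h2 : ∀ j, Measurable fun ω => est.dq n (s ω) j (z ω) (x - z ω) := fun j =>
    measurable_clm_apply (hdq j) hv
  have h3 := measurable_rowsMul (r := fun ω j => est.q n (s ω) j (z ω)) hq he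
  have h4 := measurable_rowsMul (r := fun ω j => est.dq n (s ω) j (z ω) (x - z ω)) h2 he
  exact ((hc.add h1).add h3).add h4

/-- The minimizer is unique, so `measurable_argmin` applies with the pair of reference point and
samples as parameter. -/
lemma Estimators.Valid.measurable_nextPt (hest : est.Valid P S) (hP : P.Regular)
    (hne : P.X.Nonempty) (hm : 0 < m) {α : ℝ} (hα : 0 < α) :
    Measurable fun p : Vec d × (Dataset d l n × Dataset d l m) => nextPt P est α p.1 p.2 := by
  have hA : ∀ p : Vec d × (Dataset d l n × Dataset d l m),
      argminOn (learnedBatch P est p.2.1 p.2.2 α p.1) P.X = {nextPt P est α p.1 p.2} :=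
    fun p => hP.argminOn_learnedBatch hne hm hα p.1 p.2
  refine measurable_argmin hP.compact_X (fun p => ?_) (fun x hx => ?_) hA
  · refine ContinuousOn.congr ?_ fun x _ => learnedBatch_eq hm _ _ _ _ _
    refine (continuousOn_const.mul (continuousOn_finsetSum _ fun i _ =>
      hP.continuousOn_learnedCost p.2.1 p.1 _)).add ?_
    fun_prop
  · simp_rw [learnedBatch_eq hm]
    refine Measurable.add (Measurable.const_mul (Finset.measurable_fun_sum _ fun i _ => ?_) _)
      (by fun_prop)
    refine hest.measurable_learnedCost hP hx (by fun_prop) (by fun_prop)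
      (hest.measurable_empResid.comp (g := fun p : Dataset d l n × (Vec d × Vec l) => _)
        (f := fun p : Vec d × (Dataset d l n × Dataset d l m) => (p.2.1, p.2.2 i)) (by fun_prop))

lemma Estimators.Valid.measurable_nextPt_comp (hest : est.Valid P S) (hP : P.Regular)
    (hne : P.X.Nonempty) (hm : 0 < m) {α : ℝ} (hα : 0 < α) {Ω : Type*} [MeasurableSpace Ω]
    {z : Ω → Vec d} {D : Ω → Dataset d l n × Dataset d l m} (hz : Measurable z)
    (hD : Measurable D) : Measurable fun ω => nextPt P est α (z ω) (D ω) := by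
  have h := (hest.measurable_nextPt (n := n) hP hne hm hα).comp (hz.prodMk hD)
  exact h

/-- The uniform error of the learning-based surrogate at one sample. -/
def surrogateGap (P : Problem d l) (est : Estimators d l) (z : Vec d)
    (p : Dataset d l n × (Vec d × Vec l)) : ℝ≥0∞ :=
  ⨆ x ∈ P.X, ‖learnedCost P est p.1 z (empResid est p.1 p.2) x
    - P.costModel z (trueResid P p.2) x‖ₑ

variable {κ : Measure (Vec d)}

lemma Problem.Regular.measurePreserving_trueResid_extend (hP : P.Regular)
    [IsProbabilityMeasure κ] (hκ : κ P.Oᶜ = 0) :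
    MeasurePreserving (trueResid P.extend) (P.obsLaw κ) P.noise :=
  ⟨hP.measurable_trueResid_extend, by
    rw [← hP.map_trueResid hκ]
    exact Measure.map_congr (hP.trueResid_extend_ae hκ).symm⟩

lemma Problem.Regular.aemeasurable_surrogateGap (hP : P.Regular) (hest : est.Valid P S)
    (hκ : κ P.Oᶜ = 0) (z : Vec d) {Ω : Type*} [MeasurableSpace Ω] {μ : Measure Ω}
    {f : Ω → Dataset d l n × (Vec d × Vec l)} (hf : Measurable f)
    (hq : Measure.QuasiMeasurePreserving (fun ω => (f ω).2) μ (P.obsLaw κ)) :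
    AEMeasurable (fun ω => surrogateGap P est z (f ω)) μ := by
  refine aemeasurable_biSup_of_continuousOn (F := fun ω x =>
    ‖learnedCost P est (f ω).1 z (empResid est (f ω).1 (f ω).2) x
      - P.costModel z (trueResid P (f ω).2) x‖ₑ) (fun ω => ?_) fun x hx => ?_
  · exact ((hP.continuousOn_learnedCost _ _ _).sub (hP.continuousOn_costModel _ _)).enorm
  · have h1 : Measurable fun ω => learnedCost P est (f ω).1 z (empResid est (f ω).1 (f ω).2) x :=
      hest.measurable_learnedCost hP hx hf.fst measurable_const (hest.measurable_empResid.comp hf)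
    have h2 : Continuous fun e => P.costModel z e x :=
      (hP.continuousOn_linModel _ _ _ _ z).comp_continuous
        (by fun_prop : Continuous fun e : Vec l => (e, x)) fun e => ⟨trivial, hP.X_subset hx⟩
    have h3 : AEMeasurable (fun ω => trueResid P (f ω).2) μ :=
      (hP.aemeasurable_trueResid hκ).comp_quasiMeasurePreserving hq
    exact (h1.aemeasurable.sub (h2.measurable.comp_aemeasurable h3)).enorm

/-- A batch of one sample: the proximal terms cancel and the batch error is the gap at a single
residual. Only this instance of the hypothesis enters the analysis of the algorithm. -/
lemma SurrogateErrorBound.lintegral_surrogateGap_le {r C : ℝ} (h : SurrogateErrorBound P S est r C)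
    (hP : P.Regular) (hS : S.Valid P) (hn : 0 < n) {z : Vec d} (hz : z ∈ P.X) :
    ∫⁻ p, surrogateGap P est z p ∂(S.dataLaw P n z).prod (S.residLaw P z)
      ≤ ENNReal.ofReal (C * (n : ℝ) ^ (-(r / 2))) := by
  have := (hS.isProbabilityMeasure hP n hz).1
  have := (hS.isProbabilityMeasure hP n hz).2
  have : IsProbabilityMeasure (S.dataLaw P n z) := by unfold Oracle.dataLaw; infer_instance
  refine le_trans (le_of_eq ?_) (h n 1 hn one_pos 1 one_pos z hz)
  let φ : Dataset d l n × Dataset d l 1 ≃ᵐ Dataset d l n × (Vec d × Vec l) :=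
    (MeasurableEquiv.refl _).prodCongr (MeasurableEquiv.funUnique (Fin 1) _)
  have hφ : MeasurePreserving φ (S.batchLaw P n 1 z)
      ((S.dataLaw P n z).prod (S.residLaw P z)) :=
    (MeasurePreserving.id _).prod (measurePreserving_funUnique (S.residLaw P z) (Fin 1))
  rw [← hφ.lintegral_comp_emb φ.measurableEmbedding]
  refine lintegral_congr fun D => biSup_congr fun x _ => ?_
  rw [learnedBatch_eq one_pos, conceptBatch_eq one_pos]
  simp only [Nat.cast_one, div_one, one_mul, Finset.univ_unique, Finset.sum_singleton,
    add_sub_add_right_eq_sub]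
  rfl

end Surrogate

/-! ### Expected descent of the Moreau envelope -/

section Descent

variable {d l n m : ℕ} {P : Problem d l} {S : Oracle d} {est : Estimators d l}

lemma Problem.Regular.memLp_lipConst (hP : P.Regular) (z : Vec d) :
    MemLp (P.lipConst z) 2 P.noise := by
  refine (memLp_two_iff_integrable_sq ?_).2 (hP.integrable_lipConst_sq z)
  unfold Problem.lipConst
  exact (by fun_prop : Continuous fun e : Vec l => P.Lφ * (1 + ‖fderiv ℝ P.c z‖
    + Real.sqrt (∑ j, ‖fderiv ℝ (P.q j) z‖ ^ 2) * ‖e‖)).aestronglyMeasurable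

lemma integral_affine {Ω : Type*} [MeasurableSpace Ω] {μ : Measure Ω} [IsProbabilityMeasure μ]
    {G : Ω → ℝ} (hG : Integrable G μ) (a b c : ℝ) :
    ∫ ω, (a + b * (G ω - c)) ∂μ = a + b * ((∫ ω, G ω ∂μ) - c) := by
  have h : Integrable (fun ω => G ω - c) μ := hG.sub (integrable_const _)
  rw [integral_add (integrable_const _) (h.const_mul b), integral_const_mul,
    integral_sub hG (integrable_const _)]
  simp

/-- Descent of the envelope at a point that nearly minimizes the proximal model. -/
lemma Problem.Regular.envelope_le_of_model (hP : P.Regular) {ρ α : ℝ} (hρ : P.τ < ρ)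
    (hα : ρ + P.τ ≤ α) {z x : Vec d} (hz : z ∈ P.X) (hx : x ∈ P.X) :
    P.envelope ρ x ≤ P.f (prox P.f P.X (1 / ρ) z) + ρ / (α + ρ - P.τ) *
      ((P.model z x + α / 2 * ‖x - z‖ ^ 2 + α / 2 * ‖prox P.f P.X (1 / ρ) z - x‖ ^ 2)
        - P.envelope ρ z) := by
  have hτ := P.τ_nonneg
  have hρ0 : 0 < ρ := hτ.trans_lt hρ
  have hβ : 0 < α + ρ - P.τ := by linarith
  have hne : P.X.Nonempty := ⟨z, hz⟩
  have h1 := hP.envelope_le hρ x (hP.prox_mem hne hρ z)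
  have h2 := hP.prox_growth hρ z hx
  have h3 := (abs_le.1 (hP.abs_model_sub_le (hP.X_subset hz) (hP.X_subset hx))).1
  rw [norm_sub_rev x (prox P.f P.X (1 / ρ) z)] at h2
  set y := prox P.f P.X (1 / ρ) z
  -- Growth of the proximal objective at `z` bounds the distance from `x` to the proximal point `y`.
  -- Replacing `f x` by the model costs `τ/2 ‖x - z‖²`, and `ρ + τ ≤ α` lets `α/2 ‖x - z‖²` absorb
  -- this together with `ρ/2 ‖x - z‖²`.
  have h4 : (α + ρ - P.τ) / 2 * ‖y - x‖ ^ 2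
      ≤ (P.model z x + α / 2 * ‖x - z‖ ^ 2 + α / 2 * ‖y - x‖ ^ 2) - P.envelope ρ z := by
    rw [envelope]
    have := mul_nonneg (by linarith : 0 ≤ (α - ρ - P.τ) / 2) (sq_nonneg ‖x - z‖)
    linarith
  have h5 := mul_le_mul_of_nonneg_left h4 (by positivity : 0 ≤ ρ / (α + ρ - P.τ))
  have h6 : ρ / (α + ρ - P.τ) * ((α + ρ - P.τ) / 2 * ‖y - x‖ ^ 2) = ρ / 2 * ‖y - x‖ ^ 2 := by
    field_simp
  linarith

set_option maxHeartbeats 400000 in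
/-- Expected descent of the envelope over the mini-batch, for a fixed data set `s`. -/
lemma Problem.Regular.integral_envelope_le_of_data (hP : P.Regular) (hS : S.Valid P)
    (hest : est.Valid P S) (hm : 0 < m) {ρ α : ℝ} (hρ : P.τ < ρ) (hα : ρ + P.τ ≤ α) {z : Vec d}
    (hz : z ∈ P.X) (s : Dataset d l n)
    (hs : ∫⁻ w, surrogateGap P est z (s, w) ∂S.residLaw P z ≠ ⊤) :
    ∫ w, P.envelope ρ (nextPt P est α z (s, w)) ∂(Measure.pi fun _ : Fin m => S.residLaw P z)
      ≤ P.envelope ρ z - ρ / (α + ρ - P.τ) * ((ρ - P.τ) * ‖prox P.f P.X (1 / ρ) z - z‖ ^ 2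
        - (2 * P.L ^ 2 / (m * α)
          + 4 * (∫⁻ w, surrogateGap P est z (s, w) ∂S.residLaw P z).toReal)) := by
  have hτ := P.τ_nonneg
  have hρ0 : 0 < ρ := hτ.trans_lt hρ
  have hne : P.X.Nonempty := ⟨z, hz⟩
  have hα0 : 0 < α := by linarith
  have hβ : 0 < α + ρ - P.τ := by linarith
  have hzO := hP.X_subset hz
  have hκ := hS.resid_compl hP hz
  have := hS.prob_resid z
  have := hP.noise_prob
  have := (hS.isProbabilityMeasure hP n hz).2
  have hlaw := Oracle.residLaw_eq (P := P) (S := S) z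
  set ν := S.residLaw P z with hν
  set y := prox P.f P.X (1 / ρ) z with hy
  have hyX : y ∈ P.X := hP.prox_mem hne hρ z
  set tr := trueResid P.extend with htr
  have hmp : MeasurePreserving tr ν P.noise := by
    rw [hlaw]; exact hP.measurePreserving_trueResid_extend hκ
  have htr_ae : trueResid P =ᵐ[ν] tr := by rw [hlaw]; exact hP.trueResid_extend_ae hκ
  have hgap : AEMeasurable (fun w => surrogateGap P est z (s, w)) ν := by
    refine hP.aemeasurable_surrogateGap hest hκ z (by fun_prop) ?_
    rw [← hlaw]
    exact Measure.QuasiMeasurePreserving.id _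
  set A : Dataset d l m → Vec d := fun w => nextPt P est α z (s, w) with hA
  have hAmin : ∀ w, A w ∈ argminOn (learnedBatch P est s w α z) P.X := fun w =>
    hP.nextPt_mem hne hm hα0 z (s, w)
  have hAX : ∀ w, A w ∈ P.X := fun w => (hAmin w).1
  have hAm : Measurable A :=
    hest.measurable_nextPt_comp hP hne hm hα0 measurable_const measurable_prodMk_left
  have hmodel : ∀ x ∈ P.X, ∫ w, P.costModel z (tr w) x ∂ν = P.model z x := fun x hx =>
    integral_comp_measurePreserving hmp
      (hP.integrable_costModel hzO (hP.X_subset hx)).aestronglyMeasurable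
  have hlip : ∫ w, P.lipConst z (tr w) ^ 2 ∂ν = ∫ e, P.lipConst z e ^ 2 ∂P.noise :=
    integral_comp_measurePreserving hmp (hP.integrable_lipConst_sq z).aestronglyMeasurable
  have hjoint : Measurable fun p : (Vec d × Vec l) × P.X => P.costModel z (tr p.1) p.2 := by
    have h : Continuous fun p : Vec l × P.X => P.costModel z p.1 p.2 :=
      (hP.continuousOn_linModel _ _ _ _ z).comp_continuous
        (by fun_prop : Continuous fun p : Vec l × P.X => (p.1, (p.2 : Vec d)))
        fun p => ⟨trivial, hP.X_subset p.2.2⟩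
    exact h.measurable.comp ((hmp.measurable.comp measurable_fst).prodMk measurable_snd)
  -- With `s` fixed, the learned models are the functions that are minimized, the true models are
  -- the Lipschitz approximations, and the surrogate gap is the error; the comparison point is the
  -- proximal point of `z`.
  obtain ⟨hI, hE⟩ := integral_excess_le ν hP.compact_X
    (g := fun w => learnedCost P est s z (empResid est s w))
    (h := fun w => P.costModel z (tr w)) (ℓ := fun w => P.lipConst z (tr w))
    (e := fun w => (surrogateGap P est z (s, w)).toReal)
    (fun w => hP.convexOn_learnedCost s z _) hjoint
    (fun x hx => hmp.integrable_comp_of_integrable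
      (hP.integrable_costModel hzO (hP.X_subset hx)))
    (fun w x hx y hy => hP.abs_costModel_sub_le z _ (hP.X_subset hx) (hP.X_subset hy))
    ((hP.memLp_lipConst z).comp_measurePreserving hmp)
    (by
      filter_upwards [htr_ae, ae_lt_top' hgap hs] with w hw hw' x hx
      rw [← hw, ← Real.norm_eq_abs, ← toReal_enorm]
      refine ENNReal.toReal_mono hw'.ne ?_
      exact le_iSup₂ (f := fun x (_ : x ∈ P.X) => ‖learnedCost P est s z (empResid est s w) x
        - P.costModel z (trueResid P w) x‖ₑ) x hx)
    (integrable_toReal_of_lintegral_ne_top hgap hs) hm hα0 z hAm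
    (fun w => by
      have h : learnedBatch P est s w α z = fun x => 1 / (m : ℝ) *
          ∑ i, learnedCost P est s z (empResid est s (w i)) x + α / 2 * ‖x - z‖ ^ 2 :=
        funext fun x => learnedBatch_eq hm _ _ _ _ _
      rw [← h]
      exact hAmin w) hyX
  simp only [hmodel _ (hAX _), hmodel y hyX, hlip] at hI hE
  rw [integral_toReal hgap (ae_lt_top' hgap hs)] at hE
  set π := Measure.pi fun _ : Fin m => ν with hπ
  set ε := (∫⁻ w, surrogateGap P est z (s, w) ∂ν).toReal with hε
  have hquad : Integrable (fun w => α / 2 * ‖A w - z‖ ^ 2 + α / 2 * ‖y - A w‖ ^ 2) π := by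
    obtain ⟨B, hB⟩ := hP.compact_X.exists_bound_of_continuousOn (f := fun x : Vec d =>
      α / 2 * ‖x - z‖ ^ 2 + α / 2 * ‖y - x‖ ^ 2) (by fun_prop)
    refine Integrable.of_bound ?_ B (ae_of_all _ fun w => hB _ (hAX w))
    exact (by fun_prop : Measurable fun w =>
      α / 2 * ‖A w - z‖ ^ 2 + α / 2 * ‖y - A w‖ ^ 2).aestronglyMeasurable
  have hG : Integrable (fun w => P.model z (A w) + α / 2 * ‖A w - z‖ ^ 2
      + α / 2 * ‖y - A w‖ ^ 2) π := by
    simp only [add_assoc]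
    exact hI.add hquad
  have henv : Integrable (fun w => P.envelope ρ (A w)) π := by
    have hc := hP.continuous_envelope hne hρ
    obtain ⟨B, hB⟩ := hP.compact_X.exists_bound_of_continuousOn hc.continuousOn
    exact Integrable.of_bound (hc.measurable.comp hAm).aestronglyMeasurable B
      (ae_of_all _ fun w => hB _ (hAX w))
  have h1 : ∫ w, P.envelope ρ (A w) ∂π ≤ ∫ w, (P.f y + ρ / (α + ρ - P.τ) *
      ((P.model z (A w) + α / 2 * ‖A w - z‖ ^ 2 + α / 2 * ‖y - A w‖ ^ 2)
        - P.envelope ρ z)) ∂π :=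
    integral_mono henv ((integrable_const _).add ((hG.sub (integrable_const _)).const_mul _))
      fun w => hP.envelope_le_of_model hρ hα hz (hAX w)
  rw [integral_affine hG] at h1
  have h2 := (abs_le.1 (hP.abs_model_sub_le hzO (hP.X_subset hyX))).2
  have h3 := hP.integral_lipConst_sq_le hz
  have hm' : (0 : ℝ) < m := by exact_mod_cast hm
  have h4 : 2 * (∫ e, P.lipConst z e ^ 2 ∂P.noise) / (m * α) ≤ 2 * P.L ^ 2 / (m * α) := by gcongr
  have hw : P.envelope ρ z = P.f y + ρ / 2 * ‖y - z‖ ^ 2 := rfl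
  have h5 : (∫ w, (P.model z (A w) + α / 2 * ‖A w - z‖ ^ 2 + α / 2 * ‖y - A w‖ ^ 2) ∂π)
      - P.envelope ρ z ≤ (α + P.τ - ρ) / 2 * ‖y - z‖ ^ 2 + (2 * P.L ^ 2 / (m * α) + 4 * ε) := by
    linarith
  have h6 := mul_le_mul_of_nonneg_left h5 (by positivity : 0 ≤ ρ / (α + ρ - P.τ))
  have h7 : P.f y + ρ / (α + ρ - P.τ) *
        ((α + P.τ - ρ) / 2 * ‖y - z‖ ^ 2 + (2 * P.L ^ 2 / (m * α) + 4 * ε))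
      = P.envelope ρ z - ρ / (α + ρ - P.τ) * ((ρ - P.τ) * ‖y - z‖ ^ 2
        - (2 * P.L ^ 2 / (m * α) + 4 * ε)) := by
    rw [hw]; field_simp; ring
  linarith

set_option maxHeartbeats 400000 in
/-- Expected descent of the envelope over one iteration of the algorithm. -/
lemma Problem.Regular.integral_envelope_nextPt_le (hP : P.Regular) (hS : S.Valid P)
    (hest : est.Valid P S) {r C : ℝ} (hC : 0 < C) (hbound : SurrogateErrorBound P S est r C)
    (hn : 0 < n) (hm : 0 < m) {ρ α : ℝ} (hρ : P.τ < ρ) (hα : ρ + P.τ ≤ α) {z : Vec d}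
    (hz : z ∈ P.X) :
    ∫ D, P.envelope ρ (nextPt P est α z D) ∂S.batchLaw P n m z
      ≤ P.envelope ρ z - ρ / (α + ρ - P.τ) * ((ρ - P.τ) * ‖prox P.f P.X (1 / ρ) z - z‖ ^ 2
        - (2 * P.L ^ 2 / (m * α) + 4 * (C * (n : ℝ) ^ (-(r / 2))))) := by
  have hτ := P.τ_nonneg
  have hρ0 : 0 < ρ := hτ.trans_lt hρ
  have hne : P.X.Nonempty := ⟨z, hz⟩
  have hα0 : 0 < α := by linarith
  have hβ : 0 < α + ρ - P.τ := by linarith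
  have hκ := hS.resid_compl hP hz
  have := (hS.isProbabilityMeasure hP n hz).1
  have := (hS.isProbabilityMeasure hP n hz).2
  have : IsProbabilityMeasure (S.dataLaw P n z) := by unfold Oracle.dataLaw; infer_instance
  have hlaw := Oracle.residLaw_eq (P := P) (S := S) z
  have hgap : AEMeasurable (surrogateGap P est z)
      ((S.dataLaw P n z).prod (S.residLaw P z)) := by
    refine hP.aemeasurable_surrogateGap hest hκ z measurable_id ?_
    rw [← hlaw]
    exact Measure.quasiMeasurePreserving_snd
  have hle := hbound.lintegral_surrogateGap_le hP hS hn hz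
  have hfin : ∫⁻ s, ∫⁻ w, surrogateGap P est z (s, w) ∂S.residLaw P z ∂S.dataLaw P n z
      ≤ ENNReal.ofReal (C * (n : ℝ) ^ (-(r / 2))) := by
    rwa [← lintegral_prod _ hgap]
  have hne' := (hfin.trans_lt ENNReal.ofReal_lt_top).ne
  have hcm := hgap.lintegral_prod_right'
  have hlt := ae_lt_top' hcm hne'
  have hc := hP.continuous_envelope hne hρ
  obtain ⟨B, hB⟩ := hP.compact_X.exists_bound_of_continuousOn hc.continuousOn
  have hX : ∀ D : Dataset d l n × Dataset d l m, nextPt P est α z D ∈ P.X := fun D =>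
    (hP.nextPt_mem hne hm hα0 z D).1
  have hmeas : Measurable fun D : Dataset d l n × Dataset d l m =>
      P.envelope ρ (nextPt P est α z D) :=
    hc.measurable.comp
      (hest.measurable_nextPt_comp hP hne hm hα0 measurable_const measurable_id)
  have hint : Integrable (fun D : Dataset d l n × Dataset d l m =>
      P.envelope ρ (nextPt P est α z D))
      ((S.dataLaw P n z).prod (Measure.pi fun _ : Fin m => S.residLaw P z)) :=
    Integrable.of_bound hmeas.aestronglyMeasurable B (ae_of_all _ fun D => hB _ (hX D))
  rw [Oracle.batchLaw, integral_prod _ hint]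
  have hei := integrable_toReal_of_lintegral_ne_top hcm hne'
  have h1 : ∫ s, (∫⁻ w, surrogateGap P est z (s, w) ∂S.residLaw P z).toReal ∂S.dataLaw P n z
      ≤ C * (n : ℝ) ^ (-(r / 2)) := by
    rw [integral_toReal hcm hlt]
    exact ENNReal.toReal_le_of_le_ofReal (by positivity) hfin
  set θ := ρ / (α + ρ - P.τ) with hθ
  set N := (ρ - P.τ) * ‖prox P.f P.X (1 / ρ) z - z‖ ^ 2 with hN
  have hθ0 : 0 ≤ θ := by positivity
  have h2 : ∀ v : ℝ, P.envelope ρ z - θ * (N - (2 * P.L ^ 2 / (m * α) + 4 * v))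
      = P.envelope ρ z + 4 * θ * (v - (N - 2 * P.L ^ 2 / (m * α)) / 4) := fun v => by ring
  refine (integral_mono_ae hint.integral_prod_left
    (g := fun s => P.envelope ρ z + 4 * θ * ((∫⁻ w, surrogateGap P est z (s, w)
      ∂S.residLaw P z).toReal - (N - 2 * P.L ^ 2 / (m * α)) / 4)) ?_ ?_).trans ?_
  · exact (integrable_const _).add ((hei.sub (integrable_const _)).const_mul _)
  -- The gap is finite for almost every data set, and the bound for a fixed one is affine in its
  -- gap, so it can be integrated.
  · filter_upwards [hlt] with s hs
    rw [← h2]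
    exact hP.integral_envelope_le_of_data hS hest hm hρ hα hz s hs.ne
  · rw [integral_affine hei, h2]
    gcongr

end Descent

/-! ### Runs of the algorithm -/

section Aux

lemma sq_lintegral_le_lintegral_sq {Ω : Type*} [MeasurableSpace Ω] {μ : Measure Ω}
    [IsProbabilityMeasure μ] {f : Ω → ℝ≥0∞} (hf : AEMeasurable f μ) :
    (∫⁻ ω, f ω ∂μ) ^ 2 ≤ ∫⁻ ω, f ω ^ 2 ∂μ := by
  have h := ENNReal.lintegral_mul_le_Lp_mul_Lq μ Real.HolderConjugate.two_two hf
    (aemeasurable_const (b := (1 : ℝ≥0∞)))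
  simp only [Pi.mul_apply, mul_one, ENNReal.one_rpow, lintegral_const, measure_univ] at h
  calc (∫⁻ ω, f ω ∂μ) ^ 2 ≤ ((∫⁻ ω, f ω ^ (2 : ℝ) ∂μ) ^ (1 / 2 : ℝ)) ^ 2 := by gcongr
    _ = ∫⁻ ω, f ω ^ 2 ∂μ := by
      rw [← ENNReal.rpow_natCast, ← ENNReal.rpow_mul]
      norm_num

lemma lintegral_le_ofReal_of_sq_le {Ω : Type*} [MeasurableSpace Ω] {μ : Measure Ω}
    [IsProbabilityMeasure μ] {f : Ω → ℝ≥0∞} (hf : AEMeasurable f μ) {a : ℝ} (ha : 0 ≤ a)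
    (h : ∫⁻ ω, f ω ^ 2 ∂μ ≤ ENNReal.ofReal (a ^ 2)) : ∫⁻ ω, f ω ∂μ ≤ ENNReal.ofReal a := by
  rw [ENNReal.ofReal_pow ha] at h
  exact (ENNReal.pow_le_pow_left_iff two_ne_zero).1 ((sq_lintegral_le_lintegral_sq hf).trans h)

/-- Summation by parts with nonincreasing weights; the induction carries the boundary term `g k * (u
k - c)`, which is nonnegative and dropped at the end. -/
lemma sum_mul_sub_le {g u : ℕ → ℝ} {c Δ : ℝ} {T : ℕ} (hg : Antitone g) (hg0 : 0 ≤ g (T + 1))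
    (hu0 : ∀ t ≤ T + 1, c ≤ u t) (hu : u 0 ≤ c + Δ) :
    ∑ t ∈ Finset.range (T + 1), g t * (u t - u (t + 1)) ≤ g 0 * Δ := by
  have h : ∀ k ≤ T + 1, ∑ t ∈ Finset.range k, g t * (u t - u (t + 1)) + g k * (u k - c)
      ≤ g 0 * Δ := by
    intro k
    induction k with
    | zero =>
      intro _
      have h0 : 0 ≤ g 0 := hg0.trans (hg (Nat.zero_le _))
      simp only [Finset.range_zero, Finset.sum_empty, zero_add]
      gcongr
      linarith
    | succ k ih =>
      intro hk
      have h1 := ih (by omega)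
      have h2 : g (k + 1) ≤ g k := hg (Nat.le_succ k)
      have h3 := hu0 (k + 1) hk
      rw [Finset.sum_range_succ]
      nlinarith
  have h1 := h (T + 1) le_rfl
  have h2 := mul_nonneg hg0 (sub_nonneg.2 (hu0 (T + 1) le_rfl))
  linarith

end Aux

section Run

variable {d l n m : ℕ} {P : Problem d l} {S : Oracle d} {est : Estimators d l}
  {Ω : Type*} [MeasurableSpace Ω] {μ : Measure Ω}
  {D : ℕ → Ω → Dataset d l n × Dataset d l m} {z : ℕ → Ω → Vec d} {α : ℕ → ℝ} {T : ℕ} {z₀ : Vec d}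

/-- The law of the samples of one iteration as a kernel from the reference point. -/
def Oracle.Valid.batchKernel (hS : S.Valid P) (hP : P.Regular) (n m : ℕ) :
    Kernel (Vec d) (Dataset d l n × Dataset d l m) :=
  ⟨S.batchLaw P.extend n m, hS.measurable_batchLaw_extend hP n m⟩

instance Oracle.Valid.isMarkovKernel_batchKernel (hS : S.Valid P) (hP : P.Regular) (n m : ℕ) :
    IsMarkovKernel (hS.batchKernel hP n m) := by
  refine ⟨fun z => ?_⟩
  have := (hS.isProbabilityMeasure_extend hP n z).1
  have := (hS.isProbabilityMeasure_extend hP n z).2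
  change IsProbabilityMeasure (S.batchLaw P.extend n m z)
  unfold Oracle.batchLaw Oracle.dataLaw
  infer_instance

namespace IsRun

lemma history_le (h : IsRun P S est n m α T z₀ μ D z) {t : ℕ} (ht : t ≤ T + 1) :
    history D t ≤ ‹MeasurableSpace Ω› :=
  iSup₂_le fun s hs => (h.meas_samples s (by omega)).comap_le

lemma mem (h : IsRun P S est n m α T z₀ μ D z) {t : ℕ} (ht : t ≤ T + 1) (ω : Ω) :
    z t ω ∈ P.X := by
  cases t with
  | zero => rw [h.start]; exact h.start_mem
  | succ t => exact (h.step t (by omega) ω).1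

lemma measurable_iterate (h : IsRun P S est n m α T z₀ μ D z) {t : ℕ} (ht : t ≤ T) :
    Measurable (z t) :=
  (h.meas_iterate t ht).mono (h.history_le (by omega)) le_rfl

lemma iterate_succ (h : IsRun P S est n m α T z₀ μ D z) (hP : P.Regular) (hm : 0 < m) {t : ℕ}
    (hα : 0 < α t) (ht : t ≤ T) (ω : Ω) : z (t + 1) ω = nextPt P est (α t) (z t ω) (D t ω) := by
  have h1 := h.step t ht ω
  rw [hP.argminOn_learnedBatch ⟨z₀, h.start_mem⟩ hm hα] at h1
  exact h1

/-- The iterate is measurable with respect to the history, so conditional sampling, tested on its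
preimages, identifies the joint law of iterate and fresh samples on all rectangles. -/
lemma map_prodMk (h : IsRun P S est n m α T z₀ μ D z) (hP : P.Regular) (hS : S.Valid P)
    [IsProbabilityMeasure μ] {t : ℕ} (ht : t ≤ T) :
    μ.map (fun ω => (z t ω, D t ω)) = (μ.map (z t)) ⊗ₘ hS.batchKernel hP n m := by
  have hz := h.measurable_iterate ht
  have hpair : Measurable fun ω => (z t ω, D t ω) := hz.prodMk (h.meas_samples t ht)
  have := Measure.isProbabilityMeasure_map (μ := μ) hpair.aemeasurable
  have := Measure.isProbabilityMeasure_map (μ := μ) hz.aemeasurable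
  refine Measure.ext_prod fun {s U} hs hU => ?_
  rw [Measure.map_apply hpair (hs.prod hU), Measure.compProd_apply_prod hs hU,
    setLIntegral_map hs (Kernel.measurable_coe _ hU) hz]
  refine (h.sampling t ht (z t ⁻¹' s) (h.meas_iterate t ht hs) U hU).trans ?_
  refine lintegral_congr fun ω => ?_
  rw [← hS.batchLaw_extend hP n m (h.mem (by omega) ω)]
  rfl

/-- The next iterate is a fixed function of the current one and its fresh samples. By disintegration
of their joint law, the descent at a deterministic reference point can be integrated over the
iterates. -/
lemma integral_envelope_succ_le (h : IsRun P S est n m α T z₀ μ D z) (hP : P.Regular)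
    (hS : S.Valid P) (hest : est.Valid P S) [IsProbabilityMeasure μ] {r C : ℝ} (hC : 0 < C)
    (hbound : SurrogateErrorBound P S est r C) (hn : 0 < n) (hm : 0 < m) {ρ : ℝ} (hρ : P.τ < ρ)
    {t : ℕ} (hα : ρ + P.τ ≤ α t) (ht : t ≤ T) :
    ∫ ω, P.envelope ρ (z (t + 1) ω) ∂μ ≤ ∫ ω, P.envelope ρ (z t ω) ∂μ
      - ρ / (α t + ρ - P.τ) * ((ρ - P.τ) * (∫ ω, ‖z t ω - prox P.f P.X (1 / ρ) (z t ω)‖ ^ 2 ∂μ)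
        - (2 * P.L ^ 2 / (m * α t) + 4 * (C * (n : ℝ) ^ (-(r / 2))))) := by
  have hne : P.X.Nonempty := ⟨z₀, h.start_mem⟩
  have hα0 : 0 < α t := by linarith [P.τ_nonneg]
  have hz := h.measurable_iterate ht
  have hc := hP.continuous_envelope hne hρ
  have hp := hP.continuous_prox hne hρ
  obtain ⟨B, hB⟩ := hP.compact_X.exists_bound_of_continuousOn hc.continuousOn
  obtain ⟨B', hB'⟩ := hP.compact_X.exists_bound_of_continuousOn
    (f := fun x => ‖x - prox P.f P.X (1 / ρ) x‖ ^ 2) (by fun_prop)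
  have hpair : Measurable fun ω => (z t ω, D t ω) := hz.prodMk (h.meas_samples t ht)
  have hnext := hest.measurable_nextPt_comp (n := n) hP hne hm hα0 measurable_fst
    (measurable_snd (α := Vec d) (β := Dataset d l n × Dataset d l m))
  have hψ : Measurable fun p : Vec d × (Dataset d l n × Dataset d l m) =>
      P.envelope ρ (nextPt P est (α t) p.1 p.2) := hc.measurable.comp hnext
  have := Measure.isProbabilityMeasure_map (μ := μ) hz.aemeasurable
  have hψi : Integrable (fun p : Vec d × (Dataset d l n × Dataset d l m) =>
      P.envelope ρ (nextPt P est (α t) p.1 p.2))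
      ((μ.map (z t)) ⊗ₘ hS.batchKernel hP n m) :=
    Integrable.of_bound hψ.aestronglyMeasurable B
      (ae_of_all _ fun p => hB _ (hP.nextPt_mem hne hm hα0 p.1 p.2).1)
  have hinner : Integrable (fun x => ∫ D', P.envelope ρ (nextPt P est (α t) x D')
      ∂hS.batchKernel hP n m x) (μ.map (z t)) :=
    Integrable.integral_compProd (κ := Kernel.const Unit (μ.map (z t)))
      (η := Kernel.prodMkLeft Unit (hS.batchKernel hP n m)) (a := ()) hψi
  have h1 : ∫ ω, P.envelope ρ (z (t + 1) ω) ∂μ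
      = ∫ ω, (∫ D', P.envelope ρ (nextPt P est (α t) (z t ω) D') ∂S.batchLaw P n m (z t ω)) ∂μ := by
    simp_rw [h.iterate_succ hP hm hα0 ht]
    rw [← integral_map (φ := fun ω => (z t ω, D t ω)) hpair.aemeasurable hψ.aestronglyMeasurable,
      h.map_prodMk hP hS ht, Measure.integral_compProd hψi,
      integral_map hz.aemeasurable hinner.aestronglyMeasurable]
    refine integral_congr_ae (ae_of_all _ fun ω => ?_)
    simp only
    rw [← hS.batchLaw_extend hP n m (h.mem (by omega) ω)]
    rfl
  have henv : Integrable (fun ω => P.envelope ρ (z t ω)) μ :=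
    Integrable.of_bound (hc.measurable.comp hz).aestronglyMeasurable B
      (ae_of_all _ fun ω => hB _ (h.mem (by omega) ω))
  have hN : Integrable (fun ω => ‖z t ω - prox P.f P.X (1 / ρ) (z t ω)‖ ^ 2) μ := by
    refine Integrable.of_bound ?_ B' (ae_of_all _ fun ω => hB' _ (h.mem (by omega) ω))
    exact ((by fun_prop : Continuous fun x => ‖x - prox P.f P.X (1 / ρ) x‖ ^ 2).measurable.comp
      hz).aestronglyMeasurable
  have hL : Integrable (fun ω => ∫ D', P.envelope ρ (nextPt P est (α t) (z t ω) D')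
      ∂S.batchLaw P n m (z t ω)) μ := by
    have h2 := (integrable_map_measure hinner.aestronglyMeasurable hz.aemeasurable).1 hinner
    refine h2.congr (ae_of_all _ fun ω => ?_)
    simp only [Function.comp]
    rw [← hS.batchLaw_extend hP n m (h.mem (by omega) ω)]
    rfl
  rw [h1]
  set θ := ρ / (α t + ρ - P.τ) with hθ
  set E := 2 * P.L ^ 2 / (m * α t) + 4 * (C * (n : ℝ) ^ (-(r / 2))) with hE
  have h2 : ∫ ω, (P.envelope ρ (z t ω)
        - θ * ((ρ - P.τ) * ‖z t ω - prox P.f P.X (1 / ρ) (z t ω)‖ ^ 2 - E)) ∂μ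
      = ∫ ω, P.envelope ρ (z t ω) ∂μ
        - θ * ((ρ - P.τ) * (∫ ω, ‖z t ω - prox P.f P.X (1 / ρ) (z t ω)‖ ^ 2 ∂μ) - E) := by
    have h3 : Integrable (fun ω => (ρ - P.τ) * ‖z t ω - prox P.f P.X (1 / ρ) (z t ω)‖ ^ 2 - E) μ :=
      (hN.const_mul _).sub (integrable_const _)
    rw [integral_sub henv (h3.const_mul θ), integral_const_mul,
      integral_sub (hN.const_mul _) (integrable_const _), integral_const_mul]
    simp
  rw [← h2]
  refine integral_mono hL (henv.sub (((hN.const_mul _).sub (integrable_const _)).const_mul _))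
    fun ω => ?_
  have h4 := hP.integral_envelope_nextPt_le hS hest hC hbound hn hm hρ hα (h.mem (by omega) ω)
    (z := z t ω)
  rwa [norm_sub_rev (prox P.f P.X (1 / ρ) (z t ω))] at h4

/-- The weighted sum of the expected squared distances to the proximal points. -/
lemma sum_weight_mul_le (h : IsRun P S est n m α T z₀ μ D z) (hP : P.Regular)
    (hS : S.Valid P) (hest : est.Valid P S) [IsProbabilityMeasure μ] {r C : ℝ} (hC : 0 < C)
    (hbound : SurrogateErrorBound P S est r C) (hn : 0 < n) (hm : 0 < m) {ρ : ℝ} (hρ : P.τ < ρ)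
    (hα : ρ + P.τ ≤ α 0) (hmono : Monotone α) :
    ∑ t ∈ Finset.range (T + 1), weight P.τ (constSeq ρ) α t
        * (∫ ω, ‖z t ω - prox P.f P.X (1 / ρ) (z t ω)‖ ^ 2 ∂μ)
      ≤ errorSum P C r n m (constSeq ρ) α T := by
  have hτ := P.τ_nonneg
  have hρ0 : 0 < ρ := hτ.trans_lt hρ
  have hαt : ∀ t, ρ + P.τ ≤ α t := fun t => hα.trans (hmono (Nat.zero_le t))
  have hα0 : ∀ t, 0 < α t := fun t => by linarith [hαt t]
  have hne : P.X.Nonempty := ⟨z₀, h.start_mem⟩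
  have hm' : (0 : ℝ) < m := by exact_mod_cast hm
  have hn' : (0 : ℝ) < n := by exact_mod_cast hn
  have hX := hP.compact_X
  obtain ⟨x₀, hx₀, hmin⟩ := hX.exists_isMinOn hne (hP.continuousOn_f.mono hP.X_subset)
  set M : ℕ → ℝ := fun t => ∫ ω, P.envelope ρ (z t ω) ∂μ with hM
  set N : ℕ → ℝ := fun t => ∫ ω, ‖z t ω - prox P.f P.X (1 / ρ) (z t ω)‖ ^ 2 ∂μ with hN
  set E : ℕ → ℝ := fun t => 2 * P.L ^ 2 / (m * α t) + 4 * (C * (n : ℝ) ^ (-(r / 2))) with hE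
  -- This factor turns the descent coefficient `ρ / (α t + ρ - τ)` into `ρ / α t`, so that the
  -- averaging weights appear. It is nonincreasing because `α` is nondecreasing, and at most `2` at
  -- `t = 0`, whence `2 Δ₀`.
  set g : ℕ → ℝ := fun t => (α t + ρ - P.τ) / α t with hg
  have hg1 : ∀ t, g t = 1 + (ρ - P.τ) / α t := fun t => by
    have := (hα0 t).ne'
    simp only [hg]; field_simp; ring
  have hganti : Antitone g := fun s t hst => by
    rw [hg1, hg1]
    have := hα0 s
    have : 0 ≤ ρ - P.τ := by linarith
    gcongr
    exact hmono hst
  have hdesc : ∀ t ≤ T, ρ / α t * ((ρ - P.τ) * N t - E t) ≤ g t * (M t - M (t + 1)) := by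
    intro t ht
    have h1 := h.integral_envelope_succ_le hP hS hest hC hbound hn hm hρ (hαt t) ht
    have hβ : 0 < α t + ρ - P.τ := by linarith [hα0 t]
    have h2 : ρ / (α t + ρ - P.τ) * ((ρ - P.τ) * N t - E t) ≤ M t - M (t + 1) := by
      simp only [hM, hN, hE]; linarith
    have h3 := mul_le_mul_of_nonneg_left h2 (div_pos hβ (hα0 t)).le
    have h4 : (α t + ρ - P.τ) / α t * (ρ / (α t + ρ - P.τ) * ((ρ - P.τ) * N t - E t))
        = ρ / α t * ((ρ - P.τ) * N t - E t) := by
      have := (hα0 t).ne'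
      field_simp
    rwa [h4] at h3
  have hc := hP.continuous_envelope hne hρ
  obtain ⟨B, hB⟩ := hX.exists_bound_of_continuousOn hc.continuousOn
  have hlow : ∀ t ≤ T + 1, P.f x₀ ≤ M t := by
    intro t ht
    have hmeas : Measurable (z t) := by
      rcases Nat.lt_or_ge T t with h1 | h1
      · obtain rfl : t = T + 1 := by omega
        have h2 : z (T + 1) = fun ω => nextPt P est (α T) (z T ω) (D T ω) :=
          funext fun ω => h.iterate_succ hP hm (hα0 T) le_rfl ω
        rw [h2]
        exact hest.measurable_nextPt_comp hP hne hm (hα0 T) (h.measurable_iterate le_rfl)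
          (h.meas_samples T le_rfl)
      · exact h.measurable_iterate h1
    have hi : Integrable (fun ω => P.envelope ρ (z t ω)) μ :=
      Integrable.of_bound (hc.measurable.comp hmeas).aestronglyMeasurable B
        (ae_of_all _ fun ω => hB _ (h.mem ht ω))
    have h1 := integral_mono (integrable_const (P.f x₀)) hi fun ω => by
      have h2 := hmin (hP.prox_mem hne hρ (z t ω))
      have h3 : 0 ≤ ρ / 2 * ‖prox P.f P.X (1 / ρ) (z t ω) - z t ω‖ ^ 2 := by positivity
      simp only [Problem.envelope]
      exact (le_add_of_nonneg_right h3).trans' h2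
    simpa using h1
  have hup : M 0 ≤ P.f x₀ + P.Δ₀ := by
    have h1 : M 0 = P.envelope ρ z₀ := by simp [hM, h.start]
    rw [h1]
    have h2 := hP.envelope_le hρ z₀ h.start_mem
    have h3 := hP.sub_le_Δ₀ h.start_mem hx₀
    simp only [sub_self, norm_zero] at h2
    linarith
  have hg0 : 0 ≤ g (T + 1) := (div_pos (by linarith [hα0 (T + 1)]) (hα0 _)).le
  have hsum := (Finset.sum_le_sum fun t ht => hdesc t (by
    have := Finset.mem_range.1 ht; omega)).trans (sum_mul_sub_le hganti hg0 hlow hup)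
  have hΔ := hP.Δ₀_nonneg
  have hg2 : g 0 ≤ 2 := by
    have : (ρ - P.τ) / α 0 ≤ 1 := (div_le_one (hα0 0)).2 (by linarith)
    rw [hg1]; linarith
  have hw : ∀ t, weight P.τ (constSeq ρ) α t = ρ * (ρ - P.τ) / α t := fun t => by
    simp [weight, constSeq]
  -- The sampling term arises with the constant `2`; the stated `4` is slack. The learning term is
  -- exact.
  have hterm : ∀ t, ρ / α t * E t
      ≤ 4 * ρ * P.L ^ 2 / (m * α t ^ 2) + 4 * ρ * C / ((n : ℝ) ^ (r / 2) * α t) := fun t => by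
    have h0 := hα0 t
    have h1 : 0 ≤ 2 * ρ * P.L ^ 2 / (m * α t ^ 2) := by positivity
    have h2 : ρ / α t * E t
        = 2 * ρ * P.L ^ 2 / (m * α t ^ 2) + 4 * ρ * C / ((n : ℝ) ^ (r / 2) * α t) := by
      simp only [hE]
      rw [Real.rpow_neg hn'.le]
      field_simp
    have h3 : 4 * ρ * P.L ^ 2 / (m * α t ^ 2) = 2 * (2 * ρ * P.L ^ 2 / (m * α t ^ 2)) := by ring
    linarith
  have h5 := Finset.sum_le_sum fun t (_ : t ∈ Finset.range (T + 1)) => hterm t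
  have h6 : ∀ t, weight P.τ (constSeq ρ) α t * N t
      = ρ / α t * ((ρ - P.τ) * N t - E t) + ρ / α t * E t := fun t => by rw [hw]; ring
  have h7 : g 0 * P.Δ₀ ≤ 2 * P.Δ₀ := by gcongr
  rw [Finset.sum_congr rfl fun t _ => h6 t, Finset.sum_add_distrib, errorSum]
  rw [Finset.sum_add_distrib] at h5
  simp only [constSeq]
  linarith

end IsRun

end Run

/-! ### The output of the algorithm -/

lemma history_mono {d l n m : ℕ} {Ω : Type*} {D : ℕ → Ω → Dataset d l n × Dataset d l m}
    {s t : ℕ} (hst : s ≤ t) : history D s ≤ history D t :=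
  iSup₂_le fun k hk => le_iSup₂ (f := fun k (_ : k < t) => MeasurableSpace.comap (D k) inferInstance)
    k (hk.trans_le hst)

section Output

variable {d l n m : ℕ} {P : Problem d l} {S : Oracle d} {est : Estimators d l}
  {Ω : Type*} [MeasurableSpace Ω] {μ : Measure Ω}
  {D : ℕ → Ω → Dataset d l n × Dataset d l m} {z : ℕ → Ω → Vec d} {α : ℕ → ℝ} {T : ℕ} {z₀ : Vec d}
  {p : ℕ → ℝ} {tstar : Ω → ℕ}

namespace IsOutputIndex

lemma ae_le (h : IsOutputIndex μ D T p tstar) [IsProbabilityMeasure μ]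
    (hp0 : ∀ t ≤ T, 0 ≤ p t) (hp : ∑ t ∈ Finset.range (T + 1), p t = 1) :
    ∀ᵐ ω ∂μ, tstar ω ≤ T := by
  have hset : {ω | tstar ω ≤ T} = ⋃ t ∈ Finset.range (T + 1), tstar ⁻¹' {t} := by
    ext ω; simp
  have hmeas : MeasurableSet {ω | tstar ω ≤ T} := h.meas measurableSet_Iic
  rw [ae_iff_prob_eq_one (measurableSet_setOfPred.1 hmeas)]
  rw [hset, measure_biUnion_finset]
  · rw [Finset.sum_congr rfl fun t ht => h.dist t (Nat.lt_succ_iff.1 (Finset.mem_range.1 ht)),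
      ← ENNReal.ofReal_sum_of_nonneg fun t ht => hp0 t (Nat.lt_succ_iff.1 (Finset.mem_range.1 ht)),
      hp, ENNReal.ofReal_one]
  · intro s _ t _ hst
    exact Disjoint.preimage _ (by simpa using hst)
  · exact fun t _ => h.meas (measurableSet_singleton t)

/-- On each event that the index equals `t` the integrand is measurable with respect to the samples,
and independence factors the integral. -/
lemma lintegral_eq (h : IsOutputIndex μ D T p tstar) [IsProbabilityMeasure μ]
    (hle : history D (T + 1) ≤ ‹MeasurableSpace Ω›) (hT : ∀ᵐ ω ∂μ, tstar ω ≤ T)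
    {ψ : ℕ → Ω → ℝ≥0∞} (hψ : ∀ t ≤ T, Measurable[history D (T + 1)] (ψ t)) :
    ∫⁻ ω, ψ (tstar ω) ω ∂μ
      = ∑ t ∈ Finset.range (T + 1), ENNReal.ofReal (p t) * ∫⁻ ω, ψ t ω ∂μ := by
  have h1 : ∀ᵐ ω ∂μ, ψ (tstar ω) ω
      = ∑ t ∈ Finset.range (T + 1), ψ t ω * (tstar ⁻¹' {t}).indicator (fun _ => 1) ω := by
    filter_upwards [hT] with ω hω
    rw [Finset.sum_eq_single (tstar ω)]
    · simp
    · intro t _ ht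
      rw [indicator_of_notMem (by simpa using ht.symm), mul_zero]
    · intro hn
      exact absurd (Finset.mem_range.2 (Nat.lt_succ_of_le hω)) hn
  rw [lintegral_congr_ae h1, lintegral_finsetSum']
  · refine Finset.sum_congr rfl fun t ht => ?_
    have htT : t ≤ T := Nat.lt_succ_iff.1 (Finset.mem_range.1 ht)
    have hms : MeasurableSet (tstar ⁻¹' {t}) := h.meas (measurableSet_singleton t)
    have hind : IndepSets {s | MeasurableSet[history D (T + 1)] s} {tstar ⁻¹' {t}} μ := by
      refine (indepSets_of_indepSets_of_le_right (Indep_iff_IndepSets _ _ μ |>.1 h.indep.symm) ?_)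
      rintro _ rfl
      exact ⟨{t}, trivial, rfl⟩
    rw [lintegral_mul_indicator_eq_lintegral_mul_lintegral_indicator hle 1 hms hind (hψ t htT),
      lintegral_indicator hms, setLIntegral_const, one_mul, h.dist t htT, mul_comm]
  · intro t ht
    have htT : t ≤ T := Nat.lt_succ_iff.1 (Finset.mem_range.1 ht)
    exact (((hψ t htT).mono hle le_rfl).mul (measurable_const.indicator
      (h.meas (measurableSet_singleton t)))).aemeasurable

lemma aemeasurable_comp (h : IsOutputIndex μ D T p tstar) {E : Type*} [MeasurableSpace E]
    (hT : ∀ᵐ ω ∂μ, tstar ω ≤ T) {ψ : ℕ → Ω → E} (hψ : ∀ t ≤ T, Measurable (ψ t)) :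
    AEMeasurable (fun ω => ψ (tstar ω) ω) μ := by
  -- Truncation at `T` avoids the times at which no measurability is assumed; almost surely it
  -- changes nothing.
  have h1 : Measurable fun q : Ω × ℕ => ψ (min q.2 T) q.1 :=
    measurable_from_prod_countable_left fun t => hψ _ (min_le_right _ _)
  refine ⟨fun ω => ψ (min (tstar ω) T) ω, h1.comp (measurable_id.prodMk h.meas), ?_⟩
  filter_upwards [hT] with ω hω
  rw [min_eq_left hω]

end IsOutputIndex

lemma sum_polyak {τ : ℝ} {ρ α : ℕ → ℝ} (hw : ∀ t, 0 < weight τ ρ α t) (T : ℕ) :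
    ∑ t ∈ Finset.range (T + 1), polyak τ ρ α T t = 1 := by
  have h : 0 < ∑ t ∈ Finset.range (T + 1), weight τ ρ α t :=
    Finset.sum_pos (fun t _ => hw t) ⟨0, by simp⟩
  simp_rw [polyak]
  rw [← Finset.sum_div, div_self h.ne']

/-- Averaging over the independent index turns the weighted sum of expected squared distances into
one expectation. -/
lemma IsRun.output_le (h : IsRun P S est n m α T z₀ μ D z) (hP : P.Regular)
    (hS : S.Valid P) (hest : est.Valid P S) [IsProbabilityMeasure μ] {r C : ℝ} (hC : 0 < C)
    (hbound : SurrogateErrorBound P S est r C) (hn : 0 < n) (hm : 0 < m) {ρ : ℝ} (hρ : P.τ < ρ)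
    (hα : ρ + P.τ ≤ α 0) (hmono : Monotone α)
    (ht : IsOutputIndex μ D T (polyak P.τ (constSeq ρ) α T) tstar) :
    (∀ᵐ ω ∂μ, tstar ω ≤ T) ∧ AEMeasurable (fun ω => z (tstar ω) ω) μ ∧
    Integrable (fun ω => ‖z (tstar ω) ω - prox P.f P.X (1 / ρ) (z (tstar ω) ω)‖ ^ 2) μ ∧
    ∫ ω, ‖z (tstar ω) ω - prox P.f P.X (1 / ρ) (z (tstar ω) ω)‖ ^ 2 ∂μ
      ≤ guarantee P C r n m (constSeq ρ) α T := by
  have hne : P.X.Nonempty := ⟨z₀, h.start_mem⟩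
  have hρ0 : 0 < ρ := P.τ_nonneg.trans_lt hρ
  have hα0 : ∀ t, 0 < α t := fun t => by
    linarith [P.τ_nonneg, hα.trans (hmono (Nat.zero_le t))]
  have hw : ∀ t, 0 < weight P.τ (constSeq ρ) α t := fun t => by
    have h1 : weight P.τ (constSeq ρ) α t = ρ * (ρ - P.τ) / α t := by simp [weight, constSeq]
    rw [h1]
    exact div_pos (mul_pos hρ0 (sub_pos.2 hρ)) (hα0 t)
  have hW : 0 < ∑ t ∈ Finset.range (T + 1), weight P.τ (constSeq ρ) α t :=
    Finset.sum_pos (fun t _ => hw t) ⟨0, by simp⟩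
  have hp0 : ∀ t, 0 ≤ polyak P.τ (constSeq ρ) α T t := fun t => (div_pos (hw t) hW).le
  have hT := ht.ae_le (fun t _ => hp0 t) (sum_polyak hw T)
  have hzm := ht.aemeasurable_comp hT fun t htT => h.measurable_iterate htT
  have hp := hP.continuous_prox hne hρ
  set N : Vec d → ℝ := fun x => ‖x - prox P.f P.X (1 / ρ) x‖ ^ 2 with hN
  have hNc : Continuous N := by fun_prop
  have hN0 : ∀ x, 0 ≤ N x := fun x => sq_nonneg _
  obtain ⟨B, hB⟩ := hP.compact_X.exists_bound_of_continuousOn hNc.continuousOn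
  have hNi : ∀ t ≤ T, Integrable (fun ω => N (z t ω)) μ := fun t htT =>
    Integrable.of_bound (hNc.measurable.comp (h.measurable_iterate htT)).aestronglyMeasurable B
      (ae_of_all _ fun ω => hB _ (h.mem (by omega) ω))
  refine ⟨hT, hzm, Integrable.of_bound
    (hNc.measurable.comp_aemeasurable hzm).aestronglyMeasurable B ?_, ?_⟩
  · filter_upwards [hT] with ω hω
    exact hB _ (h.mem (by omega) ω)
  have h1 := ht.lintegral_eq (h.history_le le_rfl) hT
    (ψ := fun t ω => ENNReal.ofReal (N (z t ω))) fun t htT =>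
    (ENNReal.measurable_ofReal.comp hNc.measurable).comp
      ((h.meas_iterate t htT).mono (history_mono (by omega)) le_rfl)
  have h2 : ∑ t ∈ Finset.range (T + 1), ENNReal.ofReal (polyak P.τ (constSeq ρ) α T t)
        * ∫⁻ ω, ENNReal.ofReal (N (z t ω)) ∂μ
      = ENNReal.ofReal (∑ t ∈ Finset.range (T + 1), polyak P.τ (constSeq ρ) α T t
          * ∫ ω, N (z t ω) ∂μ) := by
    rw [ENNReal.ofReal_sum_of_nonneg fun t _ =>
      mul_nonneg (hp0 t) (integral_nonneg fun ω => hN0 _)]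
    refine Finset.sum_congr rfl fun t htT => ?_
    rw [ENNReal.ofReal_mul (hp0 t), ofReal_integral_eq_lintegral_ofReal
      (hNi t (Nat.lt_succ_iff.1 (Finset.mem_range.1 htT))) (ae_of_all _ fun ω => hN0 _)]
  rw [integral_eq_lintegral_of_nonneg_ae (ae_of_all _ fun ω => hN0 _)
    (hNc.measurable.comp_aemeasurable hzm).aestronglyMeasurable, h1, h2, ENNReal.toReal_ofReal
    (Finset.sum_nonneg fun t _ => mul_nonneg (hp0 t) (integral_nonneg fun ω => hN0 _)), guarantee]
  simp_rw [polyak, div_mul_eq_mul_div]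
  rw [← Finset.sum_div]
  gcongr
  exact h.sum_weight_mul_le hP hS hest hC hbound hn hm hρ hα hmono

lemma lintegral_enorm_le_of_integral_sq_le [IsProbabilityMeasure μ] {F : Type*}
    [NormedAddCommGroup F] [MeasurableSpace F] [OpensMeasurableSpace F] {g : Ω → F}
    (hg : AEMeasurable g μ) (hi : Integrable (fun ω => ‖g ω‖ ^ 2) μ) {a : ℝ} (ha : 0 ≤ a)
    (h : ∫ ω, ‖g ω‖ ^ 2 ∂μ ≤ a ^ 2) : ∫⁻ ω, ‖g ω‖ₑ ∂μ ≤ ENNReal.ofReal a := by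
  refine lintegral_le_ofReal_of_sq_le hg.enorm ha ?_
  refine le_trans (le_of_eq ?_) (ENNReal.ofReal_le_ofReal h)
  rw [ofReal_integral_eq_lintegral_ofReal hi (ae_of_all _ fun ω => by positivity)]
  refine lintegral_congr fun ω => ?_
  rw [ENNReal.ofReal_pow (norm_nonneg _), ofReal_norm]

/-- The witness is the proximal point of `x`. Jensen's inequality passes from second to first
moments, both for the distance and for its multiple by `ρ`, which bounds the stationarity measure.
-/
lemma Problem.Regular.isNSE_of_integral_le (hP : P.Regular) [IsProbabilityMeasure μ]
    (hne : P.X.Nonempty) {ρ ν δ : ℝ} (hρ : P.τ < ρ) (hν : 0 ≤ ν) (hδ : 0 ≤ δ) {x : Ω → Vec d}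
    (hx : AEMeasurable x μ) (hX : ∀ᵐ ω ∂μ, x ω ∈ P.X)
    (hi : Integrable (fun ω => ‖x ω - prox P.f P.X (1 / ρ) (x ω)‖ ^ 2) μ)
    (h1 : ∫ ω, ‖x ω - prox P.f P.X (1 / ρ) (x ω)‖ ^ 2 ∂μ ≤ δ ^ 2)
    (h2 : ρ ^ 2 * ∫ ω, ‖x ω - prox P.f P.X (1 / ρ) (x ω)‖ ^ 2 ∂μ ≤ ν ^ 2) :
    IsNSE μ P.f P.X ν δ x := by
  have hp := hP.continuous_prox hne hρ
  have hy : AEMeasurable (fun ω => prox P.f P.X (1 / ρ) (x ω)) μ := hp.measurable.comp_aemeasurable hx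
  refine ⟨hX, fun ω => prox P.f P.X (1 / ρ) (x ω), hy, ae_of_all _ fun ω => hP.prox_mem hne hρ _,
    lintegral_enorm_le_of_integral_sq_le (hx.sub hy) hi hδ h1, ?_⟩
  refine (lintegral_mono fun ω => hP.infEDist_prox_le hne hρ (x ω)).trans ?_
  have h3 : ∀ ω, ‖ρ • (x ω - prox P.f P.X (1 / ρ) (x ω))‖ ^ 2
      = ρ ^ 2 * ‖x ω - prox P.f P.X (1 / ρ) (x ω)‖ ^ 2 := fun ω => by
    rw [norm_smul, mul_pow, Real.norm_eq_abs, sq_abs]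
  refine lintegral_enorm_le_of_integral_sq_le
    (g := fun ω => ρ • (x ω - prox P.f P.X (1 / ρ) (x ω))) ((hx.sub hy).const_smul ρ) ?_ hν ?_
  · simp_rw [h3]; exact hi.const_mul _
  · simp_rw [h3]; rwa [integral_const_mul]

end Output

/-! ### Existence of a surrogate error bound -/

section MatOp

variable {d l : ℕ}

lemma matOp_eq_sum (A : Matrix (Fin l) (Fin l) ℝ) :
    matOp A = ∑ i, ∑ j, A i j • matOp (Matrix.single i j 1) := by
  conv_lhs => rw [Matrix.matrix_eq_sum_single A]
  simp only [matOp, map_sum]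
  refine Finset.sum_congr rfl fun i _ => Finset.sum_congr rfl fun j _ => ?_
  rw [← map_smul, Matrix.smul_single, smul_eq_mul, mul_one]

lemma matOp_sub (A B : Matrix (Fin l) (Fin l) ℝ) : matOp (A - B) = matOp A - matOp B := by
  simp only [matOp, map_sub]

lemma continuous_matOp : Continuous (matOp : Matrix (Fin l) (Fin l) ℝ → Vec l →L[ℝ] Vec l) := by
  have h : (matOp : Matrix (Fin l) (Fin l) ℝ → Vec l →L[ℝ] Vec l)
      = fun A => ∑ i, ∑ j, A i j • matOp (Matrix.single i j 1) := funext matOp_eq_sum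
  rw [h]
  exact continuous_finsetSum _ fun i _ => continuous_finsetSum _ fun j _ =>
    (continuous_id.matrix_elem i j).smul continuous_const

lemma measurable_matOp {Ω : Type*} [MeasurableSpace Ω] {A : Ω → Matrix (Fin l) (Fin l) ℝ}
    (hA : ∀ i j, Measurable fun ω => A ω i j) : Measurable fun ω => matOp (A ω) := by
  simp_rw [fun ω => matOp_eq_sum (A ω)]
  exact Finset.measurable_fun_sum _ fun i _ => Finset.measurable_fun_sum _ fun j _ =>
    (hA i j).smul_const _

lemma gradRows_sub_left (dq dq' : Fin l → Vec d →L[ℝ] Vec l) (e : Vec l) (v : Vec d) :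
    gradRows (fun j => dq j - dq' j) e v = gradRows dq e v - gradRows dq' e v := by
  rw [gradRows_eq, gradRows_eq, gradRows_eq, ← rowsMul_sub]
  rfl

lemma gradRows_vec_sub (dq : Fin l → Vec d →L[ℝ] Vec l) (e e' : Vec l) (v : Vec d) :
    gradRows dq (e - e') v = gradRows dq e v - gradRows dq e' v := by
  rw [gradRows_eq, gradRows_eq, gradRows_eq, rowsMul_vec_sub]

/-- The estimated coefficients stay with the empirical residual `e'` and the true ones with `e' -
e`; so the first-order errors separate from those that multiply a possibly large residual. -/
lemma norm_linArg_sub_le (c₁ c₀ : Vec l) (dc₁ dc₀ : Vec d →L[ℝ] Vec l) (q₁ q₀ : Fin l → Vec l)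
    (dq₁ dq₀ : Fin l → Vec d →L[ℝ] Vec l) (z : Vec d) (e' e : Vec l) (x : Vec d) :
    ‖linArg c₁ dc₁ q₁ dq₁ z e' x - linArg c₀ dc₀ q₀ dq₀ z e x‖
      ≤ ‖c₁ - c₀‖ + ‖dc₁ - dc₀‖ * ‖x - z‖ + ‖matOp (rowMatrix q₁ - rowMatrix q₀)‖ * ‖e'‖
        + ‖matOp (rowMatrix q₀)‖ * ‖e' - e‖
        + (Real.sqrt (∑ j, ‖dq₁ j - dq₀ j‖ ^ 2) * ‖e'‖
          + Real.sqrt (∑ j, ‖dq₀ j‖ ^ 2) * ‖e' - e‖) * ‖x - z‖ := by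
  have h : linArg c₁ dc₁ q₁ dq₁ z e' x - linArg c₀ dc₀ q₀ dq₀ z e x
      = (c₁ - c₀) + (dc₁ - dc₀) (x - z) + matOp (rowMatrix q₁ - rowMatrix q₀) e'
        + matOp (rowMatrix q₀) (e' - e)
        + (gradRows (fun j => dq₁ j - dq₀ j) e' (x - z) + gradRows dq₀ (e' - e) (x - z)) := by
    rw [linArg, linArg, gradRows_sub_left, gradRows_vec_sub, matOp_sub,
      map_sub (matOp (rowMatrix q₀)), _root_.sub_apply, _root_.sub_apply]
    abel
  rw [h]
  have h1 := (dc₁ - dc₀).le_opNorm (x - z)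
  have h2 := (matOp (rowMatrix q₁ - rowMatrix q₀)).le_opNorm e'
  have h3 := (matOp (rowMatrix q₀)).le_opNorm (e' - e)
  have h4 := norm_gradRows_le (fun j => dq₁ j - dq₀ j) e' (x - z)
  have h5 := norm_gradRows_le dq₀ (e' - e) (x - z)
  rw [add_mul]
  refine (norm_add_le _ _).trans (add_le_add ((norm_add_le _ _).trans (add_le_add
    ((norm_add_le _ _).trans (add_le_add ((norm_add_le _ _).trans (add_le_add le_rfl h1)) h2)) h3))
    ((norm_add_le _ _).trans (add_le_add h4 h5)))

/-- A combination of small quantities and of products of two of them is bounded by the sum of their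
squares, up to a small constant. -/
lemma combination_le {a₁ a₂ a₃ a₄ a₅ a₆ h ε D B V W k k' : ℝ} (h₃ : 0 ≤ a₃) (h₄ : 0 ≤ a₄) (hε : 0 < ε)
    (hε1 : ε ≤ 1) (hD : 0 ≤ D) (hB : 0 ≤ B) (hV : 0 ≤ V) (hW : 0 ≤ W) (hk : 0 ≤ k) (hk' : 0 ≤ k')
    (hh : h ≤ V * a₅ + W * a₆) :
    a₁ + a₂ * D + a₃ * (B + h) + k * h + (a₄ * (B + h) + k' * h) * D
      ≤ (1 + D + (B + (V + W)) + k * (V + W) + ((B + (V + W)) + k' * (V + W)) * D)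
        * (ε + (a₁ ^ 2 + a₂ ^ 2 + a₃ ^ 2 + a₄ ^ 2 + a₅ ^ 2 + a₆ ^ 2) / ε) := by
  set σ := a₁ ^ 2 + a₂ ^ 2 + a₃ ^ 2 + a₄ ^ 2 + a₅ ^ 2 + a₆ ^ 2 with hσ
  set M := ε + σ / ε with hM
  have hσ0 : 0 ≤ σ := by positivity
  have hσM : σ ≤ M := by
    have : σ ≤ σ / ε := (le_div_iff₀ hε).2 (by nlinarith)
    linarith
  have hM0 : 0 ≤ M := hσ0.trans hσM
  -- Linear terms by Young's inequality `a ≤ ε + a² / ε`; products of two errors are below `σ`,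
  -- hence below `σ / ε` because `ε ≤ 1`.
  have lin : ∀ a : ℝ, a ^ 2 ≤ σ → a ≤ M := fun a ha => by
    have h1 : a ^ 2 / ε ≤ σ / ε := by gcongr
    have h2 : a ≤ ε + a ^ 2 / ε := by
      rw [← sub_le_iff_le_add', le_div_iff₀ hε]
      nlinarith [sq_nonneg (a - ε), sq_nonneg a, sq_nonneg ε]
    linarith
  have p₁ := sq_nonneg a₁
  have p₂ := sq_nonneg a₂
  have p₃ := sq_nonneg a₃
  have p₄ := sq_nonneg a₄
  have p₅ := sq_nonneg a₅
  have p₆ := sq_nonneg a₆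
  have q₁ := lin a₁ (by linarith)
  have q₂ := lin a₂ (by linarith)
  have q₃ := lin a₃ (by linarith)
  have q₄ := lin a₄ (by linarith)
  have q₅ := lin a₅ (by linarith)
  have q₆ := lin a₆ (by linarith)
  have hhM : h ≤ (V + W) * M := by
    have := mul_le_mul_of_nonneg_left q₅ hV
    have := mul_le_mul_of_nonneg_left q₆ hW
    linarith
  have prod : ∀ a : ℝ, 0 ≤ a → a ^ 2 + a₅ ^ 2 ≤ σ → a ^ 2 + a₆ ^ 2 ≤ σ →
      a * h ≤ (V + W) * M := fun a ha k₅ k₆ => by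
    have s₅ : a * a₅ ≤ M := by nlinarith [sq_nonneg (a - a₅)]
    have s₆ : a * a₆ ≤ M := by nlinarith [sq_nonneg (a - a₆)]
    have := mul_le_mul_of_nonneg_left hh ha
    have := mul_le_mul_of_nonneg_left s₅ hV
    have := mul_le_mul_of_nonneg_left s₆ hW
    linarith
  have r₃ := prod a₃ h₃ (by linarith) (by linarith)
  have r₄ := prod a₄ h₄ (by linarith) (by linarith)
  have t₂ := mul_le_mul_of_nonneg_right q₂ hD
  have t₃ := mul_le_mul_of_nonneg_right q₃ hB
  have tk := mul_le_mul_of_nonneg_left hhM hk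
  have t₄ : (a₄ * (B + h) + k' * h) * D ≤ (((B + (V + W)) + k' * (V + W)) * M) * D := by
    refine mul_le_mul_of_nonneg_right ?_ hD
    have := mul_le_mul_of_nonneg_right q₄ hB
    have := mul_le_mul_of_nonneg_left hhM hk'
    linarith
  linarith

end MatOp

namespace Problem

variable {d l : ℕ} {P : Problem d l}

lemma Regular.continuousOn_Q (hP : P.Regular) : ContinuousOn P.Q P.O :=
  continuousOn_pi.2 fun i => continuousOn_pi.2 fun j =>
    (by fun_prop : Continuous fun v : Vec l => v j).comp_continuousOn (hP.smooth_q i).continuousOn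

/-- Positive definiteness keeps the determinant away from zero pointwise; compactness of `X` later
turns continuity into a uniform bound. -/
lemma Regular.continuousOn_Q_inv (hP : P.Regular) : ContinuousOn (fun x => (P.Q x)⁻¹) P.O := by
  have h1 : ContinuousOn (fun x => (P.Q x).det) P.O :=
    continuous_id.matrix_det.comp_continuousOn hP.continuousOn_Q
  have h2 : ContinuousOn (fun x => (P.Q x).adjugate) P.O :=
    continuous_id.matrix_adjugate.comp_continuousOn hP.continuousOn_Q
  refine ((h1.inv₀ fun x hx => (hP.posDef_Q x hx).det_pos.ne').smul h2).congr fun x _ => ?_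
  simp only [Matrix.inv_def, Ring.inverse_eq_inv']
  rfl

/-- Uniform bounds on `X` for the data of the problem. -/
lemma Regular.exists_bounds (hP : P.Regular) : ∃ k : ℝ, 0 ≤ k ∧ ∀ x ∈ P.X,
    ‖P.c x‖ ≤ k ∧ ‖matOp (P.Q x)‖ ≤ k ∧ ‖matOp (P.Q x)⁻¹‖ ≤ k ∧
      Real.sqrt (∑ j, ‖fderiv ℝ (P.q j) x‖ ^ 2) ≤ k ∧ ∀ y ∈ P.X, ‖y - x‖ ≤ k := by
  have hdq := fun j => (hP.lipschitz_dq j).continuousOn.mono hP.X_subset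
  obtain ⟨k₁, h₁⟩ := hP.compact_X.exists_bound_of_continuousOn
    (hP.smooth_c.continuousOn.mono hP.X_subset)
  obtain ⟨k₂, h₂⟩ := hP.compact_X.exists_bound_of_continuousOn
    (continuous_matOp.comp_continuousOn (hP.continuousOn_Q.mono hP.X_subset))
  obtain ⟨k₃, h₃⟩ := hP.compact_X.exists_bound_of_continuousOn
    (continuous_matOp.comp_continuousOn (hP.continuousOn_Q_inv.mono hP.X_subset))
  obtain ⟨k₄, h₄⟩ := hP.compact_X.exists_bound_of_continuousOn
    (f := fun x => Real.sqrt (∑ j, ‖fderiv ℝ (P.q j) x‖ ^ 2)) (by fun_prop)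
  obtain ⟨k₅, h₅⟩ := Metric.isBounded_iff.1 hP.compact_X.isBounded
  have e₁ := le_abs_self k₁
  have e₂ := le_abs_self k₂
  have e₃ := le_abs_self k₃
  have e₄ := le_abs_self k₄
  have e₅ := le_abs_self k₅
  have n₁ := abs_nonneg k₁
  have n₂ := abs_nonneg k₂
  have n₃ := abs_nonneg k₃
  have n₄ := abs_nonneg k₄
  have n₅ := abs_nonneg k₅
  refine ⟨|k₁| + |k₂| + |k₃| + |k₄| + |k₅|, by positivity, fun x hx => ⟨?_, ?_, ?_, ?_, ?_⟩⟩
  · linarith [h₁ x hx]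
  · have := h₂ x hx
    simp only [Function.comp] at this
    linarith
  · have := h₃ x hx
    simp only [Function.comp] at this
    linarith
  · linarith [h₄ x hx, Real.le_norm_self (Real.sqrt (∑ j, ‖fderiv ℝ (P.q j) x‖ ^ 2))]
  · intro y hy
    have := h₅ hy hx
    rw [dist_eq_norm] at this
    linarith

end Problem

section Rate

variable {d l n m : ℕ} {P : Problem d l} {S : Oracle d} {est : Estimators d l}

/-- The sum of the squared errors of the estimates at `z` and of those at `y` that enter the
residuals. -/
def sqError (P : Problem d l) (est : Estimators d l) (z y : Vec d) (s : Dataset d l n) : ℝ :=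
  ‖est.c n s z - P.c z‖ ^ 2 + ‖est.dc n s z - fderiv ℝ P.c z‖ ^ 2
    + ‖matOp (est.Q n s z - P.Q z)‖ ^ 2
    + (Real.sqrt (∑ j, ‖est.dq n s j z - fderiv ℝ (P.q j) z‖ ^ 2)) ^ 2
    + ‖matOp ((est.Q n s y)⁻¹ - (P.Q y)⁻¹)‖ ^ 2 + ‖est.c n s y - P.c y‖ ^ 2

/-- The error of the inverse acts on the estimated deviation, and the true inverse acts on the error
of `c`. Thus the residual error is linear in the estimation errors once `w.2 - est.c n s w.1` is
bounded. -/
lemma norm_empResid_sub_le (s : Dataset d l n) (w : Vec d × Vec l) :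
    ‖empResid est s w - trueResid P w‖
      ≤ ‖w.2 - est.c n s w.1‖ * ‖matOp ((est.Q n s w.1)⁻¹ - (P.Q w.1)⁻¹)‖
        + ‖matOp (P.Q w.1)⁻¹‖ * ‖est.c n s w.1 - P.c w.1‖ := by
  have h : empResid est s w - trueResid P w
      = matOp ((est.Q n s w.1)⁻¹ - (P.Q w.1)⁻¹) (w.2 - est.c n s w.1)
        + matOp (P.Q w.1)⁻¹ (P.c w.1 - est.c n s w.1) := by
    rw [empResid, trueResid, matOp_sub, _root_.sub_apply,
      show P.c w.1 - est.c n s w.1 = (w.2 - est.c n s w.1) - (w.2 - P.c w.1) by abel,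
      map_sub (matOp (P.Q w.1)⁻¹) (w.2 - est.c n s w.1) (w.2 - P.c w.1)]
    abel
  rw [h, norm_sub_rev (est.c n s w.1) (P.c w.1), mul_comm ‖w.2 - est.c n s w.1‖]
  exact (norm_add_le _ _).trans (add_le_add (ContinuousLinearMap.le_opNorm _ _)
    (ContinuousLinearMap.le_opNorm _ _))

lemma ofReal_norm_sq {F : Type*} [NormedAddCommGroup F] (v : F) :
    ENNReal.ofReal (‖v‖ ^ 2) = ‖v‖ₑ ^ 2 := by
  rw [ENNReal.ofReal_pow (norm_nonneg _), ofReal_norm]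

/-- Five single errors and `ℓ` row Jacobians. Equality of the data laws lets the rate at `y` be used
for data drawn at reference point `z`. -/
lemma Estimators.MSERate.lintegral_sqError_le {C r : ℝ} (hrate : est.MSERate P S C r)
    (hest : est.Valid P S) (hC : 0 < C) (hn : 0 < n) {z y : Vec d} (hz : z ∈ P.X) (hy : y ∈ P.X)
    (hyz : S.dataLaw P n y = S.dataLaw P n z) :
    ∫⁻ s, ENNReal.ofReal (sqError P est z y s) ∂S.dataLaw P n z ≤
      ENNReal.ofReal ((5 + l) * (C * (n : ℝ) ^ (-r))) := by
  have hpair : ∀ x : Vec d, Measurable fun s : Dataset d l n => (s, x) := fun x => by fun_prop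
  have hc : ∀ x, Measurable fun s => est.c n s x := fun x => (hest.meas_c n).comp (hpair x)
  have hdc : Measurable fun s => est.dc n s z := (hest.meas_dc n).comp (hpair z)
  have hq : ∀ x j, Measurable fun s => est.q n s j x := fun x j =>
    (hest.meas_q n j).comp (hpair x)
  have hdq : ∀ j, Measurable fun s => est.dq n s j z := fun j => (hest.meas_dq n j).comp (hpair z)
  have hQ : ∀ x i j, Measurable fun s => est.Q n s x i j := fun x =>
    measurable_rowMatrix (hq x)
  have m₁ := ((hc z).sub_const (P.c z)).enorm.pow_const 2
  have m₂ := (hdc.sub_const (fderiv ℝ P.c z)).enorm.pow_const 2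
  have m₃ : Measurable fun s => ‖matOp (est.Q n s z - P.Q z)‖ₑ ^ 2 :=
    (measurable_matOp fun i j => (hQ z i j).sub_const _).enorm.pow_const 2
  have m₄ : ∀ j, Measurable fun s => ‖est.dq n s j z - fderiv ℝ (P.q j) z‖ₑ ^ 2 := fun j =>
    ((hdq j).sub_const _).enorm.pow_const 2
  have m₅ : Measurable fun s => ‖matOp ((est.Q n s y)⁻¹ - (P.Q y)⁻¹)‖ₑ ^ 2 :=
    (measurable_matOp fun i j =>
      (measurable_matrix_inv (hQ y) i j).sub_const _).enorm.pow_const 2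
  have h : ∀ s, ENNReal.ofReal (sqError P est z y s)
      = ‖est.c n s z - P.c z‖ₑ ^ 2 + ‖est.dc n s z - fderiv ℝ P.c z‖ₑ ^ 2
        + ‖matOp (est.Q n s z - P.Q z)‖ₑ ^ 2
        + (∑ j, ‖est.dq n s j z - fderiv ℝ (P.q j) z‖ₑ ^ 2)
        + ‖matOp ((est.Q n s y)⁻¹ - (P.Q y)⁻¹)‖ₑ ^ 2 + ‖est.c n s y - P.c y‖ₑ ^ 2 := fun s => by
    rw [sqError, Real.sq_sqrt (by positivity)]
    rw [ENNReal.ofReal_add (by positivity) (by positivity),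
      ENNReal.ofReal_add (by positivity) (by positivity),
      ENNReal.ofReal_add (by positivity) (by positivity),
      ENNReal.ofReal_add (by positivity) (by positivity),
      ENNReal.ofReal_add (by positivity) (by positivity),
      ENNReal.ofReal_sum_of_nonneg fun j _ => by positivity]
    simp only [ofReal_norm_sq]
  have hCn : 0 ≤ C * (n : ℝ) ^ (-r) := by positivity
  simp_rw [h]
  have s₂ : Measurable fun s => ‖est.c n s z - P.c z‖ₑ ^ 2 + ‖est.dc n s z - fderiv ℝ P.c z‖ₑ ^ 2 :=
    m₁.add m₂
  have s₃ : Measurable fun s => ‖est.c n s z - P.c z‖ₑ ^ 2 + ‖est.dc n s z - fderiv ℝ P.c z‖ₑ ^ 2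
      + ‖matOp (est.Q n s z - P.Q z)‖ₑ ^ 2 := s₂.add m₃
  have s₄ : Measurable fun s => ‖est.c n s z - P.c z‖ₑ ^ 2 + ‖est.dc n s z - fderiv ℝ P.c z‖ₑ ^ 2
      + ‖matOp (est.Q n s z - P.Q z)‖ₑ ^ 2
      + ∑ j, ‖est.dq n s j z - fderiv ℝ (P.q j) z‖ₑ ^ 2 :=
    s₃.add (Finset.measurable_fun_sum _ fun j _ => m₄ j)
  have s₅ : Measurable fun s => ‖est.c n s z - P.c z‖ₑ ^ 2 + ‖est.dc n s z - fderiv ℝ P.c z‖ₑ ^ 2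
      + ‖matOp (est.Q n s z - P.Q z)‖ₑ ^ 2
      + (∑ j, ‖est.dq n s j z - fderiv ℝ (P.q j) z‖ₑ ^ 2)
      + ‖matOp ((est.Q n s y)⁻¹ - (P.Q y)⁻¹)‖ₑ ^ 2 := s₄.add m₅
  rw [lintegral_add_left s₅, lintegral_add_left s₄, lintegral_add_left s₃, lintegral_add_left s₂,
    lintegral_add_left m₁, lintegral_finsetSum _ fun j _ => m₄ j]
  have h₅ := hrate.Qinv n hn y hy
  have h₆ := hrate.c n hn y hy
  rw [hyz] at h₅ h₆
  refine (add_le_add (add_le_add (add_le_add (add_le_add (add_le_add (hrate.c n hn z hz)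
    (hrate.dc n hn z hz)) (hrate.Q n hn z hz))
    (Finset.sum_le_sum fun j _ => hrate.dq n hn j z hz)) h₅) h₆).trans (le_of_eq ?_)
  rw [Finset.sum_const, Finset.card_univ, Fintype.card_fin, nsmul_eq_mul,
    ← ENNReal.ofReal_natCast l, ← ENNReal.ofReal_mul (by positivity),
    ← ENNReal.ofReal_add (by positivity) (by positivity),
    ← ENNReal.ofReal_add (by positivity) (by positivity),
    ← ENNReal.ofReal_add (by positivity) (by positivity),
    ← ENNReal.ofReal_add (by positivity) (by positivity),
    ← ENNReal.ofReal_add (by positivity) (by positivity)]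
  congr 1
  ring

/-- The factor in the bound on the surrogate error by the squared errors of the estimates. -/
def gapFactor (P : Problem d l) (k B V : ℝ) : ℝ :=
  P.Lφ * (1 + k + (B + (V + k)) + k * (V + k) + ((B + (V + k)) + k * (V + k)) * k)

/-- Bounds on the noise, on the estimate of `c` and on the true data over `X` turn all other factors
into constants, so the error has the shape treated by `combination_le`. -/
lemma Problem.Regular.surrogateGap_le (hP : P.Regular) {k B B' ε : ℝ} (hB : 0 ≤ B) (hB' : 0 ≤ B')
    (hk : 0 ≤ k) (hbd : ∀ x ∈ P.X, ‖P.c x‖ ≤ k ∧ ‖matOp (P.Q x)‖ ≤ k ∧ ‖matOp (P.Q x)⁻¹‖ ≤ k ∧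
      Real.sqrt (∑ j, ‖fderiv ℝ (P.q j) x‖ ^ 2) ≤ k ∧ ∀ y ∈ P.X, ‖y - x‖ ≤ k)
    {z y : Vec d} (hz : z ∈ P.X) (hy : y ∈ P.X) {e : Vec l} (he : ‖e‖ ≤ B) {s : Dataset d l n}
    (hs : ‖est.c n s y‖ ≤ B') (hε : 0 < ε) (hε1 : ε ≤ 1) :
    surrogateGap P est z (s, P.obsMap (y, e))
      ≤ ENNReal.ofReal (gapFactor P k B (k + k * B + B') * (ε + sqError P est z y s / ε)) := by
  obtain ⟨-, hQz, -, hdqz, hD⟩ := hbd z hz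
  obtain ⟨hcy, hQy, hQiy, -, -⟩ := hbd y hy
  refine iSup₂_le fun x hx => ?_
  rw [← ofReal_norm, Real.norm_eq_abs]
  apply ENNReal.ofReal_le_ofReal
  have hres : trueResid P (P.obsMap (y, e)) = e := hP.trueResid_obsMap (hP.X_subset hy)
  set e' := empResid est s (P.obsMap (y, e)) with he'
  have hη : ‖(P.obsMap (y, e)).2 - est.c n s y‖ ≤ k + k * B + B' := by
    refine (norm_sub_le _ _).trans (add_le_add ((norm_add_le _ _).trans (add_le_add hcy ?_)) hs)
    exact ((matOp (P.Q y)).le_opNorm e).trans (by gcongr)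
  have hh : ‖e' - e‖ ≤ (k + k * B + B') * ‖matOp ((est.Q n s y)⁻¹ - (P.Q y)⁻¹)‖
      + k * ‖est.c n s y - P.c y‖ := by
    have h1 := norm_empResid_sub_le (P := P) (est := est) s (P.obsMap (y, e))
    rw [hres] at h1
    refine h1.trans ?_
    change ‖(P.obsMap (y, e)).2 - est.c n s y‖ * ‖matOp ((est.Q n s y)⁻¹ - (P.Q y)⁻¹)‖
        + ‖matOp (P.Q y)⁻¹‖ * ‖est.c n s y - P.c y‖ ≤ _
    gcongr
  have he'B : ‖e'‖ ≤ B + ‖e' - e‖ := by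
    have := norm_add_le e (e' - e)
    rw [add_sub_cancel] at this
    linarith
  rw [hres]
  refine (hP.abs_cost_sub_le (hP.X_subset hx) (hP.X_subset hx) _ _).trans ?_
  rw [sub_self, norm_zero, zero_add, gapFactor, mul_assoc]
  refine mul_le_mul_of_nonneg_left ?_ P.Lφ.coe_nonneg
  refine le_trans ?_ (combination_le (norm_nonneg (matOp (est.Q n s z - P.Q z)))
    (Real.sqrt_nonneg (∑ j, ‖est.dq n s j z - fderiv ℝ (P.q j) z‖ ^ 2))
    hε hε1 hk hB (by positivity) hk hk hk hh)
  refine (norm_linArg_sub_le _ _ _ _ _ _ _ _ z e' e x).trans ?_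
  have hxz := hD x hx
  change ‖est.c n s z - P.c z‖ + ‖est.dc n s z - fderiv ℝ P.c z‖ * ‖x - z‖
    + ‖matOp (est.Q n s z - P.Q z)‖ * ‖e'‖ + ‖matOp (P.Q z)‖ * ‖e' - e‖
    + (Real.sqrt (∑ j, ‖est.dq n s j z - fderiv ℝ (P.q j) z‖ ^ 2) * ‖e'‖
      + Real.sqrt (∑ j, ‖fderiv ℝ (P.q j) z‖ ^ 2) * ‖e' - e‖) * ‖x - z‖ ≤ _
  gcongr

/-- Residuals need estimates at `y`, computed from data drawn at `z`. The two oracles permit this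
for opposite reasons: the static data law ignores the reference point, and the adaptive residuals
are sampled at `z` itself. -/
lemma Oracle.Valid.resid_ae (hS : S.Valid P) {z : Vec d} (hz : z ∈ P.X) :
    ∀ᵐ y ∂S.residMarginal z, y ∈ P.X ∧ S.dataLaw P n y = S.dataLaw P n z := by
  cases S with
  | static κ =>
    have h : ∀ᵐ y ∂κ, y ∈ P.X := hS.2
    filter_upwards [h] with y hy using ⟨hy, rfl⟩
  | adaptive M =>
    have h : ∀ᵐ y ∂Measure.dirac z, y = z := (ae_dirac_iff (measurableSet_singleton z)).2 rfl
    exact h.mono fun y hy => by rw [hy]; exact ⟨hz, rfl⟩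

lemma gapFactor_nonneg {k B V : ℝ} (hk : 0 ≤ k) (hB : 0 ≤ B) (hV : 0 ≤ V) :
    0 ≤ gapFactor P k B V := by
  unfold gapFactor; positivity

lemma Estimators.MSERate.lintegral_surrogateGap_le {C r : ℝ} (hrate : est.MSERate P S C r)
    (hP : P.Regular) (hS : S.Valid P) (hest : est.Valid P S) (hC : 0 < C) (hr : 0 < r)
    {k B B' : ℝ} (hB : 0 ≤ B) (hB' : 0 ≤ B')
    (hk : 0 ≤ k) (hbd : ∀ x ∈ P.X, ‖P.c x‖ ≤ k ∧ ‖matOp (P.Q x)‖ ≤ k ∧ ‖matOp (P.Q x)⁻¹‖ ≤ k ∧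
      Real.sqrt (∑ j, ‖fderiv ℝ (P.q j) x‖ ^ 2) ≤ k ∧ ∀ y ∈ P.X, ‖y - x‖ ≤ k)
    (hnoise : ∀ᵐ e ∂P.noise, ‖e‖ ≤ B)
    (hestim : ∀ n, 0 < n → ∀ z ∈ P.X, ∀ᵐ s ∂S.dataLaw P n z, ‖est.c n s z‖ ≤ B')
    (hn : 0 < n) {z : Vec d} (hz : z ∈ P.X) :
    ∫⁻ p, surrogateGap P est z p ∂(S.dataLaw P n z).prod (S.residLaw P z)
      ≤ ENNReal.ofReal (gapFactor P k B (k + k * B + B') * (1 + (5 + l) * C)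
        * (n : ℝ) ^ (-(r / 2))) := by
  have := (hS.isProbabilityMeasure hP n hz).1
  have := (hS.isProbabilityMeasure hP n hz).2
  have : IsProbabilityMeasure (S.dataLaw P n z) := by unfold Oracle.dataLaw; infer_instance
  have := hS.prob_resid z
  have := hP.noise_prob
  have hκ := hS.resid_compl hP hz
  have hlaw : S.residLaw P z = ((S.residMarginal z).prod P.noise).map P.obsMap :=
    Oracle.residLaw_eq z
  have hgap : AEMeasurable (surrogateGap P est z)
      ((S.dataLaw P n z).prod (S.residLaw P z)) := by
    refine hP.aemeasurable_surrogateGap hest hκ z measurable_id ?_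
    rw [← Oracle.residLaw_eq]
    exact Measure.quasiMeasurePreserving_snd
  have hgap' := hgap.prod_swap.lintegral_prod_right'
  set F := gapFactor P k B (k + k * B + B') with hF
  have hF0 : 0 ≤ F := gapFactor_nonneg hk hB (by positivity)
  have hn1 : (1 : ℝ) ≤ n := by exact_mod_cast hn
  -- The balancing choice: the mean of the squared errors is of order `ε²`, so both terms of `ε + σ
  -- / ε` have expected order `ε`.
  set ε := (n : ℝ) ^ (-(r / 2)) with hε
  have hε0 : 0 < ε := Real.rpow_pos_of_pos (by positivity) _
  have hε1 : ε ≤ 1 := Real.rpow_le_one_of_one_le_of_nonpos hn1 (by linarith)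
  have hε2 : (n : ℝ) ^ (-r) = ε * ε := by
    rw [hε, ← Real.rpow_add (by positivity)]
    congr 1; ring
  rw [lintegral_prod_symm _ hgap]
  rw [hlaw] at hgap' ⊢
  refine (lintegral_map' hgap' (hP.aemeasurable_obsMap hκ)).le.trans ?_
  have hae : ∀ᵐ p ∂(S.residMarginal z).prod P.noise,
      ∫⁻ s, surrogateGap P est z (s, P.obsMap p) ∂S.dataLaw P n z
        ≤ ENNReal.ofReal (F * (1 + (5 + l) * C) * ε) := by
    filter_upwards [Measure.quasiMeasurePreserving_fst.ae (hS.resid_ae (n := n) hz),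
      Measure.quasiMeasurePreserving_snd.ae hnoise] with p hp he
    have h1 : ∀ᵐ s ∂S.dataLaw P n z, surrogateGap P est z (s, P.obsMap p)
        ≤ ENNReal.ofReal (F * ε)
          + ENNReal.ofReal (F / ε) * ENNReal.ofReal (sqError P est z p.1 s) := by
      have h2 := hestim n hn p.1 hp.1
      rw [hp.2] at h2
      filter_upwards [h2] with s hs
      have hsq : 0 ≤ sqError P est z p.1 s := by unfold sqError; positivity
      refine (hP.surrogateGap_le hB hB' hk hbd hz hp.1 he hs hε0 hε1).trans (le_of_eq ?_)
      rw [← ENNReal.ofReal_mul (by positivity), ← ENNReal.ofReal_add (by positivity)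
        (by positivity)]
      congr 1
      ring
    refine (lintegral_mono_ae h1).trans ?_
    rw [lintegral_add_left measurable_const, lintegral_const, measure_univ, mul_one,
      lintegral_const_mul' _ _ ENNReal.ofReal_ne_top]
    refine (add_le_add le_rfl (mul_le_mul_right
      (hrate.lintegral_sqError_le hest hC hn hz hp.1 hp.2) _)).trans (le_of_eq ?_)
    rw [← ENNReal.ofReal_mul (by positivity), ← ENNReal.ofReal_add (by positivity)
      (by positivity), hε2]
    congr 1
    field_simp
  refine (lintegral_mono_ae hae).trans ?_
  rw [lintegral_const, measure_univ, mul_one]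

/-- The proximal terms cancel and the average is bounded termwise, so the constant is uniform in `α`
and `m`. -/
lemma enorm_batch_sub_le (hm : 0 < m) (s : Dataset d l n) (w : Dataset d l m) (α : ℝ) (z : Vec d) :
    ⨆ x ∈ P.X, ‖learnedBatch P est s w α z x - conceptBatch P w α z x‖ₑ
      ≤ ENNReal.ofReal (1 / m) * ∑ i, surrogateGap P est z (s, w i) := by
  refine iSup₂_le fun x hx => ?_
  rw [learnedBatch_eq hm, conceptBatch_eq hm, add_sub_add_right_eq_sub, ← mul_sub,
    ← Finset.sum_sub_distrib, enorm_mul, Real.enorm_of_nonneg (by positivity)]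
  gcongr
  refine (enorm_sum_le _ _).trans (Finset.sum_le_sum fun i _ => ?_)
  exact le_iSup₂ (f := fun x (_ : x ∈ P.X) => ‖learnedCost P est s z (empResid est s (w i)) x
    - P.costModel z (trueResid P (w i)) x‖ₑ) x hx

lemma Estimators.MSERate.exists_surrogateErrorBound {C r : ℝ} (hrate : est.MSERate P S C r)
    (hP : P.Regular) (hS : S.Valid P) (hest : est.Valid P S) (hbdd : est.Bounded P S)
    (hC : 0 < C) (hr : 0 < r) : ∃ Ct : ℝ, 0 < Ct ∧ SurrogateErrorBound P S est r Ct := by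
  obtain ⟨B, hB, hnoise⟩ := hbdd.noise
  obtain ⟨B', hB', hestim⟩ := hbdd.estimate
  obtain ⟨k, hk, hbd⟩ := hP.exists_bounds
  have hF0 : 0 ≤ gapFactor P k B (k + k * B + B') := gapFactor_nonneg hk hB.le (by positivity)
  set K := gapFactor P k B (k + k * B + B') * (1 + (5 + l) * C) with hK
  have hK0 : 0 ≤ K := by positivity
  -- `K` vanishes when the cost is constant, and adding one makes the constant positive.
  refine ⟨K + 1, by positivity, fun n m hn hm α hα z hz => ?_⟩
  have := (hS.isProbabilityMeasure hP n hz).1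
  have := (hS.isProbabilityMeasure hP n hz).2
  have : IsProbabilityMeasure (S.dataLaw P n z) := by unfold Oracle.dataLaw; infer_instance
  have hgap : AEMeasurable (surrogateGap P est z)
      ((S.dataLaw P n z).prod (S.residLaw P z)) := by
    refine hP.aemeasurable_surrogateGap hest (hS.resid_compl hP hz) z measurable_id ?_
    rw [← Oracle.residLaw_eq]
    exact Measure.quasiMeasurePreserving_snd
  have hmp : ∀ i : Fin m, MeasurePreserving
      (fun D : Dataset d l n × Dataset d l m => (D.1, D.2 i)) (S.batchLaw P n m z)
      ((S.dataLaw P n z).prod (S.residLaw P z)) := fun i =>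
    (MeasurePreserving.id _).prod (measurePreserving_eval (fun _ : Fin m => S.residLaw P z) i)
  have hi : ∀ i : Fin m, ∫⁻ D, surrogateGap P est z (D.1, D.2 i) ∂S.batchLaw P n m z
      ≤ ENNReal.ofReal (K * (n : ℝ) ^ (-(r / 2))) := fun i => by
    have h1 := hrate.lintegral_surrogateGap_le hP hS hest hC hr hB.le hB'.le hk hbd hnoise hestim
      hn hz
    rw [← (hmp i).map_eq, lintegral_map' (by rwa [(hmp i).map_eq])
      (hmp i).measurable.aemeasurable] at h1
    exact h1
  have hgi : ∀ i : Fin m, AEMeasurable (fun D : Dataset d l n × Dataset d l m =>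
      surrogateGap P est z (D.1, D.2 i)) (S.batchLaw P n m z) := fun i =>
    hgap.comp_quasiMeasurePreserving (hmp i).quasiMeasurePreserving
  have hm' : (0 : ℝ) < m := by exact_mod_cast hm
  calc ∫⁻ D, ⨆ x ∈ P.X, ‖learnedBatch P est D.1 D.2 α z x - conceptBatch P D.2 α z x‖ₑ
        ∂S.batchLaw P n m z
      ≤ ∫⁻ D, ENNReal.ofReal (1 / m) * ∑ i, surrogateGap P est z (D.1, D.2 i)
          ∂S.batchLaw P n m z := lintegral_mono fun D => enorm_batch_sub_le hm _ _ _ _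
    _ = ENNReal.ofReal (1 / m) * ∑ i : Fin m,
          ∫⁻ D, surrogateGap P est z (D.1, D.2 i) ∂S.batchLaw P n m z := by
      rw [lintegral_const_mul' _ _ ENNReal.ofReal_ne_top, lintegral_finsetSum' _ fun i _ => hgi i]
    _ ≤ ENNReal.ofReal (1 / m) * ∑ i : Fin m, ENNReal.ofReal (K * (n : ℝ) ^ (-(r / 2))) := by
      gcongr with i
      exact hi i
    _ = ENNReal.ofReal (K * (n : ℝ) ^ (-(r / 2))) := by
      rw [Finset.sum_const, Finset.card_univ, Fintype.card_fin, nsmul_eq_mul, ← mul_assoc,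
        ← ENNReal.ofReal_natCast m, ← ENNReal.ofReal_mul (by positivity),
        one_div_mul_cancel hm'.ne', ENNReal.ofReal_one, one_mul]
    _ ≤ ENNReal.ofReal ((K + 1) * (n : ℝ) ^ (-(r / 2))) := by
      apply ENNReal.ofReal_le_ofReal
      gcongr
      linarith

end Rate

/-! ### The main result -/

lemma monotone_powerSeq {α₀ b : ℝ} (hα : 0 ≤ α₀) (hb : 0 ≤ b) : Monotone (powerSeq α₀ b) := by
  intro s t hst
  unfold powerSeq
  gcongr

lemma Problem.Regular.sq_dist_prox_le {d l : ℕ} {P : Problem d l} (hP : P.Regular) {ρ : ℝ}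
    (hρ : P.τ < ρ) {x : Vec d} (hx : x ∈ P.X) :
    ‖x - prox P.f P.X (1 / ρ) x‖ ^ 2 ≤ 2 * P.Δ₀ / ρ := by
  have hρ0 : 0 < ρ := P.τ_nonneg.trans_lt hρ
  have h1 := hP.envelope_le hρ x hx
  have h2 := hP.sub_le_Δ₀ hx (hP.prox_mem ⟨x, hx⟩ hρ x)
  rw [envelope, sub_self, norm_zero, norm_sub_rev] at h1
  rw [le_div_iff₀ hρ0]
  linarith

end SPDDU

end

theorem corollary1 {d l : ℕ} (P : SPDDU.Problem d l) (hP : P.Regular)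
    (S : SPDDU.Oracle d) (hS : S.Valid P)
    (est : SPDDU.Estimators d l) (hest : est.Valid P S) (hbdd : est.Bounded P S)
    (r C : ℝ) (hr : 0 < r) (hr1 : r ≤ 1) (hC : 0 < C) (hrate : est.MSERate P S C r) :
    -- a constant as in the surrogate error bound exists, and the rest holds for every such constant
    (∃ Ct : ℝ, 0 < Ct ∧ SPDDU.SurrogateErrorBound P S est r Ct) ∧
    ∀ Ct : ℝ, 0 < Ct → SPDDU.SurrogateErrorBound P S est r Ct →
      ∀ m : ℕ, 0 < m → ∀ ρ₀ α₀ : ℝ, P.τ < ρ₀ → ρ₀ + P.τ ≤ α₀ →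
        -- the proximal points are well defined
        (∀ x ∈ P.X, SPDDU.argminOn (fun y => P.f y + 1 / (2 * (1 / ρ₀)) * ‖y - x‖ ^ 2) P.X
          = {SPDDU.prox P.f P.X (1 / ρ₀) x}) ∧
        -- for every `b`, the guarantee holds, and it certifies near stationarity
        (∀ b ∈ Set.Icc (0 : ℝ) 1, ∀ n : ℕ, 0 < n → ∀ T : ℕ, ∀ z₀ : SPDDU.Vec d,
          ∀ (Ω : Type*) [MeasurableSpace Ω] (μ : MeasureTheory.Measure Ω)
            [MeasureTheory.IsProbabilityMeasure μ]
            (D : ℕ → Ω → SPDDU.Dataset d l n × SPDDU.Dataset d l m)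
            (z : ℕ → Ω → SPDDU.Vec d) (tstar : Ω → ℕ),
            SPDDU.IsRun P S est n m (SPDDU.powerSeq α₀ b) T z₀ μ D z →
            SPDDU.IsOutputIndex μ D T
              (SPDDU.polyak P.τ (SPDDU.constSeq ρ₀) (SPDDU.powerSeq α₀ b) T) tstar →
            MeasureTheory.Integrable (fun ω => ‖z (tstar ω) ω
              - SPDDU.prox P.f P.X (1 / ρ₀) (z (tstar ω) ω)‖ ^ 2) μ ∧
            ∫ ω, ‖z (tstar ω) ω - SPDDU.prox P.f P.X (1 / ρ₀) (z (tstar ω) ω)‖ ^ 2 ∂μ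
              ≤ SPDDU.guarantee P Ct r n m (SPDDU.constSeq ρ₀) (SPDDU.powerSeq α₀ b) T ∧
            ∀ ν δ : ℝ, 0 < ν → 0 < δ →
              SPDDU.Certified P Ct r n m (SPDDU.constSeq ρ₀) (SPDDU.powerSeq α₀ b) ν δ T →
              SPDDU.IsNSE μ P.f P.X ν δ fun ω => z (tstar ω) ω) ∧
        -- the order of the iteration complexity with `b = 1/2` is at most that with any other `b`
        (∀ b ∈ Set.Icc (0 : ℝ) 1, ∃ K : ℕ, ∀ n : ℕ, 0 < n → ∀ ν δ : ℝ, 0 < ν → 0 < δ →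
          SPDDU.iterComplexity P Ct r n m (SPDDU.constSeq ρ₀) (SPDDU.powerSeq α₀ (1 / 2)) ν δ
            ≤ K * SPDDU.iterComplexity P Ct r n m
                (SPDDU.constSeq ρ₀) (SPDDU.powerSeq α₀ b) ν δ) ∧
        -- and it is strictly smaller unless the cost is constant
        (0 < P.Lφ → ∀ b ∈ Set.Icc (0 : ℝ) 1, b ≠ 1 / 2 → ∀ K : ℕ, ∃ ε : ℝ, 0 < ε ∧
          ∀ n : ℕ, 0 < n → ∀ ν δ : ℝ, 0 < ν → 0 < δ → min (ρ₀ * δ) ν ≤ ε →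
            K * SPDDU.iterComplexity P Ct r n m
                (SPDDU.constSeq ρ₀) (SPDDU.powerSeq α₀ (1 / 2)) ν δ
              ≤ SPDDU.iterComplexity P Ct r n m
                (SPDDU.constSeq ρ₀) (SPDDU.powerSeq α₀ b) ν δ) ∧
        -- with `b = 1/2`, the averaging probabilities are proportional to `(t + 1)^(-1/2)`
        (∀ T : ℕ, ∀ t ≤ T,
          SPDDU.polyak P.τ (SPDDU.constSeq ρ₀) (SPDDU.powerSeq α₀ (1 / 2)) T t
            = ((t : ℝ) + 1) ^ (-(1 / 2) : ℝ)
              / ∑ s ∈ Finset.range (T + 1), ((s : ℝ) + 1) ^ (-(1 / 2) : ℝ)) ∧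
        -- and the output satisfies the explicit bound
        (∀ n : ℕ, 0 < n → ∀ T : ℕ, ∀ z₀ : SPDDU.Vec d,
          ∀ (Ω : Type*) [MeasurableSpace Ω] (μ : MeasureTheory.Measure Ω)
            [MeasureTheory.IsProbabilityMeasure μ]
            (D : ℕ → Ω → SPDDU.Dataset d l n × SPDDU.Dataset d l m)
            (z : ℕ → Ω → SPDDU.Vec d) (tstar : Ω → ℕ),
            SPDDU.IsRun P S est n m (SPDDU.powerSeq α₀ (1 / 2)) T z₀ μ D z →
            SPDDU.IsOutputIndex μ D T
              (SPDDU.polyak P.τ (SPDDU.constSeq ρ₀) (SPDDU.powerSeq α₀ (1 / 2)) T) tstar →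
            ∫ ω, ‖z (tstar ω) ω - SPDDU.prox P.f P.X (1 / ρ₀) (z (tstar ω) ω)‖ ^ 2 ∂μ
              ≤ 4 * P.Δ₀ * α₀ / (ρ₀ * (ρ₀ - P.τ)) * (1 / Real.sqrt ((T : ℝ) + 1))
                + 16 * P.L ^ 2 / (m * α₀ * (ρ₀ - P.τ))
                  * (Real.log ((T : ℝ) + 1) / Real.sqrt ((T : ℝ) + 1))
                + 4 * Ct / ((n : ℝ) ^ (r / 2) * (ρ₀ - P.τ))) := by
  refine ⟨hrate.exists_surrogateErrorBound hP hS hest hbdd hC hr, ?_⟩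
  intro Ct hCt hbound m hm ρ₀ α₀ hρ hα
  have hτ := P.τ_nonneg
  have hρ0 : 0 < ρ₀ := hτ.trans_lt hρ
  have hα0 : 0 < α₀ := by linarith
  have hΔ := hP.Δ₀_nonneg
  have hrun := fun (b : ℝ) (hb : b ∈ Set.Icc (0 : ℝ) 1) =>
    (⟨by simpa [SPDDU.powerSeq] using hα, SPDDU.monotone_powerSeq hα0.le hb.1⟩ :
      ρ₀ + P.τ ≤ SPDDU.powerSeq α₀ b 0 ∧ Monotone (SPDDU.powerSeq α₀ b))
  refine ⟨fun x hx => hP.argminOn_prox ⟨x, hx⟩ hρ x, ?_,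
    fun b hb => (SPDDU.exists_iterComplexity_half_le P Ct r hm hρ0 hρ hα0 hΔ hP.Δ₀_eq_zero hb).imp
      fun K hK n hn ν δ _ _ => hK n hn ν δ,
    fun hL b hb hb2 K => SPDDU.exists_mul_iterComplexity_half_le P hCt r hm hρ0 hρ hα0 hΔ
      ((NNReal.coe_pos.2 hL).trans_le SPDDU.Problem.Lφ_le_L) hb hb2 K,
    fun T t _ => SPDDU.polyak_half hρ0 hρ hα0 T t, ?_⟩
  · intro b hb n hn T z₀ Ω _ μ _ D z tstar hz ht
    obtain ⟨hle, hmeas, hint, hmain⟩ := hz.output_le hP hS hest hCt hbound hn hm hρ (hrun b hb).1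
      (hrun b hb).2 ht
    refine ⟨hint, hmain, fun ν δ hν hδ hcert => hP.isNSE_of_integral_le ⟨z₀, hz.start_mem⟩ hρ hν.le
      hδ.le hmeas (hle.mono fun ω hω => hz.mem (by omega) ω) hint (hmain.trans hcert.1) ?_⟩
    have h := hcert.2
    rw [SPDDU.scaledGuarantee_eq P Ct r n m hρ0 hρ hα0 b T] at h
    exact (mul_le_mul_of_nonneg_left hmain (sq_nonneg ρ₀)).trans h
  · intro n hn T z₀ Ω _ μ _ D z tstar hz ht
    have hb : (1 / 2 : ℝ) ∈ Set.Icc (0 : ℝ) 1 := ⟨by norm_num, by norm_num⟩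
    obtain ⟨hle, -, -, hmain⟩ := hz.output_le hP hS hest hCt hbound hn hm hρ (hrun _ hb).1
      (hrun _ hb).2 ht
    -- For `T = 0` the logarithmic term vanishes and cannot absorb the sampling term. The output is
    -- then `z₀`, whose squared distance to its proximal point is at most `2 Δ₀ / ρ₀`; the first
    -- term of the bound covers this because `ρ₀ - τ ≤ 2 α₀`.
    rcases Nat.eq_zero_or_pos T with rfl | hT
    · have h0 : ∀ᵐ ω ∂μ, ‖z (tstar ω) ω - SPDDU.prox P.f P.X (1 / ρ₀) (z (tstar ω) ω)‖ ^ 2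
          = ‖z₀ - SPDDU.prox P.f P.X (1 / ρ₀) z₀‖ ^ 2 := by
        filter_upwards [hle] with ω hω
        rw [Nat.le_zero.1 hω, hz.start]
      rw [MeasureTheory.integral_congr_ae h0]
      simp only [MeasureTheory.integral_const, MeasureTheory.probReal_univ, one_smul,
        Nat.cast_zero, zero_add, Real.log_one, Real.sqrt_one, mul_zero, div_one, mul_one,
        add_zero]
      have h1 := hP.sq_dist_prox_le hρ hz.start_mem
      have h2 : 2 * P.Δ₀ / ρ₀ ≤ 4 * P.Δ₀ * α₀ / (ρ₀ * (ρ₀ - P.τ)) := by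
        have h3 : 0 < ρ₀ - P.τ := by linarith
        rw [div_le_div_iff₀ hρ0 (mul_pos hρ0 h3)]
        have h4 := mul_nonneg (mul_nonneg hΔ hρ0.le) (by linarith : 0 ≤ 2 * α₀ - (ρ₀ - P.τ))
        linarith
      have h5 : 0 ≤ 4 * Ct / ((n : ℝ) ^ (r / 2) * (ρ₀ - P.τ)) := by
        have h3 : 0 < ρ₀ - P.τ := by linarith
        positivity
      linarith
    · exact hmain.trans (SPDDU.guarantee_half_le P Ct r hn hm hρ0 hρ hα0 hΔ hT)
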